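/- Setting. Let $M$ be a connected smooth manifold (Hausdorff, second countable, finite-dimensional) and $\mathfrak D(M)$ its space of smooth vector fields. Let $\Delta\subset TM$ be a distribution with weak derived flag $\Gamma(\Delta_1)=\Gamma(\Delta)$, $\Gamma(\Delta_{i+1})=\Gamma(\Delta_i)+[\Gamma(\Delta),\Gamma(\Delta_i)]$, $\Delta_0=0$; assume that all $\Delta_i$ have constant rank and that $\Delta_\nu=TM$ for some $\nu$. A filtered structure $\mathcal F$ on $M$ is such a $\Delta$ together with finitely many successive reductions $\Gamma_1,\dots,\Gamma_r$ of strictly increasing jet orders $k_1<\dots<k_r$. Here $\Gamma_j$ is encoded by the groupoid of those $k_j$-jets of local diffeomorphisms of $M$ that preserve the reduction: it contains the jets of the identity and is closed under composition and inversion, each of its jets at $x$ represented by $\varphi$ satisfies $d_x\varphi(\Delta_x)\subset\Delta_{\varphi(x)}$, and jets in $\Gamma_{j}$ project into $\Gamma_i$ for $i\le j$. An automorphism of $\mathcal F$ is a diffeomorphism of $M$ that preserves $\Delta$ and all of whose $k_j$-jets lie in $\Gamma_j$ for each $j$. The Lie equation $\mathfrak{Lie}(\mathcal F)$ is given by the set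 $\Box$ of linear differential operators $\mathfrak D(M)\to C^\infty(M)$ consisting of the operators $X\mapsto\alpha([X,v])$ with $v\in\Gamma(\Delta)$, $\alpha\in\Gamma(\Delta^\perp)$, and of the linearizations along the identity of the equations $j^{k_j}\varphi\in\Gamma_j$, i.e. the operators which locally have the form $X\mapsto dF_{j^{k_j}_x\mathrm{id}}(j^{k_j}_xX)$ with $F$ a smooth function, defined on the $k_j$-jets near those of the identity, that vanishes on $\Gamma_j$. A symmetry of $\mathcal F$ is a vector field $X\in\mathfrak D(M)$ with $\Box X=0$; $\mathcal S$ is the space of symmetries. Weighted jets. For $w\ge0$ let $D_{-w}$ be the span of the scalar operators $f\,v_1\cdots v_s$ with $f\in C^\infty(M)$, $v_t\in\Gamma(\Delta_{a_t})$, $a_1+\dots+a_s\le w$; let $\Omega^1_j=\Gamma(\Delta_{j-1}^\perp)$ for $j\ge1$; and let $\mathfrak D_{-i}$, $i\in\mathbb Z$, be the span of the operators $X\mapsto P(\alpha(X))$ with $P\in D_{-w}$, $\alpha\in\Omega^1_j$, $j-w=-i$, $j\ge1$, $w\ge0$. The weighted $i$-jet of $X$ at $x$ vanishes if $\nabla(X)_x=0$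 for all $\nabla\in\mathfrak D_{-i}$; $J(TM)_{i,x}$ denotes the space of weighted $i$-jets at $x$. Let $D[\Box]$ be the left $\mathrm{Diff}(M)$-module generated by $\Box$, and let $\mathcal E_i(x)\subset J(TM)_{i,x}$ consist of the jets of those $X$ with $\nabla(X)_x=0$ for all $\nabla\in D[\Box]\cap\mathfrak D_{-i}$. The Lie equation has finite type if, for some integer $\kappa\ge0$, the symbol $\mathrm{Ker}(\mathcal E_\kappa(x)\to J(TM)_{\kappa-1,x})$ vanishes for all $x\in M$. Let $\mathcal S^i_x$ be the set of symmetries with vanishing weighted $(i-1)$-jet at $x$. A vector field $X$ is $s$-jet determined at $x$ if its (standard) jets at $x$ satisfy $[X]^{s-1}_x=0$ and $[X]^s_x\neq0$. Theorem. Suppose that the Lie equation of $\mathcal F$ has finite type. Then: (1) There is $k$ such that any two symmetries of $\mathcal F$ with the same $k$-jet at some point of $M$ coincide. (2) There is $k$ such that any two automorphisms of $\mathcal F$ with the same $k$-jet at some point of $M$ coincide. (3) If $i\ge0$, $x\in M$, and $X\in\mathcal S^i_x\setminus\mathcal S^{i+1}_x$ is $s$-jet determined at $x$, then $$\lfloor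 i/\nu\rfloor+1\le s\le i+1 .$$ -/

import Mathlib

open scoped Manifold ContDiff Topology

noncomputable section

namespace FilteredGeometry

/-! ## Vector fields, one-forms, jets -/

section Basic

variable {E : Type*} [NormedAddCommGroup E] [NormedSpace ℝ E]
  {M : Type*} [TopologicalSpace M] [ChartedSpace E M] [IsManifold 𝓘(ℝ, E) ∞ M]

variable (E M) in
/-- Smooth vector fields on `M`. -/
abbrev VField : Type _ :=
  ContMDiffSection 𝓘(ℝ, E) E ∞ (fun x : M => TangentSpace 𝓘(ℝ, E) x)

variable (E M) in
/-- Smooth one-forms on `M`. -/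
abbrev OneForm : Type _ :=
  ContMDiffSection 𝓘(ℝ, E) (E →L[ℝ] ℝ) ∞
    (fun x : M => TangentSpace 𝓘(ℝ, E) x →L[ℝ] Bundle.Trivial M ℝ x)

/-- Pairing of a one-form with a vector field. -/
def OneForm.pair (α : OneForm E M) (X : VField E M) : M → ℝ := fun x => α x (X x)

/-- The derivative of a function along a vector field. -/
def VField.act (v : VField E M) (g : M → ℝ) : M → ℝ :=
  fun x => mfderiv 𝓘(ℝ, E) 𝓘(ℝ, ℝ) g x (v x)

/-- The expression of a vector field in the preferred chart at `p`. -/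
def VField.inChart (p : M) (X : VField E M) : E → E := fun y =>
  mfderiv 𝓘(ℝ, E) 𝓘(ℝ, E) (extChartAt 𝓘(ℝ, E) p) ((extChartAt 𝓘(ℝ, E) p).symm y)
    (X ((extChartAt 𝓘(ℝ, E) p).symm y))

/-- The expression of a map `M → M` in the preferred chart at `p` (in source and target). -/
def mapInChart (E : Type*) [NormedAddCommGroup E] [NormedSpace ℝ E]
    {M : Type*} [TopologicalSpace M] [ChartedSpace E M] (p : M) (φ : M → M) : E → E :=
  fun y => extChartAt 𝓘(ℝ, E) p (φ ((extChartAt 𝓘(ℝ, E) p).symm y))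

/-- Two vector fields have the same (standard) `k`-jet at `x`. -/
def SameFieldJet (k : ℕ) (X Y : VField E M) (x : M) : Prop :=
  ∀ m ≤ k, iteratedFDeriv ℝ m (X.inChart x) (extChartAt 𝓘(ℝ, E) x x) =
    iteratedFDeriv ℝ m (Y.inChart x) (extChartAt 𝓘(ℝ, E) x x)

/-- `X` is `s`-jet determined at `x`: its `(s-1)`-jet (in the standard jet filtration) at `x`
vanishes, but its `s`-jet does not. -/
def IsJetDetermined (s : ℕ) (X : VField E M) (x : M) : Prop :=
  (∀ m < s, iteratedFDeriv ℝ m (X.inChart x) (extChartAt 𝓘(ℝ, E) x x) = 0) ∧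
    iteratedFDeriv ℝ s (X.inChart x) (extChartAt 𝓘(ℝ, E) x x) ≠ 0

/-- Two maps `M → M` have the same `k`-jet at `x`. -/
def SameMapJet (E : Type*) [NormedAddCommGroup E] [NormedSpace ℝ E]
    {M : Type*} [TopologicalSpace M] [ChartedSpace E M] (k : ℕ) (φ ψ : M → M) (x : M) : Prop :=
  φ x = ψ x ∧ ∀ m ≤ k,
    iteratedFDeriv ℝ m (writtenInExtChartAt 𝓘(ℝ, E) 𝓘(ℝ, E) x φ) (extChartAt 𝓘(ℝ, E) x x) =
    iteratedFDeriv ℝ m (writtenInExtChartAt 𝓘(ℝ, E) 𝓘(ℝ, E) x ψ) (extChartAt 𝓘(ℝ, E) x x)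

/-- The space in which `k`-jets at a point of maps `E → E` take their values. -/
abbrev JetFiber (E : Type*) [NormedAddCommGroup E] [NormedSpace ℝ E] (k : ℕ) : Type _ :=
  (m : Fin (k + 1)) → (E [×(m : ℕ)]→L[ℝ] E)

/-- The `k`-jet of `g : E → E` at `y`. -/
def coordJet {E : Type*} [NormedAddCommGroup E] [NormedSpace ℝ E] (k : ℕ) (g : E → E) (y : E) :
    JetFiber E k :=
  fun m => iteratedFDeriv ℝ (m : ℕ) g y

/-- The type of operators sending vector fields to functions. All of those used below are
`T^*M`-valued differential operators (elements of `Diff(M) ⊗ Ω^1(M)`). -/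
abbrev Op (E : Type*) [NormedAddCommGroup E] [NormedSpace ℝ E]
    (M : Type*) [TopologicalSpace M] [ChartedSpace E M] [IsManifold 𝓘(ℝ, E) ∞ M] : Type _ :=
  VField E M → M → ℝ

/-! ## Distributions and the weak derived flag -/

variable (E M) in
/-- A smooth vector distribution of constant rank. -/
structure Distribution where
  space : (x : M) → Submodule ℝ (TangentSpace 𝓘(ℝ, E) x)
  smooth : ∀ x, ∀ v ∈ space x, ∃ X : VField E M, X x = v ∧ ∀ y, X y ∈ space y
  rank : ∃ r : ℕ, ∀ x, Module.finrank ℝ (space x) = r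

namespace Distribution

variable (Δ : Distribution E M)

/-- `Δ.Flag i X`: the field `X` is a section of `Δ_i`, the `i`-th member of the weak derived flag.
Here `Δ_0 = 0`, `Γ(Δ_1) = Γ(Δ)`, and `Γ(Δ_{i+1})` is the `C^∞(M)`-module generated by `Γ(Δ_i)`
and the brackets `[Γ(Δ), Γ(Δ_i)]`. -/
inductive Flag : ℕ → VField E M → Prop
  | zero (i : ℕ) : Flag i 0
  | base (X : VField E M) (h : ∀ x, X x ∈ Δ.space x) : Flag 1 X
  | mono (i : ℕ) (X : VField E M) (h : Flag i X) : Flag (i + 1) X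
  | bracket (i : ℕ) (X Y Z : VField E M) (hX : Flag 1 X) (hY : Flag i Y)
      (hZ : ∀ x, Z x = VectorField.mlieBracket 𝓘(ℝ, E) (fun y => X y) (fun y => Y y) x) :
      Flag (i + 1) Z
  | add (i : ℕ) (X Y : VField E M) (hX : Flag i X) (hY : Flag i Y) : Flag i (X + Y)
  | smul (i : ℕ) (f : M → ℝ) (hf : ContMDiff 𝓘(ℝ, E) 𝓘(ℝ, ℝ) ∞ f) (X Z : VField E M)
      (hX : Flag i X) (hZ : ∀ x, Z x = f x • X x) : Flag i Z

/-- The fibre of `Δ_i` at `x`. -/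
def flagAt (i : ℕ) (x : M) : Submodule ℝ (TangentSpace 𝓘(ℝ, E) x) :=
  Submodule.span ℝ {v | ∃ X : VField E M, Δ.Flag i X ∧ X x = v}

/-- `Ω^1_j`, the one-forms annihilating `Δ_{j-1}` (used for `j ≥ 1`). -/
def formFiltration (j : ℕ) : Set (OneForm E M) :=
  {α | ∀ X : VField E M, Δ.Flag (j - 1) X → ∀ x, α.pair X x = 0}

/-! ## The weighted filtration of differential operators, weighted jets -/

/-- The operator `g ↦ f · v₁(v₂(… v_s(g)))` on functions; the vector fields in the list carry
their weights. -/
def monomialOp (f : M → ℝ) (L : List (ℕ × VField E M)) (g : M → ℝ) : M → ℝ :=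
  fun x => f x * L.foldr (fun v h => v.2.act h) g x

/-- `𝔇_{-i}`, the member of index `-i` of the weighted filtration of `Diff(M) ⊗ Ω^1(M)`.
It is spanned by the operators `X ↦ f · v₁ ⋯ v_s (α(X))`, where `v_t` is a section of `Δ_{a_t}`,
the form `α` lies in `Ω^1_j` with `j ≥ 1`, and `a_1 + ⋯ + a_s ≤ i + j`; that is, `𝔇_{-i}` is the
sum of the `D_{-w} ⊗ Ω^1_j` with `j - w = -i`, `w ≥ 0`. -/
def opFiltration (i : ℤ) : Submodule ℝ (Op E M) :=
  Submodule.span ℝ {B | ∃ (j w : ℕ) (α : OneForm E M) (f : M → ℝ) (L : List (ℕ × VField E M)),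
    1 ≤ j ∧ (w : ℤ) = i + j ∧ α ∈ Δ.formFiltration j ∧
    ContMDiff 𝓘(ℝ, E) 𝓘(ℝ, ℝ) ∞ f ∧ (∀ p ∈ L, Δ.Flag p.1 p.2) ∧
    (L.map Prod.fst).sum ≤ w ∧ B = fun X => monomialOp f L (α.pair X)}

/-- The fields whose weighted `i`-jet at `x` vanishes; the fibre at `x` of the bundle `J(TM)_i` of
weighted `i`-jets is the quotient of the space of all vector fields by this subspace. -/
def weightedJetKer (i : ℤ) (x : M) : Set (VField E M) :=
  {X | ∀ B ∈ Δ.opFiltration i, B X x = 0}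

/-- The Lie equation of the distribution itself: the operators `X ↦ α([X, v])` with `v ∈ Γ(Δ)` and
`α ∈ Γ(Δ^⊥)`. -/
def lieOps : Set (Op E M) :=
  {B | ∃ (v : VField E M) (α : OneForm E M), Δ.Flag 1 v ∧ α ∈ Δ.formFiltration 2 ∧
    B = fun X x => α x (VectorField.mlieBracket 𝓘(ℝ, E) (fun y => X y) (fun y => v y) x)}

end Distribution

/-! ## Reductions and filtered structures -/

/-- A reduction, of jet order `k`, of the jets of local diffeomorphisms adapted to `Δ`, given by
the groupoid of those jets which preserve it: `mem φ x` says that the `k`-jet at `x` of the local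
diffeomorphism `φ` (whose values away from `x` are irrelevant) preserves the reduction. The
condition depends on the `k`-jet only, is satisfied by the identity, is stable under composition
and inversion, and its members preserve `Δ` at the point. -/
structure JetReduction (Δ : Distribution E M) (k : ℕ) where
  mem : (M → M) → M → Prop
  isLocalDiffeo : ∀ φ x, mem φ x → IsLocalDiffeomorphAt 𝓘(ℝ, E) 𝓘(ℝ, E) ∞ φ x
  preserves : ∀ φ x, mem φ x → ∀ v ∈ Δ.space x,
    mfderiv 𝓘(ℝ, E) 𝓘(ℝ, E) φ x v ∈ Δ.space (φ x)
  congr : ∀ φ ψ x, mem φ x → IsLocalDiffeomorphAt 𝓘(ℝ, E) 𝓘(ℝ, E) ∞ ψ x →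
    SameMapJet E k φ ψ x → mem ψ x
  one : ∀ x, mem id x
  comp : ∀ φ ψ x, mem φ x → mem ψ (φ x) → mem (ψ ∘ φ) x
  inv : ∀ φ ψ x, mem φ x → IsLocalDiffeomorphAt 𝓘(ℝ, E) 𝓘(ℝ, E) ∞ ψ (φ x) →
    (∀ᶠ y in 𝓝 x, ψ (φ y) = y) → mem ψ (φ x)

/-- The linearization along the identity of the nonlinear equation `j^k φ ∈ Γ`. An operator `B`
belongs to it if near every point `p`, in the chart at `p`, it is the derivative at the jets of the
identity of some smooth function `F` of the `k`-jets near that of the identity which vanishes on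
the jets belonging to `Γ`. (When these jets form a submanifold, the common solutions of these
operators on the level of `k`-jets are the vectors tangent to it along the identity.) -/
def JetReduction.linearization {Δ : Distribution E M} {k : ℕ} (Γ : JetReduction Δ k) :
    Set (Op E M) :=
  {B | ∀ p : M, ∃ (F : E × JetFiber E k → ℝ) (W : Set (E × JetFiber E k)),
    IsOpen W ∧
    (extChartAt 𝓘(ℝ, E) p p, coordJet k id (extChartAt 𝓘(ℝ, E) p p)) ∈ W ∧
    ContDiffOn ℝ ∞ F W ∧
    (∀ (φ : M → M) (x : M), Γ.mem φ x → x ∈ (extChartAt 𝓘(ℝ, E) p).source →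
      φ x ∈ (extChartAt 𝓘(ℝ, E) p).source →
      (extChartAt 𝓘(ℝ, E) p x, coordJet k (mapInChart E p φ) (extChartAt 𝓘(ℝ, E) p x)) ∈ W →
      F (extChartAt 𝓘(ℝ, E) p x,
        coordJet k (mapInChart E p φ) (extChartAt 𝓘(ℝ, E) p x)) = 0) ∧
    ∀ᶠ x in 𝓝 p, ∀ X : VField E M,
      B X x = fderiv ℝ (fun J : JetFiber E k => F (extChartAt 𝓘(ℝ, E) p x, J))
        (coordJet k id (extChartAt 𝓘(ℝ, E) p x))
        (coordJet k (X.inChart p) (extChartAt 𝓘(ℝ, E) p x))}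

variable (E M) in
/-- A filtered structure on `M`: a completely non-holonomic distribution, the weak derived flag of
which consists of subbundles, together with a finite number of successive reductions of increasing
orders. -/
structure FilteredStructure where
  dist : Distribution E M
  /-- The number `ν` with `Δ_ν = TM`. -/
  depth : ℕ
  flag_depth : ∀ x, dist.flagAt depth x = ⊤
  flag_rank : ∀ i, ∃ r : ℕ, ∀ x, Module.finrank ℝ (dist.flagAt i x) = r
  numRed : ℕ
  order : Fin numRed → ℕ
  order_strictMono : StrictMono order
  red : (j : Fin numRed) → JetReduction dist (order j)
  successive : ∀ i j : Fin numRed, i ≤ j → ∀ φ x, (red j).mem φ x → (red i).mem φ x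

/-- The left module over the algebra `Diff(M)` of scalar differential operators which is generated
by a set of operators. -/
inductive DModule (S : Set (Op E M)) : Op E M → Prop
  | of (B : Op E M) (h : B ∈ S) : DModule S B
  | zero : DModule S 0
  | add (B C : Op E M) (hB : DModule S B) (hC : DModule S C) : DModule S (B + C)
  | smul (f : M → ℝ) (hf : ContMDiff 𝓘(ℝ, E) 𝓘(ℝ, ℝ) ∞ f) (B : Op E M) (hB : DModule S B) :
      DModule S (fun X x => f x * B X x)
  | deriv (v : VField E M) (B : Op E M) (hB : DModule S B) : DModule S (fun X => v.act (B X))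

namespace FilteredStructure

variable (F : FilteredStructure E M)

/-- The operators defining the Lie equation of `F`. -/
def lieOps : Set (Op E M) :=
  F.dist.lieOps ∪ ⋃ j, (F.red j).linearization

/-- An (infinitesimal) symmetry of `F`: a solution of the Lie equation. -/
def IsSymmetry (X : VField E M) : Prop := ∀ B ∈ F.lieOps, ∀ x, B X x = 0

/-- An automorphism of `F`: a diffeomorphism of `M` that preserves the distribution and all the
reductions. -/
def IsAutomorphism (φ : Diffeomorph 𝓘(ℝ, E) 𝓘(ℝ, E) M M ∞) : Prop :=
  (∀ x, ∀ v ∈ F.dist.space x, mfderiv 𝓘(ℝ, E) 𝓘(ℝ, E) φ x v ∈ F.dist.space (φ x)) ∧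
    ∀ j x, (F.red j).mem φ x

/-- Representatives of the elements of the fibre at `x` of `ℰ_i ⊆ J(TM)_i`: the fields `X` with
`∇(X)_x = 0` for all operators `∇` in the generated module `D[□]` that belong to `𝔇_{-i}`. -/
def completed (i : ℤ) (x : M) : Set (VField E M) :=
  {X | ∀ B ∈ F.dist.opFiltration i, DModule F.lieOps B → B X x = 0}

/-- The Lie equation has finite type: for some `κ` the symbol `Ker(ℰ_κ → ℰ_{κ-1})` of the completed
equation vanishes at all points. -/
def FiniteType : Prop :=
  ∃ κ : ℕ, ∀ x, F.completed κ x ∩ F.dist.weightedJetKer ((κ : ℤ) - 1) x ⊆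
    F.dist.weightedJetKer κ x

/-- `𝒮^i`, the `i`-th member at `x` of the filtration of the symmetry algebra: the symmetries with
vanishing weighted `(i-1)`-jet at `x`. -/
def symFiltration (i : ℤ) (x : M) : Set (VField E M) :=
  {X | F.IsSymmetry X ∧ X ∈ F.dist.weightedJetKer (i - 1) x}

end FilteredStructure

end Basic

end FilteredGeometry

end

open FilteredGeometry

/-!
Fix a point `x₀`. A frame `V_1, …, V_n` of fields in the weak derived flag, adapted to the flag near
`x₀`, with its dual coframe `θ_k` and the weights `w_k`, makes everything explicit: the operators
`X ↦ V_s (θ_k X)`, where `V_s` is the ordered product of the `V_j` over a multiset `s` of indices of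
weight at most `i + w_k`, generate `𝔇_{-i}` over the smooth functions (a reordering of a product
produces shorter products of no larger weight), and their values at `x₀` can be prescribed.

*Finite type as a linear system.* If the symbol vanishes at `x₀`, then by duality every basic
operator of `𝔇_{-κ}` is, near `x₀`, the sum of an element of `D[□]` and a combination of basic
operators of `𝔇_{-(κ-1)}`. Hence the vector `u` of all basic operators of `𝔇_{-(κ-1)}`, applied to
a field `X`, satisfies `|Du| ≤ K |u| + K ∑ |C_j X|` with finitely many `C_j ∈ D[□]`, and it controls
`X` (`exists_prolongation_bound`).

*Symmetries.* For the difference of two symmetries the terms `C_j X` are zero, so the set of zeros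
of `u` is open and closed (`IsSymmetry.eq_zero`).

*Automorphisms.* Composition with an inverse reduces the claim to a map `φ` that preserves the
structure, fixes a point and is tangent to the identity there to a high order; it has to be the
identity. Every operator of `□` is the linearization of a smooth equation `Φ = 0` that holds for the
jets of all iterates of `φ` (`exists_local_equation`). Expanding `Φ` along Newton's interpolation of
the iterates shows that the formal logarithm of `φ`, truncated late, satisfies `□ X = 0` up to any
given order; the linear system then raises its order of vanishing, and with it that of `φ - id`
(`Preserves.vanishesToOrder_succ`). So `φ - id` is flat at the fixed point. A flat function need not
vanish, but for `w = φ - id`, regarded as a field, `□ w` is quadratic in a jet of `w`. By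
interpolation the supremum over a ball of a derivative of `w` is at most a power, with exponent
close to `1`, of the supremum of `w` itself, so the terms `C_j w` are small compared with `w`, which
the linear system forbids unless `w = 0` near the point (`Preserves.eventually_eq_id`). Hence the set
of points near which `φ` is the identity is open and closed.

*The inequalities.* A field with vanishing weighted `(i-1)`-jet is annihilated by all products of at
most `⌊i/ν⌋` derivations followed by a form, since each derivation has weight at most `ν`; this is
the lower bound. For the upper bound, the equation of the distribution expresses, for a symmetry,
the derivative along `Δ` of a component of weight `w ≥ 2` by components of weight at least `w - 1`,
so that a component of weight `w` vanishes along `Δ` to `w - 1` orders more than a standard jet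
would tell (`IsSymmetry.derivVanish`).
-/


noncomputable section

set_option linter.unusedSectionVars false

namespace FilteredGeometry

/-! ### Orders of vanishing and interpolation of derivatives -/

section Calculus

open Filter Asymptotics Metric

/-- A numerical differentiation formula: `∑ λ_j p(j) = p'(0)` for polynomials `p` of degree at
most `D`, expressed on monomials. -/
theorem exists_differentiation_weights (D : ℕ) :
    ∃ c : Fin (D + 1) → ℝ, ∀ m ≤ D, ∑ j, c j * (j : ℝ) ^ m = if m = 1 then 1 else 0 := by
  let V : Matrix (Fin (D + 1)) (Fin (D + 1)) ℝ := Matrix.vandermonde fun j => (j : ℝ)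
  have hV : IsUnit V.det := by
    rw [isUnit_iff_ne_zero, Matrix.det_vandermonde_ne_zero_iff]
    intro a b h
    exact Fin.ext (by simpa using h)
  let b : Fin (D + 1) → ℝ := fun m => if (m : ℕ) = 1 then 1 else 0
  refine ⟨Matrix.vecMul b V⁻¹, fun m hm => ?_⟩
  have h : Matrix.vecMul (Matrix.vecMul b V⁻¹) V = b := by
    rw [Matrix.vecMul_vecMul, Matrix.nonsing_inv_mul _ hV, Matrix.vecMul_one]
  have := congrFun h ⟨m, by omega⟩
  simpa [Matrix.vecMul, dotProduct, V, Matrix.vandermonde_apply, b] using this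

variable {E : Type*} [NormedAddCommGroup E] [NormedSpace ℝ E]
  {V : Type*} [NormedAddCommGroup V] [NormedSpace ℝ V]

theorem norm_sub_taylor_le [CompleteSpace V] {f : E → V} (hf : ContDiff ℝ ∞ f) (n : ℕ) (x y : E)
    {B : ℝ} (hB : ∀ t ∈ Set.Icc (0 : ℝ) 1, ‖iteratedFDeriv ℝ (n + 1) f (x + t • y)‖ ≤ B) :
    ‖f (x + y) - ∑ k ∈ Finset.range (n + 1),
      ((k.factorial : ℝ)⁻¹ • iteratedFDeriv ℝ k f x fun _ => y)‖ ≤ B * ‖y‖ ^ (n + 1) := by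
  have hf' : ContDiff ℝ (n + 1) f := hf.of_le (by exact_mod_cast le_top)
  rw [map_add_eq_sum_add_integral_iteratedFDeriv (n := n) fun t _ => hf'.contDiffAt,
    add_sub_cancel_left, norm_smul]
  have h1 : ‖∫ t in (0:ℝ)..1, (1 - t) ^ n • iteratedFDeriv ℝ (n + 1) f (x + t • y) fun _ => y‖
      ≤ (B * ‖y‖ ^ (n + 1)) * |1 - 0| := by
    refine intervalIntegral.norm_integral_le_of_norm_le_const fun t ht => ?_
    rw [Set.uIoc_of_le zero_le_one] at ht
    rw [norm_smul, norm_pow, Real.norm_of_nonneg (by linarith [ht.2])]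
    have h2 : (1 - t) ^ n ≤ 1 := pow_le_one₀ (by linarith [ht.2]) (by linarith [ht.1])
    have h3 : ‖(iteratedFDeriv ℝ (n + 1) f (x + t • y)) fun _ => y‖ ≤ B * ‖y‖ ^ (n + 1) := by
      refine (ContinuousMultilinearMap.le_opNorm _ _).trans ?_
      simp only [Finset.prod_const, Finset.card_univ, Fintype.card_fin]
      gcongr
      exact hB t ⟨ht.1.le, ht.2⟩
    calc _ ≤ 1 * (B * ‖y‖ ^ (n + 1)) := by gcongr
      _ = _ := one_mul _
  have h4 : ‖((n.factorial : ℝ)⁻¹)‖ ≤ 1 := by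
    rw [norm_inv, Real.norm_natCast]
    exact inv_le_one_of_one_le₀ (by exact_mod_cast Nat.factorial_pos n)
  calc _ ≤ 1 * ((B * ‖y‖ ^ (n + 1)) * |1 - 0|) := by gcongr
    _ = _ := by simp

theorem exists_bound_closedBall [FiniteDimensional ℝ E] {g : E → V} (hg : Continuous g) (x₀ : E)
    (r : ℝ) : ∃ B, 0 ≤ B ∧ ∀ y ∈ closedBall x₀ r, ‖g y‖ ≤ B := by
  have : ProperSpace E := FiniteDimensional.proper ℝ E
  obtain ⟨B, hB⟩ := (isCompact_closedBall x₀ r).exists_bound_of_continuousOn hg.continuousOn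
  exact ⟨max B 0, le_max_right _ _, fun y hy => (hB y hy).trans (le_max_left _ _)⟩

/-- The interpolation inequality of Landau and Kolmogorov on balls: the derivative of a smooth
function is bounded on a ball by the bound of the function on the same ball, divided by a length
`h`, up to an arbitrary power of `h`. No shrinking of the ball is needed: at each of its points, the
directions pointing into the ball span the space. -/
theorem exists_norm_fderiv_le_interpolation [FiniteDimensional ℝ E] [CompleteSpace V] {f : E → V}
    (hf : ContDiff ℝ ∞ f) (x₀ : E) (L : ℕ) :
    ∃ C, 0 ≤ C ∧ ∀ r, 0 < r → r ≤ 1 → ∀ h, 0 < h → h ≤ r → ∀ A, (∀ y ∈ closedBall x₀ r, ‖f y‖ ≤ A) →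
      ∀ y ∈ closedBall x₀ r, ‖fderiv ℝ f y‖ ≤ C * (A / h + h ^ L) := by
  set n := L + 1 with hn
  obtain ⟨c, hc⟩ := exists_differentiation_weights n
  obtain ⟨B, hB0, hB⟩ := exists_bound_closedBall
    (hf.continuous_iteratedFDeriv (m := n + 1) (by exact_mod_cast le_top)) x₀ 1
  set Λ := ∑ j, |c j| with hΛ
  have hΛ0 : 0 ≤ Λ := Finset.sum_nonneg fun j _ => abs_nonneg _
  set C₁ := n * Λ * (1 + B * 2 ^ (n + 1)) with hC₁
  have hC₁0 : 0 ≤ C₁ := by positivity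
  refine ⟨2 * C₁, by positivity, fun r hr hr1 h hh hhr A hA y hy => ?_⟩
  have hA0 : 0 ≤ A := (norm_nonneg _).trans (hA y hy)
  have hn0 : (0 : ℝ) < n := by positivity
  -- the estimate in a direction `d` that points into the ball
  have key : ∀ d : E, ‖d‖ ≤ 2 → (∀ t ∈ Set.Icc (0 : ℝ) r, y + t • d ∈ closedBall x₀ r) →
      ‖fderiv ℝ f y d‖ ≤ C₁ * (A / h + h ^ L) := by
    intro d hd hyd
    let t : Fin (n + 1) → ℝ := fun j => j * (h / n)
    have ht : ∀ j, t j ∈ Set.Icc 0 h := by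
      intro j
      refine ⟨by positivity, ?_⟩
      have : (j : ℝ) ≤ n := by exact_mod_cast Nat.lt_succ_iff.mp j.2
      calc (j : ℝ) * (h / n) ≤ n * (h / n) := by gcongr
        _ = h := by field_simp
    let R : Fin (n + 1) → V := fun j => f (y + t j • d) - ∑ k ∈ Finset.range (n + 1),
      ((k.factorial : ℝ)⁻¹ • iteratedFDeriv ℝ k f y fun _ => t j • d)
    have hR : ∀ j, ‖R j‖ ≤ B * 2 ^ (n + 1) * h ^ (n + 1) := by
      intro j
      refine (norm_sub_taylor_le hf n y (t j • d) (B := B) fun s hs => hB _ ?_).trans ?_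
      · refine closedBall_subset_closedBall hr1 ?_
        rw [smul_smul]
        refine hyd _ ⟨mul_nonneg hs.1 (ht j).1, ?_⟩
        calc s * t j ≤ 1 * h := mul_le_mul hs.2 (ht j).2 (ht j).1 zero_le_one
          _ ≤ r := by linarith
      · rw [norm_smul, Real.norm_of_nonneg (ht j).1, mul_pow, mul_comm (t j ^ (n + 1)), ← mul_assoc]
        have h1 := (ht j).1
        have h2 := (ht j).2
        gcongr
    have hsum : ∑ j, c j • f (y + t j • d) =
        (h / n) • fderiv ℝ f y d + ∑ j, c j • R j := by
      have h1 : ∀ j, f (y + t j • d) = (∑ k ∈ Finset.range (n + 1),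
          ((k.factorial : ℝ)⁻¹ • iteratedFDeriv ℝ k f y fun _ => t j • d)) + R j := by
        intro j; simp [R]
      rw [Finset.sum_congr rfl fun j _ => by rw [h1 j, smul_add], Finset.sum_add_distrib]
      congr 1
      simp_rw [Finset.smul_sum]
      rw [Finset.sum_comm]
      have h2 : ∀ k ∈ Finset.range (n + 1), ∑ j, c j • ((k.factorial : ℝ)⁻¹ •
          iteratedFDeriv ℝ k f y fun _ => t j • d) =
          (if k = 1 then (1 : ℝ) else 0) • ((h / n) ^ k • ((k.factorial : ℝ)⁻¹ •
            iteratedFDeriv ℝ k f y fun _ => d)) := by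
        intro k hk
        rw [← hc k (Nat.lt_succ_iff.mp (Finset.mem_range.mp hk)), Finset.sum_smul]
        refine Finset.sum_congr rfl fun j _ => ?_
        rw [ContinuousMultilinearMap.map_smul_univ]
        simp only [Finset.prod_const, Finset.card_univ, Fintype.card_fin, smul_smul, t, mul_pow]
        congr 1
        ring
      rw [Finset.sum_congr rfl h2]
      simp [ite_smul, iteratedFDeriv_one_apply, hn]
    have h3 : (h / n) • fderiv ℝ f y d = ∑ j, c j • (f (y + t j • d) - R j) := by
      simp_rw [smul_sub]
      rw [Finset.sum_sub_distrib, hsum, add_sub_cancel_right]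
    have h4 : (h / n) * ‖fderiv ℝ f y d‖ ≤ Λ * (A + B * 2 ^ (n + 1) * h ^ (n + 1)) := by
      rw [← Real.norm_of_nonneg (show 0 ≤ h / n by positivity), ← norm_smul, h3, hΛ,
        Finset.sum_mul]
      refine norm_sum_le_of_le _ fun j _ => ?_
      rw [norm_smul, Real.norm_eq_abs]
      refine mul_le_mul_of_nonneg_left ((norm_sub_le _ _).trans (add_le_add ?_ (hR j)))
        (abs_nonneg _)
      exact hA _ (hyd _ ⟨(ht j).1, (ht j).2.trans hhr⟩)
    have h5 : ‖fderiv ℝ f y d‖ ≤ n * Λ * (A / h + B * 2 ^ (n + 1) * h ^ n) := by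
      have : ‖fderiv ℝ f y d‖ = (n / h) * ((h / n) * ‖fderiv ℝ f y d‖) := by field_simp
      rw [this]
      calc _ ≤ (n / h) * (Λ * (A + B * 2 ^ (n + 1) * h ^ (n + 1))) := by gcongr
        _ = _ := by field_simp; ring
    refine h5.trans ?_
    rw [hC₁, mul_assoc ((n : ℝ) * Λ)]
    have h6 : h ^ n ≤ h ^ L := pow_le_pow_of_le_one hh.le (hhr.trans hr1) (by omega)
    have h7 : 0 ≤ A / h := by positivity
    have h8 : 0 ≤ B * 2 ^ (n + 1) := by positivity
    have h9 : 0 ≤ h ^ L := by positivity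
    refine mul_le_mul_of_nonneg_left ?_ (by positivity)
    nlinarith [mul_le_mul_of_nonneg_left h6 h8, mul_nonneg h8 h7]
  refine ContinuousLinearMap.opNorm_le_of_unit_norm (by positivity) fun e he => ?_
  rw [mem_closedBall, dist_eq_norm] at hy
  -- a unit vector is the difference of two vectors pointing into the ball
  have hdir : ∀ e' : E, ‖e'‖ ≤ 1 → ‖e' - r⁻¹ • (y - x₀)‖ ≤ 2 ∧
      ∀ t ∈ Set.Icc (0 : ℝ) r, y + t • (e' - r⁻¹ • (y - x₀)) ∈ closedBall x₀ r := by
    intro e' he'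
    have h1 : ‖r⁻¹ • (y - x₀)‖ ≤ 1 := by
      rw [norm_smul, norm_inv, Real.norm_of_nonneg hr.le]
      calc r⁻¹ * ‖y - x₀‖ ≤ r⁻¹ * r := by gcongr
        _ = 1 := inv_mul_cancel₀ hr.ne'
    refine ⟨(norm_sub_le _ _).trans (by linarith), fun t ht => ?_⟩
    rw [mem_closedBall, dist_eq_norm]
    have h2 : y + t • (e' - r⁻¹ • (y - x₀)) - x₀ = (1 - t * r⁻¹) • (y - x₀) + t • e' := by
      module
    have h3 : t * r⁻¹ ≤ 1 := by
      rw [← div_eq_mul_inv]; exact (div_le_one hr).2 ht.2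
    rw [h2]
    calc _ ≤ (1 - t * r⁻¹) * r + t * 1 := by
          refine (norm_add_le _ _).trans ?_
          rw [norm_smul, norm_smul, Real.norm_of_nonneg (by linarith : 0 ≤ 1 - t * r⁻¹),
            Real.norm_of_nonneg ht.1]
          exact add_le_add (mul_le_mul_of_nonneg_left hy (by linarith))
            (mul_le_mul_of_nonneg_left he' ht.1)
      _ = r := by field_simp; ring
  obtain ⟨h1, h2⟩ := hdir e he.le
  obtain ⟨h3, h4⟩ := hdir 0 (by simp)
  have h5 : fderiv ℝ f y e = fderiv ℝ f y (e - r⁻¹ • (y - x₀)) -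
      fderiv ℝ f y (0 - r⁻¹ • (y - x₀)) := by
    rw [← map_sub]; congr 1; abel
  rw [h5]
  refine (norm_sub_le _ _).trans ?_
  linarith [key _ h1 h2, key _ h3 h4]

/-- `f` vanishes to order `n` at `x₀`. -/
abbrev VanishesToOrder (n : ℕ) (f : E → V) (x₀ : E) : Prop :=
  f =O[𝓝 x₀] fun y => ‖y - x₀‖ ^ n

theorem VanishesToOrder.mono {n m : ℕ} (h : m ≤ n) {f : E → V} {x₀ : E}
    (hf : VanishesToOrder n f x₀) : VanishesToOrder m f x₀ := by
  refine hf.trans (IsBigO.of_bound 1 ?_)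
  filter_upwards [ball_mem_nhds x₀ zero_lt_one] with y hy
  rw [mem_ball, dist_eq_norm] at hy
  simp only [norm_pow, norm_norm, one_mul]
  exact pow_le_pow_of_le_one (norm_nonneg _) hy.le h

theorem VanishesToOrder.eq_zero {n : ℕ} (hn : n ≠ 0) {f : E → V} {x₀ : E}
    (hf : VanishesToOrder n f x₀) : f x₀ = 0 := by
  obtain ⟨C, hC⟩ := hf.bound
  have := hC.self_of_nhds
  simpa [hn] using this

theorem vanishesToOrder_zero {f : E → V} {x₀ : E} (hf : ContinuousAt f x₀) :
    VanishesToOrder 0 f x₀ := by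
  simp only [VanishesToOrder, pow_zero]
  exact hf.norm.isBoundedUnder_le.isBigO_one ℝ

/-- Differentiation lowers the order of vanishing by one. -/
theorem VanishesToOrder.fderiv [FiniteDimensional ℝ E] [CompleteSpace V] {f : E → V} {x₀ : E}
    {n : ℕ} (hf : ContDiff ℝ ∞ f) (h : VanishesToOrder (n + 1) f x₀) :
    VanishesToOrder n (_root_.fderiv ℝ f) x₀ := by
  obtain ⟨C, hC0, hC⟩ := h.exists_pos
  rw [IsBigOWith, Metric.eventually_nhds_iff_ball] at hC
  obtain ⟨ε, hε, hC⟩ := hC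
  obtain ⟨C', hC'0, hC'⟩ := exists_norm_fderiv_le_interpolation hf x₀ n
  have h0 : f x₀ = 0 := VanishesToOrder.eq_zero (Nat.succ_ne_zero n) h
  have main : ∀ y, ‖y - x₀‖ < min ε 1 → y ≠ x₀ →
      ‖_root_.fderiv ℝ f y‖ ≤ C' * (C + 1) * ‖y - x₀‖ ^ n := by
    intro y hy hne
    have hr : 0 < ‖y - x₀‖ := norm_pos_iff.2 (sub_ne_zero.2 hne)
    refine (hC' ‖y - x₀‖ hr (hy.le.trans (min_le_right _ _)) _ hr le_rfl
      (C * ‖y - x₀‖ ^ (n + 1)) (fun z hz => ?_) y (by simp [dist_eq_norm])).trans (le_of_eq ?_)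
    · rw [mem_closedBall, dist_eq_norm] at hz
      refine (hC z ?_).trans ?_
      · rw [mem_ball, dist_eq_norm]; exact hz.trans_lt (hy.trans_le (min_le_left _ _))
      · simp only [norm_pow, norm_norm]; gcongr
    · field_simp
      ring
  have hcont : Continuous fun y => C' * (C + 1) * ‖y - x₀‖ ^ n := by fun_prop
  refine IsBigO.of_bound (C' * (C + 1)) ?_
  simp only [norm_pow, norm_norm]
  rw [Metric.eventually_nhds_iff_ball]
  refine ⟨min ε 1, by positivity, fun y hy => ?_⟩
  rw [mem_ball, dist_eq_norm] at hy
  by_cases hne : y = x₀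
  · subst hne
    rcases subsingleton_or_nontrivial E with hE | hE
    · rw [Subsingleton.elim (_root_.fderiv ℝ f y) 0, norm_zero]; positivity
    · have : (𝓝[≠] y).NeBot := Module.punctured_nhds_neBot ℝ E y
      refine le_of_tendsto_of_tendsto (b := 𝓝[≠] y)
        (((hf.continuous_fderiv (by simp)).norm.tendsto y).mono_left nhdsWithin_le_nhds)
        ((hcont.tendsto y).mono_left nhdsWithin_le_nhds) ?_
      have h1 : ∀ᶠ z in 𝓝[≠] y, z ∈ ball y (min ε 1) :=
        nhdsWithin_le_nhds (ball_mem_nhds y (by positivity))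
      filter_upwards [h1, self_mem_nhdsWithin] with z hz hz'
      exact main z (by rwa [mem_ball, dist_eq_norm] at hz) hz'
  · exact main y hy hne

theorem VanishesToOrder.iteratedFDeriv [FiniteDimensional ℝ E] [CompleteSpace V] {f : E → V}
    {x₀ : E} {n m : ℕ} (hf : ContDiff ℝ ∞ f) (h : VanishesToOrder (n + m) f x₀) :
    VanishesToOrder n (_root_.iteratedFDeriv ℝ m f) x₀ := by
  induction m generalizing n with
  | zero =>
    refine IsBigO.of_norm_left ?_
    simp_rw [norm_iteratedFDeriv_zero]
    exact h.norm_left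
  | succ m ih =>
    have h1 : VanishesToOrder (n + 1) (_root_.iteratedFDeriv ℝ m f) x₀ :=
      ih (by rwa [Nat.add_right_comm, Nat.add_assoc])
    have h2 := h1.fderiv (hf.iteratedFDeriv_right (m := ∞) (mod_cast le_top))
    refine IsBigO.of_norm_left ?_
    simp_rw [← norm_fderiv_iteratedFDeriv]
    exact h2.norm_left

/-- A function vanishing at `x₀` whose derivative vanishes to order `n` vanishes to order
`n + 1`. -/
theorem VanishesToOrder.of_fderiv {f : E → V} {x₀ : E} {n : ℕ}
    (hf : ∀ᶠ y in 𝓝 x₀, DifferentiableAt ℝ f y) (h0 : f x₀ = 0)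
    (h : VanishesToOrder n (_root_.fderiv ℝ f) x₀) : VanishesToOrder (n + 1) f x₀ := by
  obtain ⟨C, hC⟩ := h.bound
  obtain ⟨ε, hε, H⟩ := Metric.eventually_nhds_iff_ball.1 (hC.and hf)
  refine IsBigO.of_bound C ?_
  filter_upwards [ball_mem_nhds x₀ hε] with y hy
  rw [mem_ball, dist_eq_norm] at hy
  have hsub : closedBall x₀ ‖y - x₀‖ ⊆ ball x₀ ε := closedBall_subset_ball hy
  have := (convex_closedBall x₀ ‖y - x₀‖).norm_image_sub_le_of_norm_fderiv_le (𝕜 := ℝ) (f := f)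
    (C := C * ‖y - x₀‖ ^ n) (x := x₀) (y := y) (fun z hz => (H z (hsub hz)).2) (fun z hz => ?_)
    (by simp) (by simp [dist_eq_norm])
  · rw [h0, sub_zero] at this
    refine this.trans (le_of_eq ?_)
    simp only [norm_pow, norm_norm]
    ring
  · have h1 := (H z (hsub hz)).1
    rw [mem_closedBall, dist_eq_norm] at hz
    have hC0 : 0 ≤ C ∨ C < 0 := le_or_gt 0 C
    rcases hC0 with hC0 | hC0
    · refine h1.trans ?_
      simp only [norm_pow, norm_norm]
      gcongr
    · have h2 := (norm_nonneg _).trans (H x₀ (mem_ball_self hε)).1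
      have h3 := (norm_nonneg _).trans (H y (by rwa [mem_ball, dist_eq_norm])).1
      have h4 : ‖_root_.fderiv ℝ f z‖ ≤ C * ‖z - x₀‖ ^ n := by simpa using h1
      have h5 : ‖z - x₀‖ ^ n = 0 := by
        have := (norm_nonneg _).trans h4
        nlinarith [pow_nonneg (norm_nonneg (z - x₀)) n]
      rw [h5, mul_zero] at h4
      have h6 : 0 ≤ C * ‖y - x₀‖ ^ n := by simpa using h3
      exact h4.trans h6

theorem vanishesToOrder_iff_iteratedFDeriv [FiniteDimensional ℝ E] [CompleteSpace V] {f : E → V}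
    {x₀ : E} {n : ℕ} (hf : ContDiff ℝ ∞ f) :
    VanishesToOrder n f x₀ ↔ ∀ m < n, iteratedFDeriv ℝ m f x₀ = 0 := by
  constructor
  · intro h m hm
    have h1 : VanishesToOrder (n - m) (_root_.iteratedFDeriv ℝ m f) x₀ :=
      VanishesToOrder.iteratedFDeriv hf (by rwa [Nat.sub_add_cancel hm.le])
    exact h1.eq_zero (by omega)
  · intro h
    rcases n with _ | n
    · exact vanishesToOrder_zero hf.continuous.continuousAt
    obtain ⟨B, -, hB⟩ := exists_bound_closedBall
      (hf.continuous_iteratedFDeriv (m := n + 1) (by exact_mod_cast le_top)) x₀ 1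
    refine IsBigO.of_bound B ?_
    filter_upwards [ball_mem_nhds x₀ zero_lt_one] with y hy
    rw [mem_ball, dist_eq_norm] at hy
    have h1 := norm_sub_taylor_le hf n x₀ (y - x₀) (B := B) fun t ht => hB _ ?_
    · rw [Finset.sum_eq_zero] at h1
      · simpa using h1
      · intro k hk
        rw [h k (Finset.mem_range.1 hk)]
        simp
    · rw [mem_closedBall, dist_eq_norm, add_sub_cancel_left, norm_smul,
        Real.norm_of_nonneg ht.1]
      exact mul_le_one₀ ht.2 (norm_nonneg _) hy.le

theorem VanishesToOrder.congr' {f g : E → V} {x₀ : E} {n : ℕ} (h : VanishesToOrder n f x₀)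
    (hfg : f =ᶠ[𝓝 x₀] g) : VanishesToOrder n g x₀ :=
  IsBigO.congr' h hfg .rfl

/-- On a small ball around a zero of `u`, a linear differential inequality for `u` with an error
`ε` bounds `u` by a multiple of `ε`. -/
theorem norm_le_of_norm_fderiv_le [FiniteDimensional ℝ E] {u : E → V} {x₀ : E} {r C ε : ℝ}
    (hr : 0 ≤ r) (hu : ∀ y ∈ closedBall x₀ r, DifferentiableAt ℝ u y) (h0 : u x₀ = 0)
    (hC : 0 ≤ C) (hCr : C * r ≤ 1 / 2)
    (h : ∀ y ∈ closedBall x₀ r, ‖fderiv ℝ u y‖ ≤ C * ‖u y‖ + ε) :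
    ∀ y ∈ closedBall x₀ r, ‖u y‖ ≤ 2 * r * ε := by
  have : ProperSpace E := FiniteDimensional.proper ℝ E
  obtain ⟨z, hz, hmax⟩ := (isCompact_closedBall x₀ r).exists_isMaxOn ⟨x₀, by simpa⟩
    (f := fun y => ‖u y‖) fun y hy => (hu y hy).continuousAt.norm.continuousWithinAt
  have hε : 0 ≤ C * ‖u z‖ + ε := (norm_nonneg _).trans (h z hz)
  have h1 := (convex_closedBall x₀ r).norm_image_sub_le_of_norm_fderiv_le (𝕜 := ℝ) (f := u)
    (C := C * ‖u z‖ + ε) (x := x₀) (y := z) hu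
    (fun y hy => (h y hy).trans (by have := hmax hy; simp only [Set.mem_ofPred_eq] at this; gcongr))
    (by simpa) hz
  rw [h0, sub_zero] at h1
  rw [mem_closedBall, dist_eq_norm] at hz
  have h2 : ‖u z‖ ≤ (C * ‖u z‖ + ε) * r := h1.trans (mul_le_mul_of_nonneg_left hz hε)
  intro y hy
  have h3 : ‖u y‖ ≤ ‖u z‖ := hmax hy
  nlinarith [norm_nonneg (u z)]

end Calculus

/-! ### Smooth functions, vector fields and one-forms -/

section Manifold

open Filter VectorField

variable {E : Type*} [NormedAddCommGroup E] [NormedSpace ℝ E]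
  {M : Type*} [TopologicalSpace M] [ChartedSpace E M]

/-- Smooth real functions on `M`. -/
abbrev IsSmooth (E : Type*) [NormedAddCommGroup E] [NormedSpace ℝ E]
    {M : Type*} [TopologicalSpace M] [ChartedSpace E M] (g : M → ℝ) : Prop :=
  ContMDiff 𝓘(ℝ, E) 𝓘(ℝ, ℝ) ∞ g

theorem IsSmooth.mdifferentiableAt {g : M → ℝ} (hg : IsSmooth E g) (x : M) :
    MDifferentiableAt 𝓘(ℝ, E) 𝓘(ℝ, ℝ) g x :=
  ContMDiff.mdifferentiableAt hg (by simp)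

theorem IsSmooth.const (c : ℝ) : IsSmooth E (fun _ : M => c) := contMDiff_const

theorem IsSmooth.add {f g : M → ℝ} (hf : IsSmooth E f) (hg : IsSmooth E g) :
    IsSmooth E (fun x => f x + g x) := ContMDiff.add hf hg

theorem IsSmooth.sub {f g : M → ℝ} (hf : IsSmooth E f) (hg : IsSmooth E g) :
    IsSmooth E (fun x => f x - g x) := ContMDiff.sub hf hg

theorem IsSmooth.mul {f g : M → ℝ} (hf : IsSmooth E f) (hg : IsSmooth E g) :
    IsSmooth E (fun x => f x * g x) := ContMDiff.smul hf hg

theorem IsSmooth.sum {ι : Type*} {s : Finset ι} {f : ι → M → ℝ}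
    (hf : ∀ i ∈ s, IsSmooth E (f i)) : IsSmooth E (fun x => ∑ i ∈ s, f i x) := by
  classical
  induction s using Finset.induction_on with
  | empty => simpa using IsSmooth.const 0
  | insert i s hi ih =>
    simp_rw [Finset.sum_insert hi]
    exact (hf i (Finset.mem_insert_self i s)).add
      (ih fun j hj => hf j (Finset.mem_insert_of_mem hj))

theorem IsSmooth.prod {ι : Type*} {s : Finset ι} {f : ι → M → ℝ}
    (hf : ∀ i ∈ s, IsSmooth E (f i)) : IsSmooth E (fun x => ∏ i ∈ s, f i x) := by
  classical
  induction s using Finset.induction_on with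
  | empty => simpa using IsSmooth.const 1
  | insert i s hi ih =>
    simp_rw [Finset.prod_insert hi]
    exact (hf i (Finset.mem_insert_self i s)).mul
      (ih fun j hj => hf j (Finset.mem_insert_of_mem hj))

theorem IsSmooth.pow {f : M → ℝ} (hf : IsSmooth E f) (n : ℕ) :
    IsSmooth E (fun x => f x ^ n) := by
  induction n with
  | zero => simpa using IsSmooth.const 1
  | succ n ih => simp_rw [pow_succ]; exact ih.mul hf

variable [IsManifold 𝓘(ℝ, E) ∞ M]

theorem OneForm.pair_smooth (α : OneForm E M) (X : VField E M) : IsSmooth E (α.pair X) := by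
  have h : ContMDiff 𝓘(ℝ, E) (𝓘(ℝ, E).prod 𝓘(ℝ, ℝ)) ∞
      (fun x => (⟨x, α x (X x)⟩ : Bundle.TotalSpace ℝ (Bundle.Trivial M ℝ))) :=
    ContMDiff.clm_bundle_apply (E₂ := Bundle.Trivial M ℝ) (F₂ := ℝ) (b := id) α.contMDiff X.contMDiff
  intro x
  exact (Bundle.contMDiffAt_totalSpace.1 (h x)).2

/-- The differential of a smooth function. -/
def OneForm.d (g : M → ℝ) (hg : IsSmooth E g) : OneForm E M where
  toFun x := mfderiv 𝓘(ℝ, E) 𝓘(ℝ, ℝ) g x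
  contMDiff_toFun := by
    intro x
    rw [contMDiffAt_hom_bundle]
    refine ⟨contMDiffAt_id, ?_⟩
    have := (hg x).mfderiv_const (m := ∞) (by simp)
    refine this.congr_of_eventuallyEq (Filter.Eventually.of_forall fun y => ?_)
    simp only [inTangentCoordinates, ContinuousLinearMap.inCoordinates]
    ext v
    simp
    rfl

theorem OneForm.d_pair (g : M → ℝ) (hg : IsSmooth E g) (X : VField E M) :
    (OneForm.d g hg).pair X = X.act g := rfl

theorem VField.act_smooth (X : VField E M) {g : M → ℝ} (hg : IsSmooth E g) :
    IsSmooth E (X.act g) :=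
  OneForm.pair_smooth (OneForm.d g hg) X

theorem VField.act_eq (X : VField E M) (g : M → ℝ) (x : M) :
    X.act g x = mvfderiv 𝓘(ℝ, E) g x (X x) := rfl

theorem VField.act_congr (X : VField E M) {f g : M → ℝ} {x : M} (h : f =ᶠ[𝓝 x] g) :
    X.act f x = X.act g x := by
  simp only [VField.act]
  rw [h.mfderiv_eq]
  rfl

theorem VField.act_eventuallyEq (X : VField E M) {f g : M → ℝ} {x : M} (h : f =ᶠ[𝓝 x] g) :
    X.act f =ᶠ[𝓝 x] X.act g :=
  h.eventually_nhds.mono fun _ hy => X.act_congr hy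

theorem VField.act_add (X : VField E M) {f g : M → ℝ} (hf : IsSmooth E f) (hg : IsSmooth E g)
    (x : M) : X.act (fun y => f y + g y) x = X.act f x + X.act g x := by
  simp only [VField.act_eq]
  have := mvfderiv_add (hf.mdifferentiableAt x) (hg.mdifferentiableAt x)
  exact congrArg (fun L => L (X x)) this

theorem VField.act_mul (X : VField E M) {f g : M → ℝ} (hf : IsSmooth E f) (hg : IsSmooth E g)
    (x : M) : X.act (fun y => f y * g y) x = X.act f x * g x + f x * X.act g x := by
  simp only [VField.act_eq]
  have := mvfderiv_mul (hf.mdifferentiableAt x) (hg.mdifferentiableAt x)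
  have h := congrArg (fun L => L (X x)) this
  refine h.trans ?_
  simp only [_root_.add_apply, _root_.smul_apply, smul_eq_mul]
  ring

theorem VField.act_const (X : VField E M) (c : ℝ) (x : M) : X.act (fun _ => c) x = 0 := by
  simp only [VField.act_eq]
  rw [mvfderiv_const]; rfl

theorem VField.act_sub (X : VField E M) {f g : M → ℝ} (hf : IsSmooth E f) (hg : IsSmooth E g)
    (x : M) : X.act (fun y => f y - g y) x = X.act f x - X.act g x := by
  simp only [VField.act_eq]
  have := mvfderiv_sub (hf.mdifferentiableAt x) (hg.mdifferentiableAt x)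
  exact congrArg (fun L => L (X x)) this

theorem VField.act_sum {ι : Type*} (X : VField E M) (s : Finset ι) {f : ι → M → ℝ}
    (hf : ∀ i ∈ s, IsSmooth E (f i)) (x : M) :
    X.act (fun y => ∑ i ∈ s, f i y) x = ∑ i ∈ s, X.act (f i) x := by
  classical
  induction s using Finset.induction_on with
  | empty => simpa using X.act_const 0 x
  | insert i s hi ih =>
    simp_rw [Finset.sum_insert hi]
    rw [X.act_add (hf i (Finset.mem_insert_self i s))
      (IsSmooth.sum fun j hj => hf j (Finset.mem_insert_of_mem hj)),
      ih fun j hj => hf j (Finset.mem_insert_of_mem hj)]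

theorem VField.act_pow (X : VField E M) {f : M → ℝ} (hf : IsSmooth E f) (n : ℕ) (x : M) :
    X.act (fun y => f y ^ (n + 1)) x = (n + 1) * f x ^ n * X.act f x := by
  induction n with
  | zero => simp
  | succ n ih =>
    simp_rw [pow_succ _ (n + 1)]
    rw [X.act_mul (hf.pow _) hf, ih]
    push_cast
    ring

/-- The product of a vector field with a smooth function. -/
def VField.smulFn (f : M → ℝ) (hf : IsSmooth E f) (X : VField E M) : VField E M where
  toFun x := f x • X x
  contMDiff_toFun := ContMDiff.smul_section hf X.contMDiff

/-- The product of a one-form with a smooth function. -/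
def OneForm.smulFn (f : M → ℝ) (hf : IsSmooth E f) (α : OneForm E M) : OneForm E M where
  toFun x := f x • α x
  contMDiff_toFun := ContMDiff.smul_section hf α.contMDiff

theorem OneForm.smulFn_pair (f : M → ℝ) (hf : IsSmooth E f) (α : OneForm E M) (X : VField E M)
    (x : M) : (OneForm.smulFn f hf α).pair X x = f x * α.pair X x := rfl

theorem OneForm.pair_add (α : OneForm E M) (X Y : VField E M) (x : M) :
    α.pair (X + Y) x = α.pair X x + α.pair Y x := (α x).map_add _ _

theorem OneForm.pair_smulFn (f : M → ℝ) (hf : IsSmooth E f) (α : OneForm E M) (X : VField E M)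
    (x : M) : α.pair (VField.smulFn f hf X) x = f x * α.pair X x := (α x).map_smul _ _

theorem OneForm.pair_sum {ι : Type*} (α : OneForm E M) (s : Finset ι) (X : ι → VField E M)
    (x : M) : α.pair (∑ i ∈ s, X i) x = ∑ i ∈ s, α.pair (X i) x := by
  classical
  induction s using Finset.induction_on with
  | empty => exact (α x).map_zero
  | insert i s hi ih => rw [Finset.sum_insert hi, Finset.sum_insert hi, α.pair_add, ih]

theorem OneForm.sum_pair {ι : Type*} (s : Finset ι) (α : ι → OneForm E M) (X : VField E M)
    (x : M) : OneForm.pair (∑ i ∈ s, α i) X x = ∑ i ∈ s, (α i).pair X x := by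
  classical
  induction s using Finset.induction_on with
  | empty => rfl
  | insert i s hi ih => rw [Finset.sum_insert hi, Finset.sum_insert hi, ← ih]; rfl

theorem VField.sum_apply {ι : Type*} (s : Finset ι) (X : ι → VField E M) (x : M) :
    (∑ i ∈ s, X i) x = ∑ i ∈ s, X i x := by
  classical
  induction s using Finset.induction_on with
  | empty => rfl
  | insert i s hi ih => rw [Finset.sum_insert hi, Finset.sum_insert hi, ← ih]; rfl

/-- The derivative of `g` along a vector field depends on the value of the field only. -/
theorem VField.act_eq_sum {ι : Type*} (s : Finset ι) (X : VField E M) (c : ι → ℝ)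
    (Y : ι → VField E M) (x : M) (h : X x = ∑ i ∈ s, c i • Y i x) (g : M → ℝ) :
    X.act g x = ∑ i ∈ s, c i * (Y i).act g x := by
  simp only [VField.act_eq]
  rw [h, map_sum]
  exact Finset.sum_congr rfl fun i _ => (mvfderiv 𝓘(ℝ, E) g x).map_smul _ _

theorem OneForm.pair_eq_sum {ι : Type*} (s : Finset ι) (α : OneForm E M) (X : VField E M)
    (c : ι → ℝ) (Y : ι → VField E M) (x : M) (h : X x = ∑ i ∈ s, c i • Y i x) :
    α.pair X x = ∑ i ∈ s, c i * α.pair (Y i) x := by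
  simp only [OneForm.pair]
  rw [h, map_sum]
  exact Finset.sum_congr rfl fun i _ => (α x).map_smul _ _

theorem natCast_le_infty (n : ℕ) : (n : WithTop ℕ∞) ≤ ∞ := mod_cast le_top

theorem isManifold_minSmoothness (n : ℕ) (M : Type*) [TopologicalSpace M] [ChartedSpace E M]
    [IsManifold 𝓘(ℝ, E) ∞ M] : IsManifold 𝓘(ℝ, E) (minSmoothness ℝ n) M :=
  .of_le (n := ∞) (by simp only [minSmoothness_of_isRCLikeNormedField]; exact_mod_cast le_top)

instance : IsManifold 𝓘(ℝ, E) (minSmoothness ℝ 2) M := isManifold_minSmoothness 2 M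
instance : IsManifold 𝓘(ℝ, E) (minSmoothness ℝ 3) M := isManifold_minSmoothness 3 M

variable [CompleteSpace E]

/-- The Lie bracket of vector fields. -/
def VField.bracket (X Y : VField E M) : VField E M where
  toFun x := mlieBracket 𝓘(ℝ, E) (fun y => X y) (fun y => Y y) x
  contMDiff_toFun :=
    haveI : IsManifold 𝓘(ℝ, E) (((⊤ : ℕ∞) : WithTop ℕ∞) + 1) M := .of_le (n := ∞) (by simp)
    ContDiff.mlieBracket_vectorField (m := ⊤) (n := ⊤) X.contMDiff Y.contMDiff (by simp)

theorem VField.mdiffAt (X : VField E M) (x : M) :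
    MDifferentiableAt 𝓘(ℝ, E) (𝓘(ℝ, E).prod 𝓘(ℝ, E))
      (fun y => (⟨y, X y⟩ : TangentBundle 𝓘(ℝ, E) M)) x :=
  X.contMDiff.mdifferentiableAt (by simp)

theorem VField.bracket_apply (X Y : VField E M) (x : M) :
    X.bracket Y x = mlieBracket 𝓘(ℝ, E) (fun y => X y) (fun y => Y y) x := rfl

theorem VField.bracket_swap (X Y : VField E M) (x : M) : X.bracket Y x = - Y.bracket X x :=
  mlieBracket_swap_apply

theorem VField.bracket_add_right (X Y Z : VField E M) (x : M) :
    X.bracket (Y + Z) x = X.bracket Y x + X.bracket Z x :=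
  mlieBracket_add_right (Y.mdiffAt x) (Z.mdiffAt x)

theorem VField.bracket_smulFn_right (f : M → ℝ) (hf : IsSmooth E f) (X Y : VField E M) (x : M) :
    X.bracket (VField.smulFn f hf Y) x = X.act f x • Y x + f x • X.bracket Y x :=
  mlieBracket_smul_right (hf.mdifferentiableAt x) (Y.mdiffAt x)

theorem VField.bracket_jacobi (X Y Z : VField E M) (x : M) :
    X.bracket (Y.bracket Z) x = (X.bracket Y).bracket Z x + Y.bracket (X.bracket Z) x :=
  have h : minSmoothness ℝ 2 ≤ ∞ := by
    simp only [minSmoothness_of_isRCLikeNormedField]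
    exact natCast_le_infty 2
  leibniz_identity_mlieBracket_apply ((X.contMDiff x).of_le h) ((Y.contMDiff x).of_le h)
    ((Z.contMDiff x).of_le h)

theorem VField.bracket_congr_right (X Y Z : VField E M) {x : M} (h : ∀ᶠ y in 𝓝 x, Y y = Z y) :
    X.bracket Y x = X.bracket Z x :=
  Filter.EventuallyEq.mlieBracket_vectorField_eq (Filter.Eventually.of_forall fun _ => rfl) h

omit [CompleteSpace E]

/-! ### Expressions in charts -/

/-- The expression of a function in the preferred chart at `p`. -/
def chartFn (E : Type*) [NormedAddCommGroup E] [NormedSpace ℝ E]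
    {M : Type*} [TopologicalSpace M] [ChartedSpace E M] {V : Type*} (p : M) (g : M → V) : E → V :=
  fun y => g ((extChartAt 𝓘(ℝ, E) p).symm y)

theorem chartFn_contDiffOn (p : M) {g : M → ℝ} (hg : IsSmooth E g) :
    ContDiffOn ℝ ∞ (chartFn E p g) (extChartAt 𝓘(ℝ, E) p).target := by
  rw [← contMDiffOn_iff_contDiffOn]
  exact (hg.comp_contMDiffOn (contMDiffOn_extChartAt_symm p))

theorem VField.inChart_contDiffOn (p : M) (X : VField E M) :
    ContDiffOn ℝ ∞ (X.inChart p) (extChartAt 𝓘(ℝ, E) p).target := by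
  rw [← contMDiffOn_iff_contDiffOn]
  have h := X.contMDiff.contMDiffOn (s := (trivializationAt E (TangentSpace 𝓘(ℝ, E)) p).baseSet)
  rw [(trivializationAt E (TangentSpace 𝓘(ℝ, E)) p).contMDiffOn_section_baseSet_iff] at h
  refine (h.comp (contMDiffOn_extChartAt_symm p) fun y hy => ?_).congr fun y hy => ?_
  · have := (extChartAt 𝓘(ℝ, E) p).map_target hy
    rwa [TangentBundle.trivializationAt_baseSet, ← extChartAt_source 𝓘(ℝ, E)]
  · have h1 := (extChartAt 𝓘(ℝ, E) p).map_target hy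
    rw [extChartAt_source] at h1
    simp only [VField.inChart, Function.comp]
    rw [← TangentBundle.continuousLinearMapAt_trivializationAt h1]
    have h2 := (trivializationAt E (TangentSpace 𝓘(ℝ, E)) p).coe_linearMapAt_of_mem (R := ℝ) h1
    exact congrFun h2 _

theorem VField.inChart_eq_mpullbackWithin [CompleteSpace E] (p : M) (X : VField E M) {y : E}
    (hy : y ∈ (extChartAt 𝓘(ℝ, E) p).target) :
    mpullbackWithin 𝓘(ℝ, E) 𝓘(ℝ, E) (extChartAt 𝓘(ℝ, E) p).symm X
      (Set.range 𝓘(ℝ, E)) y = X.inChart p y := by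
  rw [mpullbackWithin_apply, VField.inChart]
  have := ContinuousLinearMap.inverse_eq
    (mfderivWithin_extChartAt_symm_comp_mfderiv_extChartAt hy)
    (mfderiv_extChartAt_comp_mfderivWithin_extChartAt_symm hy)
  rw [this]
  rfl

theorem VField.inChart_self (x : M) (X : VField E M) :
    X.inChart x (extChartAt 𝓘(ℝ, E) x x) = X x := by
  simp only [VField.inChart]
  rw [extChartAt_to_inv, mfderiv_extChartAt_self]
  rfl

/-- In a chart, a vector field acts by differentiation in the direction of its expression. -/
theorem VField.act_chart (p : M) (X : VField E M) {g : M → ℝ} (hg : IsSmooth E g) {y : E}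
    (hy : y ∈ (extChartAt 𝓘(ℝ, E) p).target) :
    chartFn E p (X.act g) y = fderiv ℝ (chartFn E p g) y (X.inChart p y) := by
  set x := (extChartAt 𝓘(ℝ, E) p).symm y with hx
  have hxs : x ∈ (extChartAt 𝓘(ℝ, E) p).source := (extChartAt 𝓘(ℝ, E) p).map_target hy
  have hyx : extChartAt 𝓘(ℝ, E) p x = y := (extChartAt 𝓘(ℝ, E) p).right_inv hy
  have h1 : g =ᶠ[𝓝 x] chartFn E p g ∘ extChartAt 𝓘(ℝ, E) p := by
    filter_upwards [(isOpen_extChartAt_source p).mem_nhds hxs] with z hz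
    exact congrArg g ((extChartAt 𝓘(ℝ, E) p).left_inv hz).symm
  have h2 : MDifferentiableAt 𝓘(ℝ, E) 𝓘(ℝ, ℝ) (chartFn E p g) (extChartAt 𝓘(ℝ, E) p x) := by
    rw [hyx]
    exact (((chartFn_contDiffOn p hg).contDiffAt
      ((isOpen_extChartAt_target p).mem_nhds hy)).differentiableAt (by simp)).mdifferentiableAt
  have h3 : MDifferentiableAt 𝓘(ℝ, E) 𝓘(ℝ, E) (extChartAt 𝓘(ℝ, E) p) x :=
    mdifferentiableAt_extChartAt (by rwa [← extChartAt_source 𝓘(ℝ, E)])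
  have h4 : chartFn E p (X.act g) y = mfderiv 𝓘(ℝ, E) 𝓘(ℝ, ℝ) g x (X x) := rfl
  rw [h4, h1.mfderiv_eq]
  have h5 := mfderiv_comp_apply x h2 h3 (X x)
  refine h5.trans ?_
  rw [hyx, mfderiv_eq_fderiv]
  rfl

variable [CompleteSpace E]

theorem VField.bracket_inChart (X Y : VField E M) (x : M) :
    X.bracket Y x = fderiv ℝ (Y.inChart x) (extChartAt 𝓘(ℝ, E) x x) (X x) -
      fderiv ℝ (X.inChart x) (extChartAt 𝓘(ℝ, E) x x) (Y x) := by
  have hev : ∀ Z : VField E M, mpullbackWithin 𝓘(ℝ, E) 𝓘(ℝ, E) (extChartAt 𝓘(ℝ, E) x).symm Z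
      (Set.range 𝓘(ℝ, E)) =ᶠ[𝓝 (extChartAt 𝓘(ℝ, E) x x)] Z.inChart x := fun Z => by
    filter_upwards [extChartAt_target_mem_nhds x] with y hy
    exact Z.inChart_eq_mpullbackWithin x hy
  rw [VField.bracket_apply, ← mlieBracketWithin_univ, mlieBracketWithin_apply,
    mfderiv_extChartAt_self, Set.preimage_univ, Set.univ_inter]
  have h1 : (Set.range 𝓘(ℝ, E) : Set E) = Set.univ := by simp
  have h2 : lieBracketWithin ℝ (mpullbackWithin 𝓘(ℝ, E) 𝓘(ℝ, E) (extChartAt 𝓘(ℝ, E) x).symm X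
      (Set.range 𝓘(ℝ, E))) (mpullbackWithin 𝓘(ℝ, E) 𝓘(ℝ, E) (extChartAt 𝓘(ℝ, E) x).symm Y
      (Set.range 𝓘(ℝ, E))) (Set.range 𝓘(ℝ, E)) (extChartAt 𝓘(ℝ, E) x x) =
      lieBracket ℝ (X.inChart x) (Y.inChart x) (extChartAt 𝓘(ℝ, E) x x) := by
    rw [← lieBracketWithin_univ]
    conv_rhs => rw [← h1]
    exact ((hev X).filter_mono nhdsWithin_le_nhds).lieBracketWithin_vectorField_eq
      ((hev X).self_of_nhds) ((hev Y).filter_mono nhdsWithin_le_nhds) ((hev Y).self_of_nhds)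
  refine (congrArg (ContinuousLinearMap.id ℝ E).inverse h2).trans ?_
  rw [ContinuousLinearMap.inverse_id, ContinuousLinearMap.id_apply, lieBracket_eq]
  simp only [VField.inChart_self]

/-- The bracket acts on functions as the commutator of derivations. -/
theorem VField.bracket_act (X Y : VField E M) {g : M → ℝ} (hg : IsSmooth E g) (x : M) :
    (X.bracket Y).act g x = X.act (Y.act g) x - Y.act (X.act g) x := by
  set y := extChartAt 𝓘(ℝ, E) x x with hy
  have hyt : y ∈ (extChartAt 𝓘(ℝ, E) x).target := mem_extChartAt_target x
  have hnhds := (isOpen_extChartAt_target (E := E) x).mem_nhds hyt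
  have hch : ∀ Z : VField E M, ∀ h : M → ℝ, IsSmooth E h →
      Z.act h x = fderiv ℝ (chartFn E x h) y (Z x) := by
    intro Z h hh
    have := Z.act_chart x hh hyt
    rw [Z.inChart_self] at this
    rw [← this, chartFn, extChartAt_to_inv]
  have hG : ContDiffAt ℝ ∞ (chartFn E x g) y := (chartFn_contDiffOn x hg).contDiffAt hnhds
  have h2 : ∀ Z W : VField E M, Z.act (W.act g) x =
      fderiv ℝ (fderiv ℝ (chartFn E x g)) y (Z x) (W x) +
        fderiv ℝ (chartFn E x g) y (fderiv ℝ (W.inChart x) y (Z x)) := by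
    intro Z W
    rw [hch Z _ (W.act_smooth hg)]
    have hev : chartFn E x (W.act g) =ᶠ[𝓝 y]
        fun z => fderiv ℝ (chartFn E x g) z (W.inChart x z) := by
      filter_upwards [hnhds] with z hz
      exact W.act_chart x hg hz
    rw [hev.fderiv_eq]
    have hd1 : DifferentiableAt ℝ (fderiv ℝ (chartFn E x g)) y :=
      (hG.fderiv_right (m := 1) (natCast_le_infty 2)).differentiableAt (by simp)
    have hd2 : DifferentiableAt ℝ (W.inChart x) y :=
      ((W.inChart_contDiffOn x).contDiffAt hnhds).differentiableAt (by simp)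
    rw [fderiv_clm_apply hd1 hd2, W.inChart_self]
    exact add_comm _ _
  rw [hch _ _ hg, X.bracket_inChart Y, map_sub, h2, h2]
  have hsymm := (hG.isSymmSndFDerivAt (by simpa using natCast_le_infty 2)) (X x) (Y x)
  rw [hsymm]
  ring

/-! ### Extension of locally defined functions -/

variable [FiniteDimensional ℝ E] [T2Space M]

theorem exists_smooth_eq_of_contMDiffOn (x₀ : M) {U : Set M} (hU : IsOpen U) (hx : x₀ ∈ U)
    {f : M → ℝ} (hf : ContMDiffOn 𝓘(ℝ, E) 𝓘(ℝ, ℝ) ∞ f U) :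
    ∃ g : M → ℝ, IsSmooth E g ∧ (∀ᶠ x in 𝓝 x₀, g x = f x) := by
  obtain ⟨ρ, hρ⟩ := ((SmoothBumpFunction.nhds_basis_tsupport (I := 𝓘(ℝ, E)) x₀).mem_iff).1
    (hU.mem_nhds hx)
  refine ⟨fun x => ρ x • f x, contMDiff_of_tsupport fun x hx => ?_, ?_⟩
  · have hxU : x ∈ U := hρ.2 (tsupport_smul_subset_left _ _ hx)
    exact ρ.contMDiffAt.smul ((hf x hxU).contMDiffAt (hU.mem_nhds hxU))
  · filter_upwards [ρ.eventuallyEq_one] with x hx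
    simp [hx]

/-- A smooth function equal to `1` near `x₀` with support in a given neighbourhood. -/
theorem exists_smooth_cutoff (x₀ : M) {U : Set M} (hU : U ∈ 𝓝 x₀) :
    ∃ χ : M → ℝ, IsSmooth E χ ∧ (∀ᶠ x in 𝓝 x₀, χ x = 1) ∧ ∀ x ∉ U, χ x = 0 := by
  obtain ⟨ρ, hρ⟩ := ((SmoothBumpFunction.nhds_basis_tsupport (I := 𝓘(ℝ, E)) x₀).mem_iff).1 hU
  refine ⟨ρ, ρ.contMDiff, ρ.eventuallyEq_one, fun x hx => ?_⟩
  by_contra h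
  exact hx (hρ.2 (subset_tsupport _ h))

theorem exists_smooth_chartFn_eq (x₀ : M) {U : Set E} (hU : U ∈ 𝓝 (extChartAt 𝓘(ℝ, E) x₀ x₀))
    {f : E → ℝ} (hf : ContDiffOn ℝ ∞ f U) :
    ∃ g : M → ℝ, IsSmooth E g ∧
      chartFn E x₀ g =ᶠ[𝓝 (extChartAt 𝓘(ℝ, E) x₀ x₀)] f := by
  obtain ⟨W, hWU, hW, hxW⟩ := mem_nhds_iff.1 hU
  have hop : IsOpen ((extChartAt 𝓘(ℝ, E) x₀).source ∩ extChartAt 𝓘(ℝ, E) x₀ ⁻¹' W) :=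
    isOpen_extChartAt_preimage' x₀ hW
  obtain ⟨g, hg, hgf⟩ := exists_smooth_eq_of_contMDiffOn x₀ hop
    ⟨mem_extChartAt_source x₀, hxW⟩ (f := fun x => f (extChartAt 𝓘(ℝ, E) x₀ x))
    ((contMDiffOn_iff_contDiffOn.2 (hf.mono hWU)).comp
      ((contMDiffOn_extChartAt (n := ∞)).mono fun x hx => by
        rw [← extChartAt_source 𝓘(ℝ, E)]; exact hx.1) fun x hx => hx.2)
  refine ⟨g, hg, ?_⟩
  have h1 := (continuousAt_extChartAt_symm (I := 𝓘(ℝ, E)) x₀).eventually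
    (by rw [extChartAt_to_inv]; exact hgf)
  filter_upwards [h1, extChartAt_target_mem_nhds x₀] with y hy hyt
  rw [chartFn, hy, (extChartAt 𝓘(ℝ, E) x₀).right_inv hyt]

theorem exists_smooth_inverse (x₀ : M) {f : M → ℝ} (hf : IsSmooth E f) (h0 : f x₀ ≠ 0) :
    ∃ g : M → ℝ, IsSmooth E g ∧ ∀ᶠ x in 𝓝 x₀, g x * f x = 1 := by
  have hop : IsOpen {x | f x ≠ 0} := isOpen_ne_fun hf.continuous continuous_const
  obtain ⟨g, hg, hgf⟩ := exists_smooth_eq_of_contMDiffOn (E := E) x₀ hop h0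
    (f := fun x => (f x)⁻¹)
    (fun x hx => by
      have h1 : ContDiffAt ℝ ∞ (fun t : ℝ => t⁻¹) (f x) := contDiffAt_inv ℝ hx
      exact (h1.contMDiffAt.comp x (hf x)).contMDiffWithinAt)
  refine ⟨g, hg, ?_⟩
  filter_upwards [hgf, hop.mem_nhds h0] with x hx hx0
  rw [hx, inv_mul_cancel₀ hx0]

/-- A matrix of smooth functions that is invertible at a point has a smooth inverse near it. -/
theorem exists_smooth_matrix_inverse {ι : Type*} [Fintype ι] [DecidableEq ι] (x₀ : M)
    {A : M → Matrix ι ι ℝ} (hA : ∀ i j, IsSmooth E fun x => A x i j) (h0 : (A x₀).det ≠ 0) :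
    ∃ B : M → Matrix ι ι ℝ, (∀ i j, IsSmooth E fun x => B x i j) ∧
      ∀ᶠ x in 𝓝 x₀, B x * A x = 1 ∧ A x * B x = 1 := by
  have hdet : ∀ A : M → Matrix ι ι ℝ, (∀ i j, IsSmooth E fun x => A x i j) →
      IsSmooth E fun x => (A x).det := by
    intro A hA
    simp_rw [Matrix.det_apply']
    exact IsSmooth.sum fun σ _ => (IsSmooth.const _).mul (IsSmooth.prod fun i _ => hA _ _)
  obtain ⟨δ, hδ, hδ1⟩ := exists_smooth_inverse x₀ (hdet A hA) h0
  refine ⟨fun x => δ x • (A x).adjugate, fun i j => ?_, ?_⟩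
  · simp only [Matrix.smul_apply, smul_eq_mul, Matrix.adjugate_apply]
    refine hδ.mul (hdet _ fun k l => ?_)
    by_cases hk : k = j
    · subst hk
      simp only [Matrix.updateRow_self]
      exact IsSmooth.const _
    · simp only [Matrix.updateRow_ne hk]
      exact hA k l
  · filter_upwards [hδ1] with x hx
    rw [Matrix.smul_mul, Matrix.mul_smul, Matrix.adjugate_mul, Matrix.mul_adjugate, smul_smul, hx,
      one_smul]
    exact ⟨rfl, rfl⟩

end Manifold

/-! ### The weak derived flag and adapted frames -/

section Flag

open Filter

variable {E : Type*} [NormedAddCommGroup E] [NormedSpace ℝ E]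
  {M : Type*} [TopologicalSpace M] [ChartedSpace E M] [IsManifold 𝓘(ℝ, E) ∞ M]

namespace Distribution

variable {Δ : Distribution E M}

theorem Flag.mono_le {i j : ℕ} (hij : i ≤ j) {X : VField E M} (h : Δ.Flag i X) : Δ.Flag j X := by
  induction hij with
  | refl => exact h
  | step _ ih => exact .mono _ _ ih

theorem Flag.smulFn {i : ℕ} {f : M → ℝ} (hf : IsSmooth E f) {X : VField E M} (h : Δ.Flag i X) :
    Δ.Flag i (VField.smulFn f hf X) :=
  .smul i f hf X _ h fun _ => rfl

theorem Flag.const_smul {i : ℕ} (c : ℝ) {X : VField E M} (h : Δ.Flag i X) :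
    Δ.Flag i (c • X) :=
  .smul i (fun _ => c) (IsSmooth.const c) X _ h fun _ => rfl

theorem Flag.sub {i : ℕ} {X Y : VField E M} (hX : Δ.Flag i X) (hY : Δ.Flag i Y) :
    Δ.Flag i (X - Y) := by
  have : X - Y = X + (-1 : ℝ) • Y := by rw [neg_one_smul, sub_eq_add_neg]
  rw [this]
  exact .add i _ _ hX (hY.const_smul _)

theorem Flag.eq_zero {i : ℕ} {X : VField E M} (h : Δ.Flag i X) (hi : i = 0) : X = 0 := by
  induction h with
  | zero => rfl
  | base => omega
  | mono => omega
  | bracket => omega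
  | add i X Y _ _ ihX ihY => rw [ihX hi, ihY hi, add_zero]
  | smul i f _ X Z _ hZ ih =>
    ext x
    rw [hZ, ih hi]
    exact smul_zero _

/-- The weak derived flag is compatible with brackets: `[Γ(Δ_i), Γ(Δ_j)] ⊆ Γ(Δ_{i+j})`. -/
theorem Flag.lieBracket [CompleteSpace E] {i j : ℕ} {X Y : VField E M} (hX : Δ.Flag i X)
    (hY : Δ.Flag j Y) : Δ.Flag (i + j) (X.bracket Y) := by
  induction hX generalizing j Y with
  | zero i =>
    have : (0 : VField E M).bracket Y = 0 := by
      ext x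
      have := Y.bracket_smulFn_right (fun _ => 0) (IsSmooth.const 0) 0 x
      have h0 : VField.smulFn (fun _ => (0 : ℝ)) (IsSmooth.const 0) (0 : VField E M) = 0 := by
        ext y; exact smul_zero _
      rw [h0, Y.act_const] at this
      rw [VField.bracket_swap, this]
      simp
    rw [this]
    exact .zero _
  | base X h =>
    rw [add_comm]
    exact .bracket j X Y _ (.base X h) hY fun _ => rfl
  | mono i X _ ih => exact (ih hY).mono_le (by omega)
  | bracket i X Y' Z hX hY' hZ ihX ihY' =>
    have h1 := ihX (ihY' hY)
    have h2 := ihY' (ihX hY)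
    have h3 : Z = X.bracket Y' := by ext x; exact hZ x
    have : Z.bracket Y = X.bracket (Y'.bracket Y) - Y'.bracket (X.bracket Y) := by
      ext x
      rw [h3]
      have := X.bracket_jacobi Y' Y x
      change _ = X.bracket (Y'.bracket Y) x - Y'.bracket (X.bracket Y) x
      rw [this, add_sub_cancel_right]
    rw [this]
    exact (h1.mono_le (by omega)).sub (h2.mono_le (by omega))
  | add i X X' _ _ ihX ihX' =>
    have : (X + X').bracket Y = X.bracket Y + X'.bracket Y := by
      ext x
      change _ = X.bracket Y x + X'.bracket Y x
      rw [VField.bracket_swap, Y.bracket_add_right, X.bracket_swap, X'.bracket_swap, neg_add]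
    rw [this]
    exact .add _ _ _ (ihX hY) (ihX' hY)
  | smul i f hf X Z hX hZ ih =>
    have h3 : Z = VField.smulFn f hf X := by ext x; exact hZ x
    have : Z.bracket Y = VField.smulFn f hf (X.bracket Y) -
        VField.smulFn _ (Y.act_smooth hf) X := by
      ext x
      change _ = f x • X.bracket Y x - Y.act f x • X x
      rw [VField.bracket_swap, h3, Y.bracket_smulFn_right, X.bracket_swap, neg_add, smul_neg]
      abel
    rw [this]
    exact (ih hY).smulFn hf |>.sub ((hX.mono_le (by omega)).smulFn _)

theorem mem_flagAt {i : ℕ} {x : M} {v : TangentSpace 𝓘(ℝ, E) x} :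
    v ∈ Δ.flagAt i x ↔ ∃ X : VField E M, Δ.Flag i X ∧ X x = v := by
  refine ⟨fun h => ?_, fun h => Submodule.subset_span h⟩
  refine Submodule.span_induction (fun v h => h) ⟨0, .zero _, rfl⟩ ?_ ?_ h
  · rintro _ _ _ _ ⟨X, hX, rfl⟩ ⟨Y, hY, rfl⟩
    exact ⟨X + Y, .add _ _ _ hX hY, rfl⟩
  · rintro c _ _ ⟨X, hX, rfl⟩
    exact ⟨c • X, hX.const_smul c, rfl⟩

theorem flagAt_mono (x : M) : Monotone fun i => Δ.flagAt i x := by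
  intro i j hij v hv
  obtain ⟨X, hX, rfl⟩ := mem_flagAt.1 hv
  exact mem_flagAt.2 ⟨X, hX.mono_le hij, rfl⟩

theorem flagAt_zero (x : M) : Δ.flagAt 0 x = ⊥ := by
  rw [eq_bot_iff]
  intro v hv
  obtain ⟨X, hX, rfl⟩ := mem_flagAt.1 hv
  rw [hX.eq_zero rfl]
  exact Submodule.zero_mem _

theorem formFiltration_mono {i j : ℕ} (hij : i ≤ j) {α : OneForm E M}
    (h : α ∈ Δ.formFiltration j) : α ∈ Δ.formFiltration i :=
  fun X hX x => h X (hX.mono_le (by omega)) x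

end Distribution

/-- A chain of subspaces exhausting a finite-dimensional space has an adapted basis. -/
theorem exists_adapted_basis {T : Type*} [AddCommGroup T] [Module ℝ T]
    (S : ℕ → Submodule ℝ T) (hS : Monotone S) (h0 : S 0 = ⊥) (m : ℕ) :
    ∃ (s : Set T) (w : T → ℕ), LinearIndepOn ℝ id s ∧ (∀ v ∈ s, 1 ≤ w v ∧ w v ≤ m) ∧
      ∀ a ≤ m, S a = Submodule.span ℝ {v ∈ s | w v ≤ a} := by
  classical
  induction m with
  | zero =>
    refine ⟨∅, fun _ => 0, linearIndepOn_empty _ _, by simp, fun a ha => ?_⟩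
    rw [Nat.le_zero.1 ha, h0]
    simp
  | succ m ih =>
    obtain ⟨s, w, hs, hw, hspan⟩ := ih
    have hsub : s ⊆ (S (m + 1) : Set T) := by
      intro v hv
      refine hS (Nat.le_succ m) ?_
      rw [hspan m le_rfl]
      exact Submodule.subset_span ⟨hv, (hw v hv).2⟩
    obtain ⟨s', hs', hss', hspan', hli⟩ := exists_linearIndepOn_id_extension hs hsub
    refine ⟨s', fun v => if v ∈ s then w v else m + 1, hli, fun v hv => ?_, fun a ha => ?_⟩
    · by_cases h : v ∈ s
      · simp only [h, if_true]; have := hw v h; omega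
      · simp [h]
    · rcases Nat.lt_or_ge m a with h | h
      · obtain rfl : a = m + 1 := by omega
        have hall : s' ⊆ {v ∈ s' | (if v ∈ s then w v else m + 1) ≤ m + 1} := by
          intro u hu
          refine ⟨hu, ?_⟩
          by_cases h : u ∈ s
          · simp only [h, if_true]; have := hw u h; omega
          · simp [h]
        exact le_antisymm (fun v hv => Submodule.span_mono hall (hspan' hv))
          (Submodule.span_le.2 fun v hv => hs' hv.1)
      · rw [hspan a h]
        congr 1
        ext v
        simp only [Set.mem_ofPred_eq]
        constructor
        · rintro ⟨h1, h2⟩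
          exact ⟨hss' h1, by simpa [h1] using h2⟩
        · rintro ⟨h1, h2⟩
          by_cases h3 : v ∈ s
          · exact ⟨h3, by simpa [h3] using h2⟩
          · simp [h3] at h2; omega

/-- A frame near `x₀` adapted to the weak derived flag, together with its dual coframe. The fields
and the forms are globally defined; on the open set `dom` they are dual to each other. -/
structure AdaptedFrame (Δ : Distribution E M) (x₀ : M) where
  /-- The number of fields. -/
  n : ℕ
  /-- The fields of the frame. -/
  field : Fin n → VField E M
  /-- The weights of the fields. -/
  wt : Fin n → ℕ
  /-- The forms of the coframe. -/
  form : Fin n → OneForm E M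
  /-- The open set on which the frame and the coframe are dual. -/
  dom : Set M
  isOpen_dom : IsOpen dom
  mem_dom : x₀ ∈ dom
  field_flag : ∀ i, Δ.Flag (wt i) (field i)
  wt_pos : ∀ i, 1 ≤ wt i
  form_mem : ∀ i, form i ∈ Δ.formFiltration (wt i)
  pair_field : ∀ i j, ∀ y ∈ dom, (form i).pair (field j) y = if i = j then 1 else 0
  expand : ∀ X : VField E M, ∀ y ∈ dom, X y = ∑ i, (form i).pair X y • field i y

/-- Extensions of the coordinate functions of a chart, with respect to a basis of the model
space. -/
theorem exists_coordinate_functions [FiniteDimensional ℝ E] [T2Space M] (x₀ : M) {ι : Type*}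
    [Finite ι] (b : Module.Basis ι ℝ E) : ∃ c : ι → M → ℝ, (∀ l, IsSmooth E (c l)) ∧
      (∀ l, chartFn E x₀ (c l) =ᶠ[𝓝 (extChartAt 𝓘(ℝ, E) x₀ x₀)] b.coord l) ∧
      ∀ᶠ y in 𝓝 (extChartAt 𝓘(ℝ, E) x₀ x₀), ∀ l, ∀ X : VField E M,
        X.act (c l) ((extChartAt 𝓘(ℝ, E) x₀).symm y) = b.coord l (X.inChart x₀ y) := by
  have h : ∀ l, ∃ c : M → ℝ, IsSmooth E c ∧
      chartFn E x₀ c =ᶠ[𝓝 (extChartAt 𝓘(ℝ, E) x₀ x₀)] b.coord l := fun l =>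
    exists_smooth_chartFn_eq x₀ (U := Set.univ) univ_mem
      ((LinearMap.toContinuousLinearMap (b.coord l)).contDiff.contDiffOn)
  choose c hc hcl using h
  refine ⟨c, hc, hcl, ?_⟩
  have h2 : ∀ᶠ y in 𝓝 (extChartAt 𝓘(ℝ, E) x₀ x₀), ∀ l,
      chartFn E x₀ (c l) =ᶠ[𝓝 y] b.coord l := eventually_all.2 fun l => (hcl l).eventually_nhds
  filter_upwards [h2, extChartAt_target_mem_nhds x₀] with y hy hyt l X
  have h3 := X.act_chart x₀ (hc l) hyt
  rw [(hy l).fderiv_eq] at h3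
  refine h3.trans ?_
  have h4 := (LinearMap.toContinuousLinearMap (b.coord l)).fderiv (x := y)
  exact congrArg (fun L : E →L[ℝ] ℝ => L (X.inChart x₀ y)) h4

theorem VField.eq_of_inChart_eq (p : M) {X Y : VField E M} {y : E}
    (hy : y ∈ (extChartAt 𝓘(ℝ, E) p).target) (h : X.inChart p y = Y.inChart p y) :
    X ((extChartAt 𝓘(ℝ, E) p).symm y) = Y ((extChartAt 𝓘(ℝ, E) p).symm y) := by
  have hinv := isInvertible_mfderiv_extChartAt ((extChartAt 𝓘(ℝ, E) p).map_target hy)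
  exact hinv.injective h

/-- Adapted frames exist near every point: a basis of the tangent space adapted to the flag extends
to fields in the flag, and these stay adapted nearby because the flag has constant rank. -/
theorem FilteredStructure.nonempty_adaptedFrame [FiniteDimensional ℝ E] [T2Space M]
    (F : FilteredStructure E M) (x₀ : M) : Nonempty (AdaptedFrame F.dist x₀) := by
  classical
  have hfd : ∀ x : M, FiniteDimensional ℝ (TangentSpace 𝓘(ℝ, E) x) :=
    fun x => inferInstanceAs (FiniteDimensional ℝ E)
  obtain ⟨s, w, hs, hw, hspan⟩ := exists_adapted_basis (fun i => F.dist.flagAt i x₀)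
    (Distribution.flagAt_mono x₀) (Distribution.flagAt_zero x₀) F.depth
  have hspan' : ∀ a, F.dist.flagAt a x₀ = Submodule.span ℝ {v ∈ s | w v ≤ a} := by
    intro a
    rcases le_total a F.depth with h | h
    · exact hspan a h
    · refine le_antisymm ?_ (Submodule.span_le.2 ?_)
      · have h1 : F.dist.flagAt a x₀ ≤ F.dist.flagAt F.depth x₀ := by
          rw [F.flag_depth]; exact le_top
        refine h1.trans ?_
        have h2 := hspan F.depth le_rfl
        rw [h2]
        exact Submodule.span_mono fun v hv => ⟨hv.1, hv.2.trans h⟩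
      · intro v hv
        refine Distribution.flagAt_mono x₀ ((hw v hv.1).2.trans h) ?_
        have h2 := hspan (w v) (hw v hv.1).2
        change v ∈ F.dist.flagAt (w v) x₀
        rw [h2]
        exact Submodule.subset_span ⟨hv.1, le_rfl⟩
  have hsfin : s.Finite := hs.linearIndependent.setFinite
  have : Fintype s := hsfin.fintype
  have htop : (⊤ : Submodule ℝ (TangentSpace 𝓘(ℝ, E) x₀)) ≤ Submodule.span ℝ s := by
    rw [← F.flag_depth x₀, hspan']
    exact Submodule.span_mono fun v hv => hv.1
  let e : Fin (Fintype.card s) ≃ s := (Fintype.equivFin s).symm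
  have hb0 : LinearIndependent ℝ fun i => ((e i : s) : TangentSpace 𝓘(ℝ, E) x₀) :=
    hs.linearIndependent.comp e e.injective
  have hex : ∀ i, ∃ X : VField E M, F.dist.Flag (w (e i)) X ∧ X x₀ = (e i : s) := by
    intro i
    rw [← Distribution.mem_flagAt, hspan']
    exact Submodule.subset_span ⟨(e i).2, le_rfl⟩
  choose V hVflag hV0 using hex
  -- the basis of `E` given by the adapted basis at `x₀`
  let b : Module.Basis (Fin (Fintype.card s)) ℝ E :=
    Module.Basis.mk (M := TangentSpace 𝓘(ℝ, E) x₀) hb0 (by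
      refine htop.trans (Submodule.span_mono fun v hv => ⟨e.symm ⟨v, hv⟩, by simp⟩))
  have hbV : ∀ i, b i = V i x₀ := fun i => by
    rw [hV0]; exact Module.Basis.mk_apply (M := TangentSpace 𝓘(ℝ, E) x₀) _ _ i
  obtain ⟨c, hc, -, hcX⟩ := exists_coordinate_functions (M := M) x₀ b
  let A : M → Matrix (Fin (Fintype.card s)) (Fin (Fintype.card s)) ℝ :=
    fun x => Matrix.of fun l j => (V j).act (c l) x
  have hA0 : A x₀ = 1 := by
    ext l j
    have h := hcX.self_of_nhds l (V j)
    rw [extChartAt_to_inv, (V j).inChart_self, ← hbV] at h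
    simp only [A, Matrix.of_apply, h, Module.Basis.coord_apply, Module.Basis.repr_self,
      Matrix.one_apply, Finsupp.single_apply, eq_comm]
  obtain ⟨B, hB, hBA⟩ := exists_smooth_matrix_inverse (E := E) x₀ (A := A)
    (fun l j => (V j).act_smooth (hc l)) (by rw [hA0]; simp)
  -- the neighbourhood on which everything is adapted
  have hcX' : ∀ᶠ x in 𝓝 x₀, x ∈ (extChartAt 𝓘(ℝ, E) x₀).source ∧ ∀ X Y : VField E M,
      (∀ l, X.act (c l) x = Y.act (c l) x) → X x = Y x := by
    filter_upwards [(continuousAt_extChartAt (I := 𝓘(ℝ, E)) x₀).eventually hcX,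
      extChartAt_source_mem_nhds (I := 𝓘(ℝ, E)) x₀] with x hx hxs
    refine ⟨hxs, fun X Y hXY => ?_⟩
    have hxl := (extChartAt 𝓘(ℝ, E) x₀).left_inv hxs
    rw [← hxl]
    refine VField.eq_of_inChart_eq x₀ ((extChartAt 𝓘(ℝ, E) x₀).map_source hxs) ?_
    refine b.ext_elem fun l => ?_
    have h1 := hx l X
    have h2 := hx l Y
    rw [hxl] at h1 h2
    have := hXY l
    rw [h1, h2] at this
    exact this
  obtain ⟨U, hUsub, hU, hxU⟩ := eventually_nhds_iff.1 (hBA.and hcX')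
  obtain ⟨χ, hχ, hχ1, hχ0⟩ := exists_smooth_cutoff (E := E) x₀ (hU.mem_nhds hxU)
  obtain ⟨U', hU'sub, hU', hxU'⟩ := eventually_nhds_iff.1 (hχ1.and (hU.mem_nhds hxU))
  let θ : Fin (Fintype.card s) → OneForm E M := fun k =>
    ∑ l, OneForm.smulFn _ (hχ.mul (hB k l)) (OneForm.d (c l) (hc l))
  have hθ : ∀ k X x, (θ k).pair X x = χ x * ∑ l, B x k l * X.act (c l) x := by
    intro k X x
    rw [OneForm.sum_pair, Finset.mul_sum]
    refine Finset.sum_congr rfl fun l _ => ?_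
    rw [OneForm.smulFn_pair, OneForm.d_pair, mul_assoc]
  -- on `U` the dual forms, before the cutoff, are dual to the frame
  have hdual : ∀ x ∈ U, ∀ k j, ∑ l, B x k l * (V j).act (c l) x = if k = j then 1 else 0 := by
    intro x hx k j
    have := congrFun (congrFun (hUsub x hx).1.1 k) j
    rw [Matrix.mul_apply, Matrix.one_apply] at this
    exact this
  have hexp : ∀ x ∈ U, ∀ X : VField E M, X x = ∑ k, (∑ l, B x k l * X.act (c l) x) • V k x := by
    intro x hx X
    let Y : VField E M := ∑ k, (∑ l, B x k l * X.act (c l) x) • V k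
    have hY : Y x = ∑ k, (∑ l, B x k l * X.act (c l) x) • V k x := VField.sum_apply _ _ _
    rw [← hY]
    refine (hUsub x hx).2.2 X Y fun m => ?_
    rw [Y.act_eq_sum Finset.univ _ V x hY]
    have h1 : ∀ l, ∑ k, A x m k * B x k l = if m = l then 1 else 0 := by
      intro l
      have := congrFun (congrFun (hUsub x hx).1.2 m) l
      rwa [Matrix.mul_apply, Matrix.one_apply] at this
    simp_rw [Finset.sum_mul]
    rw [Finset.sum_comm]
    have h2 : ∀ l, ∑ k, B x k l * X.act (c l) x * (V k).act (c m) x =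
        (if m = l then 1 else 0) * X.act (c l) x := by
      intro l
      rw [← h1 l, Finset.sum_mul]
      refine Finset.sum_congr rfl fun k _ => ?_
      simp only [A, Matrix.of_apply]
      ring
    simp [h2]
  -- the flag near `x₀` is spanned by the fields of the corresponding weights
  have hflag : ∀ x ∈ U, ∀ a, F.dist.flagAt a x =
      Submodule.span ℝ (Set.range fun i : {i // w (e i) ≤ a} => V i x) := by
    intro x hx a
    have hli : LinearIndependent ℝ fun i => (V i x : TangentSpace 𝓘(ℝ, E) x) := by
      rw [Fintype.linearIndependent_iff]
      intro g hg k
      have h1 : ∑ j, g j * ∑ l, B x k l * (V j).act (c l) x = 0 := by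
        simp_rw [Finset.mul_sum]
        rw [Finset.sum_comm]
        refine Finset.sum_eq_zero fun l _ => ?_
        have h2 : (0 : VField E M).act (c l) x = ∑ j, g j * (V j).act (c l) x :=
          VField.act_eq_sum Finset.univ _ g V x hg.symm _
        have h3 : (0 : VField E M).act (c l) x = 0 := (mvfderiv 𝓘(ℝ, E) (c l) x).map_zero
        calc _ = B x k l * ∑ j, g j * (V j).act (c l) x := by
              rw [Finset.mul_sum]; exact Finset.sum_congr rfl fun j _ => by ring
          _ = 0 := by rw [← h2, h3, mul_zero]
      simpa [hdual x hx k] using h1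
    have hcard : ∀ y, ∀ hy : LinearIndependent ℝ (fun i => (V i y : TangentSpace 𝓘(ℝ, E) y)),
        Module.finrank ℝ (Submodule.span ℝ (Set.range fun i : {i // w (e i) ≤ a} =>
          (V i y : TangentSpace 𝓘(ℝ, E) y))) = Fintype.card {i // w (e i) ≤ a} := fun y hy =>
      finrank_span_eq_card (hy.comp _ Subtype.val_injective)
    obtain ⟨r, hr⟩ := F.flag_rank a
    have h0 : F.dist.flagAt a x₀ =
        Submodule.span ℝ (Set.range fun i : {i // w (e i) ≤ a} => V i x₀) := by
      rw [hspan']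
      congr 1
      ext v
      constructor
      · rintro ⟨hv, hva⟩
        exact ⟨⟨e.symm ⟨v, hv⟩, by simpa using hva⟩, by simp [hV0]⟩
      · rintro ⟨i, rfl⟩
        simp only [hV0]
        exact ⟨(e i).2, i.2⟩
    have hli0 : LinearIndependent ℝ (fun i => (V i x₀ : TangentSpace 𝓘(ℝ, E) x₀)) := by
      simp_rw [hV0]; exact hb0
    have hle : Submodule.span ℝ (Set.range fun i : {i // w (e i) ≤ a} =>
        (V i x : TangentSpace 𝓘(ℝ, E) x)) ≤ F.dist.flagAt a x := by
      rw [Submodule.span_le]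
      rintro _ ⟨i, rfl⟩
      exact Distribution.mem_flagAt.2 ⟨V i, (hVflag i).mono_le i.2, rfl⟩
    have := hfd x
    refine (Submodule.eq_of_le_of_finrank_eq hle ?_).symm
    rw [hcard x hli, hr x, ← hr x₀, h0, hcard x₀ hli0]
  refine ⟨⟨Fintype.card s, V, fun i => w (e i), θ, U', hU', hxU', hVflag,
    fun i => (hw _ (e i).2).1, fun k X hX x => ?_, fun k j x hx => ?_, fun X x hx => ?_⟩⟩
  · rw [hθ]
    by_cases hx : x ∈ U
    · have h1 : X x ∈ F.dist.flagAt (w (e k) - 1) x := Distribution.mem_flagAt.2 ⟨X, hX, rfl⟩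
      rw [hflag x hx, Submodule.mem_span_range_iff_exists_fun] at h1
      obtain ⟨g, hg⟩ := h1
      have h2 : ∀ l, X.act (c l) x = ∑ i, g i * (V (i : Fin _)).act (c l) x := fun l =>
        VField.act_eq_sum Finset.univ X g (fun i : {i // w (e i) ≤ w (e k) - 1} => V i) x hg.symm _
      have h3 : ∑ l, B x k l * X.act (c l) x =
          ∑ i, g i * ∑ l, B x k l * (V (i : Fin _)).act (c l) x := by
        simp_rw [h2, Finset.mul_sum]
        rw [Finset.sum_comm]
        exact Finset.sum_congr rfl fun i _ => Finset.sum_congr rfl fun l _ => by ring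
      rw [h3, Finset.sum_eq_zero, mul_zero]
      rintro ⟨i, hi⟩ -
      have hne : k ≠ i := by
        rintro rfl
        have := (hw _ (e k).2).1
        omega
      rw [hdual x hx, if_neg hne, mul_zero]
    · rw [hχ0 x hx, zero_mul]
  · rw [hθ, (hU'sub x hx).1, one_mul, hdual x (hU'sub x hx).2]
  · simp_rw [hθ, (hU'sub x hx).1, one_mul]
    exact hexp x (hU'sub x hx).2 X

end Flag

/-! ### Normal forms of weighted differential operators -/

section NormalForm

open Filter

variable {E : Type*} [NormedAddCommGroup E] [NormedSpace ℝ E]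
  {M : Type*} [TopologicalSpace M] [ChartedSpace E M] [IsManifold 𝓘(ℝ, E) ∞ M]

namespace AdaptedFrame

variable {Δ : Distribution E M} {x₀ : M} (A : AdaptedFrame Δ x₀)

theorem dom_mem_nhds {y : M} (hy : y ∈ A.dom) : A.dom ∈ 𝓝 y := A.isOpen_dom.mem_nhds hy

/-- The composition of the fields of the frame listed in `L`, acting on functions. -/
def word (L : List (Fin A.n)) (g : M → ℝ) : M → ℝ := L.foldr (fun j h => (A.field j).act h) g

/-- The weight of a list of indices of the frame. -/
def listWt (L : List (Fin A.n)) : ℕ := (L.map A.wt).sum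

/-- The weight of a multiset of indices of the frame. -/
def msWt (s : Multiset (Fin A.n)) : ℕ := (s.map A.wt).sum

theorem msWt_coe (L : List (Fin A.n)) : A.msWt (L : Multiset (Fin A.n)) = A.listWt L := by
  simp [msWt, listWt]

theorem listWt_cons (j : Fin A.n) (L : List (Fin A.n)) :
    A.listWt (j :: L) = A.wt j + A.listWt L := by simp [listWt]

theorem listWt_toList (s : Multiset (Fin A.n)) : A.listWt s.toList = A.msWt s := by
  rw [← msWt_coe, Multiset.coe_toList]

theorem card_le_msWt (s : Multiset (Fin A.n)) : s.card ≤ A.msWt s := by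
  induction s using Multiset.induction_on with
  | empty => simp
  | cons j s ih =>
    have := A.wt_pos j
    simp only [msWt, Multiset.map_cons, Multiset.sum_cons, Multiset.card_cons] at ih ⊢
    omega

theorem finite_msWt_le (n : ℤ) : {s : Multiset (Fin A.n) | (A.msWt s : ℤ) ≤ n}.Finite := by
  refine ((List.finite_length_le (Fin A.n) n.toNat).image
    (fun l : List (Fin A.n) => (l : Multiset (Fin A.n)))).subset fun s hs => ?_
  refine ⟨s.toList, ?_, Multiset.coe_toList s⟩
  have h1 := A.card_le_msWt s
  simp only [Set.mem_ofPred_eq, Multiset.length_toList] at hs ⊢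
  omega

/-- The multisets of indices of weight at most `n`. -/
def msIdx (n : ℤ) : Finset (Multiset (Fin A.n)) := (A.finite_msWt_le n).toFinset

theorem mem_msIdx {n : ℤ} {s : Multiset (Fin A.n)} : s ∈ A.msIdx n ↔ (A.msWt s : ℤ) ≤ n := by
  simp [msIdx]

theorem word_smooth (L : List (Fin A.n)) {g : M → ℝ} (hg : IsSmooth E g) :
    IsSmooth E (A.word L g) := by
  induction L with
  | nil => exact hg
  | cons j L ih => exact (A.field j).act_smooth ih

theorem word_eventuallyEq (L : List (Fin A.n)) {f g : M → ℝ} {x : M} (h : f =ᶠ[𝓝 x] g) :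
    A.word L f =ᶠ[𝓝 x] A.word L g := by
  induction L with
  | nil => exact h
  | cons j L ih => exact (A.field j).act_eventuallyEq ih

theorem word_cons (j : Fin A.n) (L : List (Fin A.n)) (g : M → ℝ) :
    A.word (j :: L) g = (A.field j).act (A.word L g) := rfl

/-- The operators on functions that are, on the domain of the frame, linear combinations over the
smooth functions of words of length less than `N` and of weight at most `n`. -/
inductive Comb : ℕ → ℤ → ((M → ℝ) → M → ℝ) → Prop
  | word (L : List (Fin A.n)) {N : ℕ} {n : ℤ} (hN : L.length < N) (hn : (A.listWt L : ℤ) ≤ n) :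
      Comb N n (A.word L)
  | zero {N : ℕ} {n : ℤ} : Comb N n fun _ _ => 0
  | add {N : ℕ} {n : ℤ} {P Q : (M → ℝ) → M → ℝ} (hP : Comb N n P) (hQ : Comb N n Q) :
      Comb N n fun g x => P g x + Q g x
  | smul {N : ℕ} {n : ℤ} {f : M → ℝ} (hf : IsSmooth E f) {P : (M → ℝ) → M → ℝ} (hP : Comb N n P) :
      Comb N n fun g x => f x * P g x
  | congr {N : ℕ} {n : ℤ} {P Q : (M → ℝ) → M → ℝ} (hP : Comb N n P)
      (hQ : ∀ g, IsSmooth E g → IsSmooth E (Q g))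
      (h : ∀ g, IsSmooth E g → ∀ y ∈ A.dom, Q g y = P g y) : Comb N n Q

variable {A}

theorem Comb.smooth {N : ℕ} {n : ℤ} {P : (M → ℝ) → M → ℝ} (hP : A.Comb N n P) {g : M → ℝ}
    (hg : IsSmooth E g) : IsSmooth E (P g) := by
  induction hP with
  | word L => exact A.word_smooth L hg
  | zero => exact .const 0
  | add _ _ ihP ihQ => exact ihP.add ihQ
  | smul hf _ ih => exact hf.mul ih
  | congr _ hQ _ => exact hQ g hg

theorem Comb.mono {N N' : ℕ} {n n' : ℤ} {P : (M → ℝ) → M → ℝ} (hP : A.Comb N n P) (hN : N ≤ N')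
    (hn : n ≤ n') : A.Comb N' n' P := by
  induction hP with
  | word L h1 h2 => exact .word L (h1.trans_le hN) (h2.trans hn)
  | zero => exact .zero
  | add _ _ ihP ihQ => exact .add (ihP hN hn) (ihQ hN hn)
  | smul hf _ ih => exact .smul hf (ih hN hn)
  | congr _ hQ h ih => exact .congr (ih hN hn) hQ h

theorem Comb.sum {N : ℕ} {n : ℤ} {ι : Type*} (s : Finset ι) {P : ι → (M → ℝ) → M → ℝ}
    (hP : ∀ i ∈ s, A.Comb N n (P i)) : A.Comb N n fun g x => ∑ i ∈ s, P i g x := by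
  classical
  induction s using Finset.induction_on with
  | empty => simpa using Comb.zero
  | insert i s hi ih =>
    simp_rw [Finset.sum_insert hi]
    exact .add (hP i (Finset.mem_insert_self i s)) (ih fun j hj => hP j (Finset.mem_insert_of_mem hj))

theorem Comb.field {N : ℕ} {n : ℤ} {P : (M → ℝ) → M → ℝ} (hP : A.Comb N n P) (j : Fin A.n) :
    A.Comb (N + 1) (n + A.wt j) fun g => (A.field j).act (P g) := by
  have hmono : ∀ {N n P}, A.Comb N n P → A.Comb (N + 1) (n + A.wt j) P :=
    fun h => h.mono (Nat.le_succ _) (by omega)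
  induction hP with
  | word L h1 h2 =>
    refine .word (j :: L) (by simpa using h1) ?_
    rw [listWt_cons]; push_cast; omega
  | zero =>
    exact .congr .zero (fun g _ => (A.field j).act_smooth (.const 0))
      fun g _ y _ => (A.field j).act_const 0 y
  | add hP hQ ihP ihQ =>
    exact .congr (.add ihP ihQ) (fun g hg => (A.field j).act_smooth ((hP.smooth hg).add (hQ.smooth hg)))
      fun g hg y _ => (A.field j).act_add (hP.smooth hg) (hQ.smooth hg) y
  | smul hf hP ih =>
    exact .congr (.add (.smul ((A.field j).act_smooth hf) (hmono hP)) (.smul hf ih))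
      (fun g hg => (A.field j).act_smooth (hf.mul (hP.smooth hg)))
      fun g hg y _ => (A.field j).act_mul hf (hP.smooth hg) y
  | congr hP hQ h ih =>
    refine .congr ih (fun g hg => (A.field j).act_smooth (hQ g hg)) fun g hg y hy => ?_
    refine (A.field j).act_congr ?_
    filter_upwards [A.dom_mem_nhds hy] with z hz
    exact h g hg z hz

theorem form_pair_eq_zero {a : ℕ} {v : VField E M} (hv : Δ.Flag a v) {k : Fin A.n}
    (hk : a < A.wt k) (y : M) : (A.form k).pair v y = 0 :=
  A.form_mem k v (hv.mono_le (by omega)) y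

/-- Composition with a section of `Δ_a` raises the weight by at most `a`. -/
theorem Comb.flag {N : ℕ} {n : ℤ} {P : (M → ℝ) → M → ℝ} (hP : A.Comb N n P) {a : ℕ}
    {v : VField E M} (hv : Δ.Flag a v) : A.Comb (N + 1) (n + a) fun g => v.act (P g) := by
  have h1 : A.Comb (N + 1) (n + a) fun g x =>
      ∑ k, (A.form k).pair v x * (A.field k).act (P g) x := by
    refine Comb.sum _ fun k _ => ?_
    by_cases hk : A.wt k ≤ a
    · exact .smul ((A.form k).pair_smooth v) ((hP.field k).mono le_rfl (by omega))
    · have h0 := A.form_pair_eq_zero hv (k := k) (by omega)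
      simpa [h0] using Comb.zero
  exact .congr h1 (fun g hg => v.act_smooth (hP.smooth hg)) fun g _ y hy =>
    VField.act_eq_sum _ v _ _ y (A.expand v y hy) _

/-- Reordering a word changes it by shorter words of no larger weight. -/
theorem comb_word_sub_of_perm [CompleteSpace E] {L L' : List (Fin A.n)} (h : L.Perm L') :
    A.Comb L.length (A.listWt L) fun g x => A.word L g x - A.word L' g x := by
  induction h with
  | nil => simpa using Comb.zero
  | @cons j L L' _ ih =>
    refine .congr ((ih.field j).mono le_rfl ?_)
      (fun g hg => (A.word_smooth _ hg).sub (A.word_smooth _ hg)) fun g hg y _ => ?_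
    · rw [listWt_cons]; push_cast; omega
    · exact ((A.field j).act_sub (A.word_smooth L hg) (A.word_smooth L' hg) y).symm
  | swap i j L =>
    have h1 : A.Comb (L.length + 1) (A.listWt L) (A.word L) := .word L (Nat.lt_succ_self _) le_rfl
    refine .congr ((h1.flag ((A.field_flag j).lieBracket (A.field_flag i))).mono le_rfl ?_)
      (fun g hg => (A.word_smooth _ hg).sub (A.word_smooth _ hg)) fun g hg y _ => ?_
    · rw [listWt_cons, listWt_cons]; push_cast; omega
    · exact ((A.field j).bracket_act (A.field i) (A.word_smooth L hg) y).symm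
  | @trans L₁ L₂ L₃ h12 _ ih1 ih2 =>
    rw [← h12.length_eq, show A.listWt L₂ = A.listWt L₁ from ((h12.map A.wt).sum_eq).symm] at ih2
    refine .congr (.add ih1 ih2) (fun g hg => (A.word_smooth _ hg).sub (A.word_smooth _ hg))
      fun g _ y _ => by ring

/-- Every combination of words is, on the domain of the frame, a combination of the words
representing the multisets of indices. -/
theorem Comb.exists_normalForm [CompleteSpace E] {N : ℕ} {n : ℤ} {P : (M → ℝ) → M → ℝ}
    (hP : A.Comb N n P) : ∃ c : Multiset (Fin A.n) → M → ℝ, (∀ s, IsSmooth E (c s)) ∧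
      ∀ g, IsSmooth E g → ∀ y ∈ A.dom, P g y = ∑ s ∈ A.msIdx n, c s y * A.word s.toList g y := by
  classical
  induction N using Nat.strong_induction_on generalizing n P with
  | _ N IH =>
  induction hP with
  | @word L N n h1 h2 =>
    have hperm : L.Perm (L : Multiset (Fin A.n)).toList := by
      rw [← Multiset.coe_eq_coe, Multiset.coe_toList]
    obtain ⟨c, hc, h⟩ := IH _ h1 ((comb_word_sub_of_perm hperm).mono le_rfl h2)
    refine ⟨fun s y => c s y + if s = L then 1 else 0, fun s => (hc s).add (.const _),
      fun g hg y hy => ?_⟩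
    have h3 := h g hg y hy
    have h4 : (L : Multiset (Fin A.n)) ∈ A.msIdx n := A.mem_msIdx.2 (by rwa [msWt_coe])
    simp_rw [add_mul, Finset.sum_add_distrib, ← h3]
    simp [h4]
  | zero => exact ⟨fun _ _ => 0, fun _ => .const 0, by simp⟩
  | add _ _ ihP ihQ =>
    obtain ⟨c, hc, h⟩ := ihP IH
    obtain ⟨d, hd, h'⟩ := ihQ IH
    refine ⟨fun s y => c s y + d s y, fun s => (hc s).add (hd s), fun g hg y hy => ?_⟩
    simp_rw [add_mul, Finset.sum_add_distrib, ← h g hg y hy, ← h' g hg y hy]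
  | @smul _ _ f hf _ _ ih =>
    obtain ⟨c, hc, h⟩ := ih IH
    refine ⟨fun s y => f y * c s y, fun s => hf.mul (hc s), fun g hg y hy => ?_⟩
    simp_rw [mul_assoc, ← Finset.mul_sum, ← h g hg y hy]
  | congr _ _ h ih =>
    obtain ⟨c, hc, h'⟩ := ih IH
    exact ⟨c, hc, fun g hg y hy => (h g hg y hy).trans (h' g hg y hy)⟩

/-- The composition of multiplication by a smooth function with sections of the flag. -/
theorem comb_foldr {L : List (ℕ × VField E M)} (hL : ∀ p ∈ L, Δ.Flag p.1 p.2) {h : M → ℝ}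
    (hh : IsSmooth E h) : A.Comb (L.length + 1) ((L.map Prod.fst).sum : ℕ) fun g =>
      L.foldr (fun v k => v.2.act k) fun x => h x * g x := by
  induction L with
  | nil => exact .smul hh (.word [] (by simp) (by simp [listWt]))
  | cons p L ih =>
    have h1 := (ih fun q hq => hL q (List.mem_cons_of_mem _ hq)).flag (hL p List.mem_cons_self)
    refine h1.mono (by simp) ?_
    simp only [List.map_cons, List.sum_cons]
    push_cast
    omega

variable (A)

/-- The operator `X ↦ V_s (θ_k (X))` attached to an index `k` and a multiset `s` of indices. -/
def basisOp (b : Fin A.n × Multiset (Fin A.n)) : Op E M :=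
  fun X => A.word b.2.toList ((A.form b.1).pair X)

/-- The indices of the operators `V_s θ_k` belonging to `𝔇_{-i}`. -/
def opIdx (i : ℤ) : Finset (Fin A.n × Multiset (Fin A.n)) := by
  classical
  exact Finset.univ.biUnion fun k => (A.msIdx (i + A.wt k)).image (Prod.mk k)

theorem mem_opIdx {i : ℤ} {b : Fin A.n × Multiset (Fin A.n)} :
    b ∈ A.opIdx i ↔ (A.msWt b.2 : ℤ) ≤ i + A.wt b.1 := by
  obtain ⟨k, s⟩ := b
  simp [opIdx, mem_msIdx]

theorem sum_opIdx (i : ℤ) (f : Fin A.n × Multiset (Fin A.n) → ℝ) :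
    ∑ b ∈ A.opIdx i, f b = ∑ k, ∑ s ∈ A.msIdx (i + A.wt k), f (k, s) := by
  classical
  rw [opIdx, Finset.sum_biUnion]
  · exact Finset.sum_congr rfl fun k _ => Finset.sum_image fun _ _ _ _ h => (Prod.mk.inj h).2
  · intro k _ l _ hkl
    rw [Function.onFun, Finset.disjoint_left]
    rintro ⟨_, _⟩ h1 h2
    simp only [Finset.mem_image, Prod.mk.injEq] at h1 h2
    obtain ⟨_, _, rfl, _⟩ := h1
    obtain ⟨_, _, rfl, _⟩ := h2
    exact hkl rfl

theorem basisOp_smooth (b : Fin A.n × Multiset (Fin A.n)) (X : VField E M) :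
    IsSmooth E (A.basisOp b X) := A.word_smooth _ ((A.form _).pair_smooth X)

theorem word_eq_foldr (L : List (Fin A.n)) (g : M → ℝ) :
    A.word L g = (L.map fun j => (A.wt j, A.field j)).foldr (fun v h => v.2.act h) g := by
  induction L with
  | nil => rfl
  | cons j L ih => rw [word_cons, ih]; rfl

theorem basisOp_mem {i : ℤ} {b : Fin A.n × Multiset (Fin A.n)} (hb : b ∈ A.opIdx i) :
    A.basisOp b ∈ Δ.opFiltration i := by
  rw [mem_opIdx] at hb
  refine Submodule.subset_span ⟨A.wt b.1, (i + A.wt b.1).toNat, A.form b.1, fun _ => 1,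
    b.2.toList.map fun j => (A.wt j, A.field j), A.wt_pos _, by omega, A.form_mem _, IsSmooth.const 1, ?_,
    ?_, ?_⟩
  · intro p hp
    obtain ⟨j, -, rfl⟩ := List.mem_map.1 hp
    exact A.field_flag j
  · have h1 := A.listWt_toList b.2
    simp only [List.map_map, Function.comp_def]
    simp only [listWt] at h1
    change (b.2.toList.map A.wt).sum ≤ _
    omega
  · funext X x
    simp only [Distribution.monomialOp, one_mul, ← word_eq_foldr]
    rfl

/-- Operators in `𝔇_{-i}` are combinations of the operators `V_s θ_k` with `wt s ≤ i + wt k`. -/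
theorem exists_expansion [CompleteSpace E] {i : ℤ} {B : Op E M} (hB : B ∈ Δ.opFiltration i) :
    ∃ c : Fin A.n × Multiset (Fin A.n) → M → ℝ, (∀ b, IsSmooth E (c b)) ∧
      ∀ X, ∀ y ∈ A.dom, B X y = ∑ b ∈ A.opIdx i, c b y * A.basisOp b X y := by
  induction hB using Submodule.span_induction with
  | zero => exact ⟨fun _ _ => 0, fun _ => .const 0, by simp⟩
  | add P Q _ _ ihP ihQ =>
    obtain ⟨c, hc, h⟩ := ihP
    obtain ⟨d, hd, h'⟩ := ihQ
    refine ⟨fun s y => c s y + d s y, fun s => (hc s).add (hd s), fun X y hy => ?_⟩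
    simp_rw [add_mul, Finset.sum_add_distrib, ← h X y hy, ← h' X y hy]
    rfl
  | smul a P _ ih =>
    obtain ⟨c, hc, h⟩ := ih
    refine ⟨fun s y => a * c s y, fun s => (IsSmooth.const a).mul (hc s), fun X y hy => ?_⟩
    simp_rw [mul_assoc, ← Finset.mul_sum, ← h X y hy]
    rfl
  | mem B hB =>
    obtain ⟨j, w, α, f, L, hj, hw, hα, hf, hL, hLw, rfl⟩ := hB
    have hk : ∀ k, ∃ c : Multiset (Fin A.n) → M → ℝ, (∀ s, IsSmooth E (c s)) ∧
        ∀ g, IsSmooth E g → ∀ y ∈ A.dom,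
          L.foldr (fun v h => v.2.act h) (fun x => α.pair (A.field k) x * g x) y =
          ∑ s ∈ A.msIdx (i + A.wt k), c s y * A.word s.toList g y := by
      intro k
      by_cases hjk : j ≤ A.wt k
      · exact ((A.comb_foldr hL (α.pair_smooth (A.field k))).mono le_rfl
          (by omega)).exists_normalForm
      · have h0 : ∀ x, α.pair (A.field k) x = 0 :=
          hα _ ((A.field_flag k).mono_le (by omega))
        refine ⟨fun _ _ => 0, fun _ => .const 0, fun g _ y _ => ?_⟩
        simp only [h0, zero_mul, Finset.sum_const_zero]
        clear hL hLw
        have : ∀ y, L.foldr (fun v h => v.2.act h) (fun _ => (0 : ℝ)) y = 0 := by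
          induction L with
          | nil => intro y; rfl
          | cons p L ih =>
            intro y
            rw [List.foldr_cons, show L.foldr (fun v h => v.2.act h) (fun _ => (0 : ℝ)) =
              fun _ => 0 from funext ih]
            exact p.2.act_const 0 y
        exact this y
    choose c hc h using hk
    refine ⟨fun b y => f y * c b.1 b.2 y, fun b => hf.mul (hc _ _), fun X y hy => ?_⟩
    rw [sum_opIdx]
    simp_rw [mul_assoc, ← Finset.mul_sum]
    have hsum : ∀ (L : List (ℕ × VField E M)), ∀ y ∈ A.dom,
        L.foldr (fun v h => v.2.act h) (α.pair X) y = ∑ k,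
        L.foldr (fun v h => v.2.act h)
          (fun x => α.pair (A.field k) x * (A.form k).pair X x) y := by
      intro L
      have hsm : ∀ (L : List (ℕ × VField E M)) {g : M → ℝ}, IsSmooth E g →
          IsSmooth E (L.foldr (fun v h => v.2.act h) g) := by
        intro L g hg
        induction L with
        | nil => exact hg
        | cons p L ih => exact p.2.act_smooth ih
      induction L with
      | nil =>
        intro y hy
        simp only [List.foldr_nil]
        rw [α.pair_eq_sum Finset.univ X _ _ y (A.expand X y hy)]
        exact Finset.sum_congr rfl fun k _ => mul_comm _ _
      | cons p L ih =>
        intro y hy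
        simp only [List.foldr_cons]
        rw [← p.2.act_sum Finset.univ fun k _ => hsm L (((α.pair_smooth _)).mul
          ((A.form k).pair_smooth X))]
        refine p.2.act_congr ?_
        filter_upwards [A.dom_mem_nhds hy] with z hz using ih z hz
    simp only [Distribution.monomialOp]
    rw [hsum L y hy]
    congr 1
    exact Finset.sum_congr rfl fun k _ => h k _ ((A.form k).pair_smooth X) y hy

/-- A smooth function with prescribed differential at a point at which it vanishes. -/
theorem _root_.FilteredGeometry.exists_smooth_differential [FiniteDimensional ℝ E] [T2Space M]
    (x₀ : M) (ℓ : E →L[ℝ] ℝ) : ∃ z : M → ℝ, IsSmooth E z ∧ z x₀ = 0 ∧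
      ∀ X : VField E M, X.act z x₀ = ℓ (X x₀) := by
  obtain ⟨z, hz, hzl⟩ := exists_smooth_chartFn_eq (E := E) x₀ (U := Set.univ) univ_mem
    (f := fun y => ℓ (y - extChartAt 𝓘(ℝ, E) x₀ x₀)) (by fun_prop)
  refine ⟨z, hz, ?_, fun X => ?_⟩
  · have := hzl.self_of_nhds
    simpa [chartFn] using this
  · have h := X.act_chart x₀ hz (mem_extChartAt_target x₀)
    rw [hzl.fderiv_eq, X.inChart_self, chartFn, extChartAt_to_inv] at h
    rw [h]
    have h2 : HasFDerivAt (fun y => ℓ (y - extChartAt 𝓘(ℝ, E) x₀ x₀)) ℓ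
        (extChartAt 𝓘(ℝ, E) x₀ x₀) :=
      ℓ.hasFDerivAt.comp _ ((hasFDerivAt_id _).sub_const _)
    rw [h2.fderiv]

theorem word_append_singleton (L : List (Fin A.n)) (j : Fin A.n) (g : M → ℝ) :
    A.word (L ++ [j]) g = A.word L ((A.field j).act g) := by
  simp [word]

/-- Words applied to powers of a function vanishing at a point. -/
theorem word_mul_pow {z : M → ℝ} (hz : IsSmooth E z) {x : M} (hz0 : z x = 0)
    (L : List (Fin A.n)) (d : ℕ) {f : M → ℝ} (hf : IsSmooth E f) :
    A.word L (fun y => f y * z y ^ (L.length + d)) x = if d = 0 then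
      L.length.factorial * f x * (L.map fun j => (A.field j).act z x).prod else 0 := by
  induction L using List.reverseRecOn generalizing f with
  | nil =>
    rcases d with _ | d
    · simp [word]
    · simp [word, hz0]
  | append_singleton L j ih =>
    rw [word_append_singleton]
    have h1 : (A.field j).act (fun y => f y * z y ^ ((L ++ [j]).length + d)) =
        fun y => ((A.field j).act f y * z y + (L.length + d + 1 : ℕ) * (f y * (A.field j).act z y)) *
          z y ^ (L.length + d) := by
      funext y
      rw [(A.field j).act_mul hf (hz.pow _)]
      rw [show (L ++ [j]).length + d = (L.length + d) + 1 by simp; omega, (A.field j).act_pow hz]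
      push_cast
      ring
    rw [h1, ih ((((A.field j).act_smooth hf).mul hz).add
      ((IsSmooth.const _).mul (hf.mul ((A.field j).act_smooth hz))))]
    split_ifs with hd
    · subst hd
      simp only [hz0, mul_zero, zero_add, List.length_append, List.length_singleton,
        Nat.factorial_succ, List.map_append, List.prod_append, List.map_singleton,
        List.prod_singleton, add_zero]
      push_cast
      ring
    · rfl

/-- The values at `x₀` of the words representing different multisets can be prescribed. -/
theorem exists_smooth_word_eq [FiniteDimensional ℝ E] [T2Space M]
    (T : Finset (Multiset (Fin A.n))) (ξ : Multiset (Fin A.n) → ℝ) :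
    ∃ g : M → ℝ, IsSmooth E g ∧ ∀ s ∈ T, A.word s.toList g x₀ = ξ s := by
  classical
  -- the values which are attained form a subspace
  have hlin : ∀ (L : List (Fin A.n)) (a : ℝ) (f g : M → ℝ), IsSmooth E f → IsSmooth E g → ∀ x,
      A.word L (fun y => a * f y + g y) x = a * A.word L f x + A.word L g x := by
    intro L a f g hf hg
    induction L with
    | nil => intro x; rfl
    | cons j L ih =>
      intro x
      rw [word_cons, funext ih, (A.field j).act_add ((IsSmooth.const a).mul (A.word_smooth L hf))
        (A.word_smooth L hg), (A.field j).act_mul (.const a) (A.word_smooth L hf),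
        (A.field j).act_const]
      simp [word_cons]
  let S : Submodule ℝ (T → ℝ) :=
    { carrier := {ξ | ∃ g : M → ℝ, IsSmooth E g ∧ ∀ s : T, A.word s.1.toList g x₀ = ξ s}
      add_mem' := by
        rintro _ _ ⟨f, hf, h⟩ ⟨g, hg, h'⟩
        exact ⟨fun y => 1 * f y + g y, ((IsSmooth.const 1).mul hf).add hg, fun s => by
          rw [hlin _ _ _ _ hf hg, h, h']; simp⟩
      zero_mem' := ⟨fun y => 0, .const 0, fun s => by
        have := hlin s.1.toList (-1) _ _ (IsSmooth.const 0) (IsSmooth.const 0) x₀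
        simpa using this⟩
      smul_mem' := by
        rintro a _ ⟨f, hf, h⟩
        refine ⟨fun y => a * f y + 0, ((IsSmooth.const a).mul hf).add (.const 0), fun s => ?_⟩
        have h0 := hlin s.1.toList (-1) _ _ (IsSmooth.const 0) (IsSmooth.const 0) x₀
        rw [hlin _ _ _ _ hf (.const 0), h]
        simp at h0
        simp [h0] }
  suffices hS : S = ⊤ by
    obtain ⟨g, hg, h⟩ : (fun s : T => ξ s) ∈ S := hS ▸ Submodule.mem_top
    exact ⟨g, hg, fun s hs => h ⟨s, hs⟩⟩
  by_contra hne
  obtain ⟨φ, hφ0, hφ⟩ := Submodule.exists_le_ker_of_lt_top S (lt_top_iff_ne_top.2 hne)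
  let lam : Multiset (Fin A.n) → ℝ := fun s => if h : s ∈ T then φ (Pi.single ⟨s, h⟩ 1) else 0
  have hφg : ∀ g : M → ℝ, IsSmooth E g → ∑ s ∈ T, lam s * A.word s.toList g x₀ = 0 := by
    intro g hg
    have h1 : φ (fun s : T => A.word s.1.toList g x₀) = 0 := hφ ⟨g, hg, fun s => rfl⟩
    rw [← h1, LinearMap.pi_apply_eq_sum_univ φ, ← Finset.sum_attach]
    refine Finset.sum_congr rfl fun s _ => ?_
    simp only [lam, s.2, dif_pos, smul_eq_mul]
    rw [mul_comm]
    congr 2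
    funext t
    simp [Pi.single_apply, eq_comm]
  -- a nonzero coefficient of a multiset of the largest possible size
  have hex : (T.filter fun s => lam s ≠ 0).Nonempty := by
    by_contra h0
    rw [Finset.not_nonempty_iff_eq_empty, Finset.filter_eq_empty_iff] at h0
    refine hφ0 (LinearMap.pi_ext' fun s => LinearMap.ext_ring ?_)
    have := h0 s.2
    simpa [lam] using this
  obtain ⟨s₀, hs₀, hmax⟩ := Finset.exists_max_image _ Multiset.card hex
  rw [Finset.mem_filter] at hs₀
  let p : MvPolynomial (Fin A.n) ℝ := ∑ s ∈ T.filter fun s => Multiset.card s = Multiset.card s₀,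
    MvPolynomial.monomial (Multiset.toFinsupp s) (lam s)
  have hp : p = 0 := by
    refine MvPolynomial.funext fun t => ?_
    let θ : Fin A.n → E →L[ℝ] ℝ := fun j => A.form j x₀
    obtain ⟨z, hz, hz0, hzX⟩ := exists_smooth_differential x₀ (∑ j, t j • θ j)
    have hzj : ∀ j, (A.field j).act z x₀ = t j := by
      intro j
      have h2 : ∀ u : E, (∑ k, t k • θ k) u = ∑ k, t k * θ k u := fun u => by
        simp [_root_.sum_apply]
      refine (hzX _).trans ((h2 _).trans ?_)
      have h3 : ∀ k, t k * θ k (A.field j x₀) = t k * if k = j then 1 else 0 := fun k => by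
        rw [← A.pair_field k j x₀ A.mem_dom]; rfl
      rw [Finset.sum_congr rfl fun k _ => h3 k]
      simp
    have h1 := hφg (fun y => 1 * z y ^ Multiset.card s₀) ((IsSmooth.const 1).mul (hz.pow _))
    have h3 : ∀ s ∈ T, lam s * A.word s.toList (fun y => 1 * z y ^ Multiset.card s₀) x₀ =
        if Multiset.card s = Multiset.card s₀ then
          (Multiset.card s₀).factorial * (lam s * (s.map t).prod) else 0 := by
      intro s hs
      by_cases hls : lam s = 0
      · simp [hls]
      have hle := hmax s (Finset.mem_filter.2 ⟨hs, hls⟩)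
      obtain ⟨d, hd⟩ := Nat.exists_eq_add_of_le hle
      have h4 := A.word_mul_pow hz hz0 s.toList d (IsSmooth.const 1)
      rw [Multiset.length_toList, ← hd] at h4
      rw [h4]
      have h5 : (s.toList.map fun j => (A.field j).act z x₀).prod = (s.map t).prod := by
        simp_rw [hzj]
        rw [← Multiset.prod_coe, ← Multiset.map_coe, Multiset.coe_toList]
      by_cases hd0 : d = 0
      · rw [if_pos hd0, if_pos (by omega), h5, show Multiset.card s = Multiset.card s₀ by omega]
        ring
      · rw [if_neg hd0, if_neg (by omega), mul_zero]
    rw [Finset.sum_congr rfl h3, ← Finset.sum_filter, ← Finset.mul_sum] at h1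
    have h6 := (mul_eq_zero.1 h1).resolve_left (by positivity)
    simp only [p, map_sum, map_zero, MvPolynomial.eval_monomial]
    rw [← h6]
    refine Finset.sum_congr rfl fun s _ => ?_
    congr 1
    rw [Finsupp.prod, Multiset.toFinsupp_support, Finset.prod_multiset_map_count]
    rfl
  have h7 := congrArg (MvPolynomial.coeff (Multiset.toFinsupp s₀)) hp
  simp only [p, MvPolynomial.coeff_sum, MvPolynomial.coeff_monomial, MvPolynomial.coeff_zero,
    EmbeddingLike.apply_eq_iff_eq] at h7
  rw [Finset.sum_ite_eq'] at h7
  simp [hs₀] at h7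

/-- The values at `x₀` of the operators `V_s θ_k` can be prescribed. -/
theorem exists_field_basisOp_eq [FiniteDimensional ℝ E] [T2Space M]
    (T : Finset (Fin A.n × Multiset (Fin A.n))) (ξ : Fin A.n × Multiset (Fin A.n) → ℝ) :
    ∃ X : VField E M, ∀ b ∈ T, A.basisOp b X x₀ = ξ b := by
  classical
  have h : ∀ k, ∃ g : M → ℝ, IsSmooth E g ∧ ∀ s ∈ T.image Prod.snd,
      A.word s.toList g x₀ = ξ (k, s) := fun k => A.exists_smooth_word_eq _ fun s => ξ (k, s)
  choose g hg hgs using h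
  refine ⟨∑ k, VField.smulFn (g k) (hg k) (A.field k), fun b hb => ?_⟩
  rw [← hgs b.1 b.2 (Finset.mem_image_of_mem _ hb)]
  refine (A.word_eventuallyEq b.2.toList ?_).self_of_nhds
  filter_upwards [A.dom_mem_nhds A.mem_dom] with y hy
  rw [OneForm.pair_sum]
  simp_rw [OneForm.pair_smulFn, A.pair_field _ _ y hy]
  simp

end AdaptedFrame

end NormalForm

/-! ### The operators of the Lie equation -/

section LieOps

open Filter

variable {E : Type*} [NormedAddCommGroup E] [NormedSpace ℝ E]
  {M : Type*} [TopologicalSpace M] [ChartedSpace E M] [IsManifold 𝓘(ℝ, E) ∞ M]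

theorem contDiffAt_coordJet {f : E → E} {y : E} (hf : ContDiffAt ℝ ∞ f y) (k : ℕ) :
    ContDiffAt ℝ ∞ (coordJet k f) y :=
  contDiffAt_pi.2 fun _ => hf.iteratedFDeriv_right (m := ∞) (mod_cast le_top)

theorem VField.contDiffAt_inChart (p : M) (X : VField E M) {y : E}
    (hy : y ∈ (extChartAt 𝓘(ℝ, E) p).target) : ContDiffAt ℝ ∞ (X.inChart p) y :=
  (X.inChart_contDiffOn p).contDiffAt ((isOpen_extChartAt_target p).mem_nhds hy)

theorem VField.inChart_sub (p : M) (X Y : VField E M) :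
    (X - Y).inChart p = X.inChart p - Y.inChart p := by
  funext y
  exact map_sub (mfderiv 𝓘(ℝ, E) 𝓘(ℝ, E) (extChartAt 𝓘(ℝ, E) p) _) _ _

theorem coordJet_sub {f g : E → E} {y : E} {k : ℕ} (hf : ContDiffAt ℝ ∞ f y)
    (hg : ContDiffAt ℝ ∞ g y) : coordJet k (f - g) y = coordJet k f y - coordJet k g y := by
  funext m
  exact iteratedFDeriv_sub_apply (hf.of_le (natCast_le_infty _)) (hg.of_le (natCast_le_infty _))

theorem DModule.smooth {S : Set (Op E M)} (hS : ∀ B ∈ S, ∀ X, IsSmooth E (B X)) {B : Op E M}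
    (hB : DModule S B) (X : VField E M) : IsSmooth E (B X) := by
  induction hB with
  | of B h => exact hS B h X
  | zero => exact IsSmooth.const 0
  | add B C _ _ ihB ihC => exact ihB.add ihC
  | smul f hf B _ ih => exact IsSmooth.mul hf ih
  | deriv v B _ ih => exact v.act_smooth ih

theorem DModule.apply_eq_zero {S : Set (Op E M)} {X : VField E M} (hX : ∀ B ∈ S, ∀ x, B X x = 0)
    {B : Op E M} (hB : DModule S B) : B X = fun _ => 0 := by
  induction hB with
  | of B h => exact funext (hX B h)
  | zero => rfl
  | add B C _ _ ihB ihC => funext x; simp [ihB, ihC]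
  | smul f hf B _ ih => funext x; simp [ih]
  | deriv v B _ ih =>
    funext x
    change v.act (B X) x = 0
    rw [ih]
    exact v.act_const 0 x

variable [CompleteSpace E] (F : FilteredStructure E M)

theorem FilteredStructure.lieOps_smooth {B : Op E M} (hB : B ∈ F.lieOps) (X : VField E M) :
    IsSmooth E (B X) := by
  rcases hB with ⟨v, α, -, -, rfl⟩ | hB
  · exact α.pair_smooth (X.bracket v)
  · obtain ⟨j, hj⟩ := Set.mem_iUnion.1 hB
    intro p
    obtain ⟨Φ, W, hW, hpW, hΦ, -, hBX⟩ := hj p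
    have hp := mem_extChartAt_target (I := 𝓘(ℝ, E)) p
    have h1 : ContDiffAt ℝ ∞ (fun y => fderiv ℝ (fun J => Φ (y, J)) (coordJet _ id y)
        (coordJet _ (X.inChart p) y)) (extChartAt 𝓘(ℝ, E) p p) :=
      (ContDiffAt.fderiv (f := fun y J => Φ (y, J)) (n := ∞)
        (hΦ.contDiffAt (hW.mem_nhds hpW)) (contDiffAt_coordJet contDiffAt_id _) (by simp)).clm_apply
        (contDiffAt_coordJet (X.contDiffAt_inChart p hp) _)
    exact (h1.contMDiffAt.comp p (contMDiffAt_extChartAt (I := 𝓘(ℝ, E)))).congr_of_eventuallyEq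
      (hBX.mono fun x hx => hx X)

theorem FilteredStructure.lieOps_sub {B : Op E M} (hB : B ∈ F.lieOps) (X Y : VField E M) (x : M) :
    B (X - Y) x = B X x - B Y x := by
  rcases hB with ⟨v, α, -, -, rfl⟩ | hB
  · have h1 : (X - Y).bracket v x = X.bracket v x - Y.bracket v x := by
      have h2 := v.bracket_add_right (X - Y) Y x
      rw [sub_add_cancel] at h2
      rw [(X - Y).bracket_swap, X.bracket_swap, Y.bracket_swap, h2]
      abel
    change α x ((X - Y).bracket v x) = α x (X.bracket v x) - α x (Y.bracket v x)
    rw [h1, map_sub]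
  · obtain ⟨j, hj⟩ := Set.mem_iUnion.1 hB
    obtain ⟨Φ, W, -, -, -, -, hBX⟩ := hj x
    have hx := mem_extChartAt_target (I := 𝓘(ℝ, E)) x
    have h1 := hBX.self_of_nhds
    rw [h1, h1, h1, VField.inChart_sub, coordJet_sub (X.contDiffAt_inChart x hx)
      (Y.contDiffAt_inChart x hx), map_sub]

theorem FilteredStructure.IsSymmetry.sub {X Y : VField E M} (hX : F.IsSymmetry X)
    (hY : F.IsSymmetry Y) : F.IsSymmetry (X - Y) := by
  intro B hB x
  rw [F.lieOps_sub hB, hX B hB, hY B hB, sub_zero]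

end LieOps

/-! ### Prolongation of an equation of finite type -/

section Prolongation

open Filter

variable {E : Type*} [NormedAddCommGroup E] [NormedSpace ℝ E]
  {M : Type*} [TopologicalSpace M] [ChartedSpace E M] [IsManifold 𝓘(ℝ, E) ∞ M]

namespace AdaptedFrame

variable {Δ : Distribution E M} {x₀ : M} (A : AdaptedFrame Δ x₀)

/-- An operator `P` on vector fields is reducible if, near the base point of the frame, it is the
sum of an element of the module generated by `S` and of a combination, over the smooth functions,
of the basic operators of `𝔇_{-i}`. -/
def Reducible (S : Set (Op E M)) (i : ℤ) (P : Op E M) : Prop :=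
  (∀ X, IsSmooth E (P X)) ∧ ∃ C : Op E M, DModule S C ∧
    ∃ d : Fin A.n × Multiset (Fin A.n) → M → ℝ, (∀ b, IsSmooth E (d b)) ∧
      ∀ᶠ y in 𝓝 x₀, ∀ X, P X y = C X y + ∑ b ∈ A.opIdx i, d b y * A.basisOp b X y

variable {A} {S : Set (Op E M)} {i : ℤ}

theorem Reducible.congr {P Q : Op E M} (hP : A.Reducible S i P) (hQ : ∀ X, IsSmooth E (Q X))
    (h : ∀ᶠ y in 𝓝 x₀, ∀ X, Q X y = P X y) : A.Reducible S i Q := by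
  obtain ⟨-, C, hC, d, hd, hP⟩ := hP
  refine ⟨hQ, C, hC, d, hd, ?_⟩
  filter_upwards [h, hP] with y h1 h2 X
  rw [h1, h2]

theorem Reducible.add {P Q : Op E M} (hP : A.Reducible S i P) (hQ : A.Reducible S i Q) :
    A.Reducible S i fun X x => P X x + Q X x := by
  obtain ⟨hPs, C, hC, d, hd, hP⟩ := hP
  obtain ⟨hQs, C', hC', d', hd', hQ⟩ := hQ
  refine ⟨fun X => (hPs X).add (hQs X), C + C', hC.add _ _ hC', fun b x => d b x + d' b x,
    fun b => (hd b).add (hd' b), ?_⟩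
  filter_upwards [hP, hQ] with y h1 h2 X
  rw [h1, h2]
  simp_rw [add_mul, Finset.sum_add_distrib]
  simp only [Pi.add_apply]
  ring

theorem Reducible.smul {f : M → ℝ} (hf : IsSmooth E f) {P : Op E M} (hP : A.Reducible S i P) :
    A.Reducible S i fun X x => f x * P X x := by
  obtain ⟨hPs, C, hC, d, hd, hP⟩ := hP
  refine ⟨fun X => hf.mul (hPs X), _, hC.smul f hf, fun b x => f x * d b x,
    fun b => hf.mul (hd b), ?_⟩
  filter_upwards [hP] with y h1 X
  rw [h1]
  simp_rw [mul_assoc, ← Finset.mul_sum]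
  ring

theorem Reducible.zero : A.Reducible S i fun _ _ => 0 :=
  ⟨fun _ => .const 0, 0, .zero, fun _ _ => 0, fun _ => .const 0, by simp⟩

theorem Reducible.sum {ι : Type*} (s : Finset ι) {P : ι → Op E M}
    (hP : ∀ j ∈ s, A.Reducible S i (P j)) : A.Reducible S i fun X x => ∑ j ∈ s, P j X x := by
  classical
  induction s using Finset.induction_on with
  | empty => simpa using Reducible.zero
  | insert j s hj ih =>
    simp_rw [Finset.sum_insert hj]
    exact .add (hP j (Finset.mem_insert_self j s)) (ih fun k hk => hP k (Finset.mem_insert_of_mem hk))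

theorem Reducible.of_dModule (hS : ∀ B ∈ S, ∀ X, IsSmooth E (B X)) {C : Op E M}
    (hC : DModule S C) : A.Reducible S i C :=
  ⟨hC.smooth hS, C, hC, fun _ _ => 0, fun _ => .const 0, by simp⟩

theorem Reducible.basisOp {b : Fin A.n × Multiset (Fin A.n)} (hb : b ∈ A.opIdx i) :
    A.Reducible S i (A.basisOp b) := by
  classical
  refine ⟨A.basisOp_smooth b, 0, .zero, fun b' _ => if b' = b then 1 else 0,
    fun _ => .const _, Eventually.of_forall fun y X => ?_⟩
  simp [hb]

variable (A)

/-- A field has zero weighted `i`-jet at `x` if and only if the basic operators of `𝔇_{-i}`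
vanish on it at `x`. -/
theorem mem_weightedJetKer_iff [CompleteSpace E] {x : M} (hx : x ∈ A.dom) {X : VField E M} :
    X ∈ Δ.weightedJetKer i x ↔ ∀ b ∈ A.opIdx i, A.basisOp b X x = 0 := by
  refine ⟨fun h b hb => h _ (A.basisOp_mem hb), fun h B hB => ?_⟩
  obtain ⟨c, -, hc⟩ := A.exists_expansion hB
  rw [hc X x hx]
  exact Finset.sum_eq_zero fun b hb => by rw [h b hb, mul_zero]

theorem opIdx_mono {i j : ℤ} (h : i ≤ j) : A.opIdx i ⊆ A.opIdx j := by
  intro b hb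
  rw [mem_opIdx] at hb ⊢
  omega

/-- If the symbol at `x₀` vanishes, all basic operators of `𝔇_{-κ}` are reducible to those of
`𝔇_{-(κ-1)}`: by duality, the symbols of the elements of the module which belong to `𝔇_{-κ}`
exhaust the quotient. -/
theorem reducible_of_symbol_eq_zero [FiniteDimensional ℝ E] [T2Space M]
    (hS : ∀ B ∈ S, ∀ X, IsSmooth E (B X)) {κ : ℤ}
    (hκ : ∀ X : VField E M, (∀ B ∈ Δ.opFiltration κ, DModule S B → B X x₀ = 0) →
      X ∈ Δ.weightedJetKer (κ - 1) x₀ → X ∈ Δ.weightedJetKer κ x₀)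
    {a : Fin A.n × Multiset (Fin A.n)} (ha : a ∈ A.opIdx κ) :
    A.Reducible S (κ - 1) (A.basisOp a) := by
  classical
  have : CompleteSpace E := FiniteDimensional.complete ℝ E
  let I := A.opIdx κ
  -- the values at `x₀` of the coefficients of the reducible combinations of basic operators
  let R : Submodule ℝ (I → ℝ) :=
    { carrier := {ρ | ∃ r : I → M → ℝ, (∀ b, IsSmooth E (r b)) ∧ (∀ b, r b x₀ = ρ b) ∧
        A.Reducible S (κ - 1) fun X x => ∑ b, r b x * A.basisOp b X x}
      add_mem' := by
        rintro _ _ ⟨r, hr, h, hR⟩ ⟨r', hr', h', hR'⟩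
        refine ⟨fun b x => r b x + r' b x, fun b => (hr b).add (hr' b), fun b => by
          simp only [h, h', Pi.add_apply], ?_⟩
        simpa only [add_mul, Finset.sum_add_distrib] using hR.add hR'
      zero_mem' := ⟨fun _ _ => 0, fun _ => .const 0, fun _ => rfl, by simpa using Reducible.zero⟩
      smul_mem' := by
        rintro c _ ⟨r, hr, h, hR⟩
        refine ⟨fun b x => c * r b x, fun b => (IsSmooth.const c).mul (hr b), fun b => by
          simp only [h, Pi.smul_apply, smul_eq_mul], ?_⟩
        simpa only [mul_assoc, ← Finset.mul_sum] using hR.smul (IsSmooth.const c) }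
  have hR : R = ⊤ := by
    by_contra hne
    obtain ⟨φ, hφ0, hφ⟩ := Submodule.exists_le_ker_of_lt_top R (lt_top_iff_ne_top.2 hne)
    let ξ : Fin A.n × Multiset (Fin A.n) → ℝ :=
      fun b => if h : b ∈ I then φ (Pi.single ⟨b, h⟩ 1) else 0
    have hξ : ∀ ρ : I → ℝ, φ ρ = ∑ b, ρ b * ξ b := by
      intro ρ
      rw [LinearMap.pi_apply_eq_sum_univ φ]
      refine Finset.sum_congr rfl fun b _ => ?_
      simp only [ξ, b.2, dif_pos, smul_eq_mul]
      congr 2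
      funext t
      simp [Pi.single_apply, eq_comm]
    obtain ⟨X, hX⟩ := A.exists_field_basisOp_eq I ξ
    have h1 : X ∈ Δ.weightedJetKer κ x₀ := by
      refine hκ X (fun B hB hBD => ?_) ((A.mem_weightedJetKer_iff A.mem_dom).2 fun b hb => ?_)
      · obtain ⟨c, hc, h⟩ := A.exists_expansion hB
        rw [h X x₀ A.mem_dom]
        have h2 : φ (fun b : I => c b x₀) = 0 := by
          refine hφ ⟨fun b => c b, fun b => hc b, fun b => rfl, ?_⟩
          refine (Reducible.of_dModule hS hBD).congr (fun X => IsSmooth.sum fun b _ =>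
            (hc b).mul (A.basisOp_smooth b X)) ?_
          filter_upwards [A.dom_mem_nhds A.mem_dom] with y hy X
          rw [h X y hy]
          exact Finset.sum_coe_sort I fun b => c b y * A.basisOp b X y
        rw [← h2, hξ, ← Finset.sum_coe_sort]
        exact Finset.sum_congr rfl fun b _ => by rw [hX b b.2]
      · have hbI : b ∈ I := A.opIdx_mono (by omega) hb
        rw [hX b hbI]
        simp only [ξ, hbI, dif_pos]
        refine hφ ⟨fun b' _ => if b' = ⟨b, hbI⟩ then 1 else 0, fun _ => .const _, fun b' => by
          simp [Pi.single_apply], ?_⟩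
        simpa using Reducible.basisOp (S := S) hb
    refine hφ0 (LinearMap.ext fun ρ => ?_)
    rw [hξ]
    refine Finset.sum_eq_zero fun b _ => ?_
    rw [← hX b b.2, (A.mem_weightedJetKer_iff A.mem_dom).1 h1 b b.2, mul_zero]
  have hex : ∀ a : I, ∃ r : I → M → ℝ, (∀ b, IsSmooth E (r b)) ∧
      (∀ b, r b x₀ = if a = b then 1 else 0) ∧
      A.Reducible S (κ - 1) fun X x => ∑ b, r b x * A.basisOp b X x := by
    intro a
    obtain ⟨r, hr, h, hR'⟩ : (fun b => if a = b then (1 : ℝ) else 0) ∈ R :=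
      hR ▸ Submodule.mem_top
    exact ⟨r, hr, h, hR'⟩
  choose r hr hr0 hrR using hex
  obtain ⟨N, hN, hNr⟩ := exists_smooth_matrix_inverse (E := E) x₀
    (A := fun x => Matrix.of fun a b => r a b x) (fun a b => hr a b) (by
      have : (Matrix.of fun a b => r a b x₀) = 1 := by
        ext a b
        rw [Matrix.of_apply, hr0, Matrix.one_apply]
      rw [this]; simp)
  refine (Reducible.sum Finset.univ fun a' _ => (hrR a').smul (hN ⟨a, ha⟩ a')).congr
    (A.basisOp_smooth a) ?_
  filter_upwards [hNr] with y hy X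
  simp_rw [Finset.mul_sum]
  rw [Finset.sum_comm]
  have h1 : ∀ b, ∑ a', N y ⟨a, ha⟩ a' * r a' b y = if (⟨a, ha⟩ : I) = b then 1 else 0 := by
    intro b
    have := congrFun (congrFun hy.1 ⟨a, ha⟩) b
    rwa [Matrix.mul_apply, Matrix.one_apply] at this
  simp_rw [← mul_assoc, ← Finset.sum_mul, h1]
  simp

/-- Under the assumption of finite type, the reducible operators are stable under the derivations
along the sections of the flag. -/
theorem Reducible.act_flag [CompleteSpace E] (hS : ∀ B ∈ S, ∀ X, IsSmooth E (B X)) {κ : ℤ}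
    (hκ : ∀ a ∈ A.opIdx κ, A.Reducible S (κ - 1) (A.basisOp a)) {w : ℕ} {v : VField E M}
    (hv : Δ.Flag w v) {P : Op E M} (hP : A.Reducible S (κ - 1) P) :
    A.Reducible S (κ - 1) fun X => v.act (P X) := by
  -- for sections of `Δ` itself, one derivative raises the weight by one
  have base : ∀ v : VField E M, Δ.Flag 1 v → ∀ P : Op E M, A.Reducible S (κ - 1) P →
      A.Reducible S (κ - 1) fun X => v.act (P X) := by
    intro v hv P hP
    have hb : ∀ b ∈ A.opIdx (κ - 1), A.Reducible S (κ - 1) fun X => v.act (A.basisOp b X) := by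
      intro b hb
      rw [mem_opIdx] at hb
      have h1 : A.Comb (b.2.toList.length + 1) (A.msWt b.2) (A.word b.2.toList) :=
        .word _ (Nat.lt_succ_self _) (by rw [listWt_toList])
      obtain ⟨c, hc, h⟩ := (h1.flag hv).exists_normalForm
      refine (Reducible.sum (A.msIdx (A.msWt b.2 + (1 : ℕ))) fun s hs =>
        (hκ (b.1, s) ?_).smul (hc s)).congr (fun X => v.act_smooth (A.basisOp_smooth b X)) ?_
      · rw [mem_msIdx] at hs
        rw [mem_opIdx]
        push_cast at hs
        simp only
        omega
      · filter_upwards [A.dom_mem_nhds A.mem_dom] with y hy X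
        exact h _ ((A.form b.1).pair_smooth X) y hy
    obtain ⟨hPs, C, hC, d, hd, hP⟩ := hP
    refine ((Reducible.of_dModule hS (hC.deriv v)).add (Reducible.sum (A.opIdx (κ - 1))
      fun b hb' => (((Reducible.basisOp hb').smul (v.act_smooth (hd b))).add
        ((hb b hb').smul (hd b))))).congr (fun X => v.act_smooth (hPs X)) ?_
    filter_upwards [hP.eventually_nhds] with y hy X
    rw [v.act_congr (hy.mono fun z hz => hz X), v.act_add (hC.smooth hS X)
      (IsSmooth.sum fun b _ => (hd b).mul (A.basisOp_smooth b X)),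
      v.act_sum _ fun b _ => (hd b).mul (A.basisOp_smooth b X)]
    congr 1
    exact Finset.sum_congr rfl fun b _ => v.act_mul (hd b) (A.basisOp_smooth b X) y
  induction hv generalizing P with
  | zero =>
    refine Reducible.zero.congr (fun X => VField.act_smooth 0 (hP.1 X))
      (Eventually.of_forall fun y X => ?_)
    exact (mvfderiv 𝓘(ℝ, E) (P X) y).map_zero
  | base v h => exact base v (.base v h) P hP
  | mono i v _ ih => exact ih hP
  | bracket i v v' Z hv _ hZ _ ih =>
    have h1 := (base v hv _ (ih hP)).add ((ih (base v hv _ hP)).smul (IsSmooth.const (-1)))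
    refine h1.congr (fun X => Z.act_smooth (hP.1 X)) (Eventually.of_forall fun y X => ?_)
    have h2 : Z = v.bracket v' := by ext x; exact hZ x
    rw [h2, v.bracket_act v' (hP.1 X)]
    ring
  | add i v v' _ _ ih ih' =>
    refine ((ih hP).add (ih' hP)).congr (fun X => VField.act_smooth _ (hP.1 X))
      (Eventually.of_forall fun y X => ?_)
    exact (mvfderiv 𝓘(ℝ, E) (P X) y).map_add _ _
  | smul i f hf v Z _ hZ ih =>
    refine ((ih hP).smul hf).congr (fun X => VField.act_smooth _ (hP.1 X))
      (Eventually.of_forall fun y X => ?_)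
    have := (mvfderiv 𝓘(ℝ, E) (P X) y).map_smul (f y) (v y)
    rw [← hZ y] at this
    exact this

/-- Under the assumption of finite type, the derivatives of the basic operators of `𝔇_{-(κ-1)}`
are reducible: the equation is equivalent to a linear system expressing all first derivatives. -/
theorem reducible_act_basisOp [CompleteSpace E] (hS : ∀ B ∈ S, ∀ X, IsSmooth E (B X)) {κ : ℤ}
    (hκ : ∀ a ∈ A.opIdx κ, A.Reducible S (κ - 1) (A.basisOp a)) (v : VField E M)
    {b : Fin A.n × Multiset (Fin A.n)} (hb : b ∈ A.opIdx (κ - 1)) :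
    A.Reducible S (κ - 1) fun X => v.act (A.basisOp b X) := by
  refine (Reducible.sum Finset.univ fun k _ => (Reducible.act_flag A hS hκ (A.field_flag k)
    (Reducible.basisOp hb)).smul ((A.form k).pair_smooth v)).congr
    (fun X => v.act_smooth (A.basisOp_smooth b X)) ?_
  filter_upwards [A.dom_mem_nhds A.mem_dom] with y hy X
  exact VField.act_eq_sum _ v _ _ y (A.expand v y hy) _

end AdaptedFrame

end Prolongation

/-! ### Orders of vanishing in charts -/

section Germs

open Filter Asymptotics

variable {E : Type*} [NormedAddCommGroup E] [NormedSpace ℝ E] [FiniteDimensional ℝ E]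
  {V : Type*} [NormedAddCommGroup V] [NormedSpace ℝ V]

/-- The germ of a smooth map is the germ of a map that is smooth everywhere. -/
theorem exists_contDiff_eventuallyEq {f : E → V} {p : E} {U : Set E} (hU : U ∈ 𝓝 p)
    (hf : ContDiffOn ℝ ∞ f U) : ∃ g : E → V, ContDiff ℝ ∞ g ∧ g =ᶠ[𝓝 p] f := by
  obtain ⟨r, hr, hrU⟩ := Metric.nhds_basis_closedBall.mem_iff.1 hU
  let χ : ContDiffBump p := ⟨r / 3, r / 2, by positivity, by linarith⟩
  refine ⟨fun y => χ y • f y, contDiff_iff_contDiffAt.2 fun y => ?_, ?_⟩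
  · by_cases hy : y ∈ Metric.ball p r
    · exact χ.contDiffAt.smul ((hf.mono hrU).contDiffAt
        (mem_of_superset (Metric.isOpen_ball.mem_nhds hy) Metric.ball_subset_closedBall))
    · have hev : (fun y => χ y • f y) =ᶠ[𝓝 y] fun _ => 0 := by
        have hop : IsOpen (Metric.closedBall p (r / 2))ᶜ := Metric.isClosed_closedBall.isOpen_compl
        have hyc : y ∈ (Metric.closedBall p (r / 2))ᶜ := by
          simp only [Metric.mem_ball, not_lt] at hy
          simp only [Set.mem_compl_iff, Metric.mem_closedBall, not_le]
          linarith
        filter_upwards [hop.mem_nhds hyc] with z hz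
        have : z ∉ Function.support χ := by
          rw [χ.support_eq]
          exact fun h => hz (Metric.ball_subset_closedBall h)
        rw [Function.notMem_support.1 this, zero_smul]
      exact contDiffAt_const.congr_of_eventuallyEq hev
  · filter_upwards [χ.eventuallyEq_one] with y hy
    rw [hy]
    simp

theorem VanishesToOrder.fderiv_of_contDiffOn [CompleteSpace V] {f : E → V} {p : E} {U : Set E}
    (hU : U ∈ 𝓝 p) (hf : ContDiffOn ℝ ∞ f U) {n : ℕ} (h : VanishesToOrder (n + 1) f p) :
    VanishesToOrder n (_root_.fderiv ℝ f) p := by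
  obtain ⟨g, hg, hgf⟩ := exists_contDiff_eventuallyEq hU hf
  exact ((h.congr' hgf.symm).fderiv hg).congr' hgf.fderiv

theorem vanishesToOrder_iff_of_contDiffOn [CompleteSpace V] {f : E → V} {p : E} {U : Set E}
    (hU : U ∈ 𝓝 p) (hf : ContDiffOn ℝ ∞ f U) {n : ℕ} :
    VanishesToOrder n f p ↔ ∀ m < n, iteratedFDeriv ℝ m f p = 0 := by
  obtain ⟨g, hg, hgf⟩ := exists_contDiff_eventuallyEq hU hf
  have h1 : VanishesToOrder n f p ↔ VanishesToOrder n g p :=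
    ⟨fun h => h.congr' hgf.symm, fun h => h.congr' hgf⟩
  rw [h1, vanishesToOrder_iff_iteratedFDeriv hg]
  refine forall₂_congr fun m _ => ?_
  rw [(hgf.iteratedFDeriv ℝ m).self_of_nhds]

variable {M : Type*} [TopologicalSpace M] [ChartedSpace E M] [IsManifold 𝓘(ℝ, E) ∞ M]

theorem VanishesToOrder.act {x : M} {g : M → ℝ} (hg : IsSmooth E g) (v : VField E M) {n : ℕ}
    (h : VanishesToOrder (n + 1) (chartFn E x g) (extChartAt 𝓘(ℝ, E) x x)) :
    VanishesToOrder n (chartFn E x (v.act g)) (extChartAt 𝓘(ℝ, E) x x) := by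
  have h1 := h.fderiv_of_contDiffOn (extChartAt_target_mem_nhds x) (chartFn_contDiffOn x hg)
  have h2 : (fun y => v.inChart x y) =O[𝓝 (extChartAt 𝓘(ℝ, E) x x)] fun _ => (1 : ℝ) :=
    (v.contDiffAt_inChart x (mem_extChartAt_target x)).continuousAt.norm.isBoundedUnder_le.isBigO_one ℝ
  have h3 : (fun y => _root_.fderiv ℝ (chartFn E x g) y (v.inChart x y))
      =O[𝓝 (extChartAt 𝓘(ℝ, E) x x)] fun y => ‖y - extChartAt 𝓘(ℝ, E) x x‖ ^ n := by
    have h4 := h1.norm_left.mul h2.norm_left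
    simp only [mul_one] at h4
    exact (IsBigO.of_bound 1 (Eventually.of_forall fun y => by
      simpa using (_root_.fderiv ℝ (chartFn E x g) y).le_opNorm (v.inChart x y))).trans h4
  refine h3.congr' ?_ .rfl
  filter_upwards [extChartAt_target_mem_nhds x] with y hy using (v.act_chart x hg hy).symm

theorem eventually_abs_chartFn_le (x₀ : M) {g : M → ℝ} (hg : IsSmooth E g) :
    ∀ᶠ y in 𝓝 (extChartAt 𝓘(ℝ, E) x₀ x₀), |chartFn E x₀ g y| ≤ |g x₀| + 1 := by
  have h1 : ContinuousAt (fun y => |chartFn E x₀ g y|) (extChartAt 𝓘(ℝ, E) x₀ x₀) :=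
    ((chartFn_contDiffOn x₀ hg).contDiffAt (extChartAt_target_mem_nhds x₀)).continuousAt.abs
  have h2 : chartFn E x₀ g (extChartAt 𝓘(ℝ, E) x₀ x₀) = g x₀ := by
    rw [chartFn, extChartAt_to_inv]
  refine (h1.eventually (gt_mem_nhds ?_)).mono fun y hy => hy.le
  simp only [h2]
  exact lt_add_one _

/-! ### Coordinate fields -/

variable [T2Space M]

/-- The coordinate fields of a chart extend to global fields. -/
theorem FilteredStructure.exists_coordinate_fields (F : FilteredStructure E M) (x₀ : M)
    {ι : Type*} [Fintype ι] (b : Module.Basis ι ℝ E) :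
    ∃ D : ι → VField E M, (∀ l, F.dist.Flag F.depth (D l)) ∧
      ∀ᶠ y in 𝓝 (extChartAt 𝓘(ℝ, E) x₀ x₀), ∀ l, (D l).inChart x₀ y = b l := by
  classical
  have : CompleteSpace E := FiniteDimensional.complete ℝ E
  have hex : ∀ l, ∃ X : VField E M, F.dist.Flag F.depth X ∧ X x₀ = b l := fun l => by
    have h : ∀ v : TangentSpace 𝓘(ℝ, E) x₀, v ∈ F.dist.flagAt F.depth x₀ := fun v => by
      rw [F.flag_depth]; exact Submodule.mem_top
    exact Distribution.mem_flagAt.1 (h (b l))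
  choose W hW hW0 using hex
  obtain ⟨c, hc, -, hcX⟩ := exists_coordinate_functions (M := M) x₀ b
  let A : M → Matrix ι ι ℝ := fun x => Matrix.of fun l j => (W j).act (c l) x
  have hA0 : A x₀ = 1 := by
    ext l j
    have h := hcX.self_of_nhds l (W j)
    rw [extChartAt_to_inv, (W j).inChart_self, hW0] at h
    simp only [A, Matrix.of_apply, h, Module.Basis.coord_apply, Module.Basis.repr_self,
      Matrix.one_apply, Finsupp.single_apply, eq_comm]
  obtain ⟨B, hB, hBA⟩ := exists_smooth_matrix_inverse (E := E) x₀ (A := A)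
    (fun l j => (W j).act_smooth (hc l)) (by rw [hA0]; simp)
  refine ⟨fun l => ∑ k, VField.smulFn _ (hB k l) (W k), fun l => ?_, ?_⟩
  · have : ∀ s : Finset ι, F.dist.Flag F.depth (∑ k ∈ s, VField.smulFn _ (hB k l) (W k)) := by
      intro s
      induction s using Finset.induction_on with
      | empty => exact .zero _
      | insert k s hk ih => rw [Finset.sum_insert hk]; exact .add _ _ _ ((hW k).smulFn _) ih
    exact this _
  · have h1 := (continuousAt_extChartAt_symm (I := 𝓘(ℝ, E)) x₀).eventually
      (by rw [extChartAt_to_inv]; exact hBA)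
    filter_upwards [h1, hcX] with y hy hyc l
    refine b.ext_elem fun m => ?_
    have h2 := hyc m (∑ k, VField.smulFn _ (hB k l) (W k))
    rw [← Module.Basis.coord_apply, ← h2]
    rw [VField.act_eq_sum Finset.univ _ (fun k => B ((extChartAt 𝓘(ℝ, E) x₀).symm y) k l) W _
      (VField.sum_apply _ _ _)]
    have := congrFun (congrFun hy.2 m) l
    rw [Matrix.mul_apply, Matrix.one_apply] at this
    rw [Module.Basis.repr_self, Finsupp.single_apply]
    simp only [eq_comm (a := l), ← this]
    exact Finset.sum_congr rfl fun k _ => mul_comm _ _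

/-- Every smooth map of the model space is, near a point, the expression of a field. -/
theorem FilteredStructure.exists_field_inChart_eq (F : FilteredStructure E M)
    (x₀ : M) {f : E → E} (hf : ContDiff ℝ ∞ f) :
    ∃ X : VField E M, X.inChart x₀ =ᶠ[𝓝 (extChartAt 𝓘(ℝ, E) x₀ x₀)] f := by
  classical
  let b := Module.finBasis ℝ E
  obtain ⟨D, -, hD⟩ := F.exists_coordinate_fields x₀ b
  have hex : ∀ l, ∃ g : M → ℝ, IsSmooth E g ∧
      chartFn E x₀ g =ᶠ[𝓝 (extChartAt 𝓘(ℝ, E) x₀ x₀)] fun y => b.coord l (f y) := fun l =>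
    exists_smooth_chartFn_eq x₀ (U := Set.univ) univ_mem
      ((LinearMap.toContinuousLinearMap (b.coord l)).contDiff.comp hf).contDiffOn
  choose g hg hgf using hex
  refine ⟨∑ l, VField.smulFn (g l) (hg l) (D l), ?_⟩
  filter_upwards [hD, eventually_all.2 hgf] with y hy hyg
  have h1 : (∑ l, VField.smulFn (g l) (hg l) (D l) : VField E M).inChart x₀ y =
      ∑ l, g l ((extChartAt 𝓘(ℝ, E) x₀).symm y) • (D l).inChart x₀ y := by
    simp only [VField.inChart]
    rw [VField.sum_apply, map_sum]
    exact Finset.sum_congr rfl fun l _ => map_smul _ _ _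
  rw [h1, ← b.sum_repr (f y)]
  refine Finset.sum_congr rfl fun l _ => ?_
  rw [hy l]
  congr 1
  exact hyg l

/-- The expression of a one-form in a chart, as a covector-valued function. -/
theorem FilteredStructure.exists_covector (F : FilteredStructure E M) (x₀ : M)
    (α : OneForm E M) : ∃ a : E → E →L[ℝ] ℝ, ContDiff ℝ ∞ a ∧
      ∀ᶠ y in 𝓝 (extChartAt 𝓘(ℝ, E) x₀ x₀), ∀ X : VField E M,
        chartFn E x₀ (α.pair X) y = a y (X.inChart x₀ y) := by
  let b := Module.finBasis ℝ E
  obtain ⟨D, -, hD⟩ := F.exists_coordinate_fields x₀ b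
  let a₀ : E → E →L[ℝ] ℝ := fun y =>
    ∑ l, chartFn E x₀ (α.pair (D l)) y • LinearMap.toContinuousLinearMap (b.coord l)
  have ha₀ : ContDiffOn ℝ ∞ a₀ (extChartAt 𝓘(ℝ, E) x₀).target :=
    ContDiffOn.sum fun l _ => (chartFn_contDiffOn x₀ (α.pair_smooth (D l))).smul contDiffOn_const
  obtain ⟨a, ha, haa⟩ := exists_contDiff_eventuallyEq (extChartAt_target_mem_nhds x₀) ha₀
  refine ⟨a, ha, ?_⟩
  filter_upwards [hD, haa, extChartAt_target_mem_nhds x₀] with y hy hya hyt X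
  have hinv := (isInvertible_mfderiv_extChartAt ((extChartAt 𝓘(ℝ, E) x₀).map_target hyt)).injective
  have hX : X ((extChartAt 𝓘(ℝ, E) x₀).symm y) =
      ∑ l, b.coord l (X.inChart x₀ y) • D l ((extChartAt 𝓘(ℝ, E) x₀).symm y) := by
    refine hinv ?_
    rw [map_sum]
    refine (b.sum_repr (X.inChart x₀ y)).symm.trans (Finset.sum_congr rfl fun l _ => ?_)
    rw [map_smul]
    exact congrArg _ (hy l).symm
  rw [chartFn, α.pair_eq_sum Finset.univ X _ D _ hX, hya]
  simp only [a₀, _root_.sum_apply, _root_.smul_apply, smul_eq_mul]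
  exact Finset.sum_congr rfl fun l _ => mul_comm _ _

/-- In a chart, a one-form is bounded by the size of the field to which it is applied. -/
theorem FilteredStructure.exists_pair_bound (F : FilteredStructure E M)
    (x₀ : M) (α : OneForm E M) : ∃ K : ℝ, 0 ≤ K ∧
    ∀ᶠ y in 𝓝 (extChartAt 𝓘(ℝ, E) x₀ x₀), ∀ X : VField E M,
      |chartFn E x₀ (α.pair X) y| ≤ K * ‖X.inChart x₀ y‖ := by
  obtain ⟨a, ha, haX⟩ := F.exists_covector x₀ α
  refine ⟨‖a (extChartAt 𝓘(ℝ, E) x₀ x₀)‖ + 1, by positivity, ?_⟩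
  filter_upwards [haX, ha.continuous.continuousAt.norm.eventually
    (gt_mem_nhds (lt_add_one _))] with y hy hya X
  rw [hy X]
  exact ((a y).le_opNorm _).trans (mul_le_mul_of_nonneg_right hya.le (norm_nonneg _))

/-- A function all of whose derivatives of order at most `n` along the fields of the flag vanish at
`x` vanishes to order `n + 1`. -/
theorem FilteredStructure.vanishesToOrder_of_foldr_eq_zero
    (F : FilteredStructure E M) {x : M} {n : ℕ} {g : M → ℝ}
    (hg : IsSmooth E g) (h : ∀ L : List (VField E M), (∀ v ∈ L, F.dist.Flag F.depth v) →
      L.length ≤ n → L.foldr VField.act g x = 0) :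
    VanishesToOrder (n + 1) (chartFn E x g) (extChartAt 𝓘(ℝ, E) x x) := by
  have hdiff : ∀ {g : M → ℝ}, IsSmooth E g → ∀ᶠ y in 𝓝 (extChartAt 𝓘(ℝ, E) x x),
      DifferentiableAt ℝ (chartFn E x g) y := fun hg => by
    filter_upwards [extChartAt_target_mem_nhds x] with y hy
    exact ((chartFn_contDiffOn x hg).contDiffAt
      ((isOpen_extChartAt_target x).mem_nhds hy)).differentiableAt (by simp)
  let b := Module.finBasis ℝ E
  obtain ⟨D, hDf, hD⟩ := F.exists_coordinate_fields x b
  obtain ⟨C, -, hC⟩ := b.exists_opNorm_le (F := ℝ)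
  -- it suffices to bound the derivatives along the coordinate fields
  have key : ∀ {g : M → ℝ} {n : ℕ}, IsSmooth E g →
      (∀ l, VanishesToOrder n (chartFn E x ((D l).act g)) (extChartAt 𝓘(ℝ, E) x x)) →
      VanishesToOrder n (fderiv ℝ (chartFn E x g)) (extChartAt 𝓘(ℝ, E) x x) := by
    intro g n hg hl
    have h1 : (fun y => ∑ l, |chartFn E x ((D l).act g) y|)
        =O[𝓝 (extChartAt 𝓘(ℝ, E) x x)] fun y => ‖y - extChartAt 𝓘(ℝ, E) x x‖ ^ n :=
      IsBigO.fun_sum fun l _ => (hl l).abs_left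
    refine (IsBigO.of_bound C ?_).trans h1
    filter_upwards [hD, extChartAt_target_mem_nhds x] with y hy hyt
    rw [Real.norm_of_nonneg (by positivity)]
    refine hC (by positivity) fun l => ?_
    rw [← hy l, ← (D l).act_chart x hg hyt, Real.norm_eq_abs]
    exact Finset.single_le_sum (f := fun l => |chartFn E x ((D l).act g) y|)
      (fun _ _ => abs_nonneg _) (Finset.mem_univ l)
  induction n generalizing g with
  | zero =>
    refine VanishesToOrder.of_fderiv (hdiff hg) ?_ (key hg fun l => vanishesToOrder_zero ?_)
    · rw [chartFn, extChartAt_to_inv]; exact h [] (by simp) le_rfl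
    · exact (hdiff ((D l).act_smooth hg)).self_of_nhds.continuousAt
  | succ n ih =>
    refine VanishesToOrder.of_fderiv (hdiff hg) ?_ (key hg fun l => ih ((D l).act_smooth hg)
      fun L hL hLn => ?_)
    · rw [chartFn, extChartAt_to_inv]; exact h [] (by simp) (Nat.zero_le _)
    · have := h (L ++ [D l]) (fun v hv => ?_) (by simpa using hLn)
      · rwa [List.foldr_append] at this
      · rcases List.mem_append.1 hv with hv | hv
        · exact hL v hv
        · rw [List.mem_singleton.1 hv]; exact hDf l

end Germs

/-! ### Comparison of the weighted and the standard jet filtrations -/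

section Comparison

open Filter Asymptotics

variable {E : Type*} [NormedAddCommGroup E] [NormedSpace ℝ E]
  {M : Type*} [TopologicalSpace M] [ChartedSpace E M] [IsManifold 𝓘(ℝ, E) ∞ M]

namespace Distribution

variable (Δ : Distribution E M) (x : M)

/-- All derivatives of `g` of order less than `n` along sections of `Δ` vanish at `x`. -/
def DerivVanish : ℕ → (M → ℝ) → Prop
  | 0, _ => True
  | n + 1, g => g x = 0 ∧ ∀ v : VField E M, Δ.Flag 1 v → DerivVanish n (v.act g)

variable {Δ x}

theorem DerivVanish.pred {n : ℕ} {g : M → ℝ} (h : Δ.DerivVanish x (n + 1) g) :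
    Δ.DerivVanish x n g := by
  induction n generalizing g with
  | zero => trivial
  | succ n ih => exact ⟨h.1, fun v hv => ih (h.2 v hv)⟩

theorem DerivVanish.mono {n m : ℕ} (hmn : m ≤ n) {g : M → ℝ} (h : Δ.DerivVanish x n g) :
    Δ.DerivVanish x m g := by
  induction hmn with
  | refl => exact h
  | step _ ih => exact ih h.pred

theorem DerivVanish.congr' {n : ℕ} {f g : M → ℝ} (h : Δ.DerivVanish x n f) (hfg : f =ᶠ[𝓝 x] g) :
    Δ.DerivVanish x n g := by
  induction n generalizing f g with
  | zero => trivial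
  | succ n ih => exact ⟨hfg.self_of_nhds ▸ h.1, fun v hv => ih (h.2 v hv) (v.act_eventuallyEq hfg)⟩

theorem derivVanish_zero (n : ℕ) : Δ.DerivVanish x n fun _ => 0 := by
  induction n with
  | zero => trivial
  | succ n ih => exact ⟨rfl, fun v _ => by rwa [show v.act (fun _ => 0) = fun _ => 0 from
      funext (v.act_const 0)]⟩

theorem DerivVanish.add {n : ℕ} {f g : M → ℝ} (hf : IsSmooth E f) (hg : IsSmooth E g)
    (h : Δ.DerivVanish x n f) (h' : Δ.DerivVanish x n g) :
    Δ.DerivVanish x n fun y => f y + g y := by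
  induction n generalizing f g with
  | zero => trivial
  | succ n ih =>
    refine ⟨by simp [h.1, h'.1], fun v hv => ?_⟩
    rw [show v.act (fun y => f y + g y) = fun y => v.act f y + v.act g y from
      funext (v.act_add hf hg)]
    exact ih (v.act_smooth hf) (v.act_smooth hg) (h.2 v hv) (h'.2 v hv)

theorem DerivVanish.mul {n : ℕ} {f g : M → ℝ} (hf : IsSmooth E f) (hg : IsSmooth E g)
    (h : Δ.DerivVanish x n g) : Δ.DerivVanish x n fun y => f y * g y := by
  induction n generalizing f g with
  | zero => trivial
  | succ n ih =>
    refine ⟨by simp [h.1], fun v hv => ?_⟩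
    rw [show v.act (fun y => f y * g y) = fun y => v.act f y * g y + f y * v.act g y from
      funext (v.act_mul hf hg)]
    exact (ih (v.act_smooth hf) hg h.pred).add ((v.act_smooth hf).mul hg)
      (hf.mul (v.act_smooth hg)) (ih hf (v.act_smooth hg) (h.2 v hv))

theorem DerivVanish.sum {n : ℕ} {ι : Type*} (s : Finset ι) {f : ι → M → ℝ}
    (hf : ∀ i ∈ s, IsSmooth E (f i)) (h : ∀ i ∈ s, Δ.DerivVanish x n (f i)) :
    Δ.DerivVanish x n fun y => ∑ i ∈ s, f i y := by
  classical
  induction s using Finset.induction_on with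
  | empty => simpa using derivVanish_zero n
  | insert i s hi ih =>
    simp_rw [Finset.sum_insert hi]
    exact .add (hf i (Finset.mem_insert_self i s))
      (IsSmooth.sum fun j hj => hf j (Finset.mem_insert_of_mem hj)) (h i (Finset.mem_insert_self i s))
      (ih (fun j hj => hf j (Finset.mem_insert_of_mem hj))
        fun j hj => h j (Finset.mem_insert_of_mem hj))

/-- A derivation along a section of `Δ_a` is at most as costly as `a` derivations along sections
of `Δ`. -/
theorem DerivVanish.act_flag [CompleteSpace E] {a : ℕ} {v : VField E M} (hv : Δ.Flag a v) {n : ℕ}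
    {g : M → ℝ} (hg : IsSmooth E g) (h : Δ.DerivVanish x (n + a) g) :
    Δ.DerivVanish x n (v.act g) := by
  induction hv generalizing n g with
  | zero =>
    exact (derivVanish_zero n).congr'
      (Eventually.of_forall fun y => ((mvfderiv 𝓘(ℝ, E) g y).map_zero).symm)
  | base v hv => exact h.2 v (.base v hv)
  | mono i v _ ih => exact ih hg h.pred
  | bracket i v v' Z hv _ hZ _ ih =>
    have h1 : Δ.DerivVanish x n (v.act (v'.act g)) :=
      (ih (n := n + 1) hg (h.mono (by omega))).2 v hv
    have h2 : Δ.DerivVanish x n (v'.act (v.act g)) := ih (v.act_smooth hg) (h.2 v hv)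
    have h3 : Z = v.bracket v' := by ext y; exact hZ y
    refine (h1.add (v.act_smooth (v'.act_smooth hg))
      ((IsSmooth.const (-1)).mul (v'.act_smooth (v.act_smooth hg)))
      (h2.mul (.const (-1)) (v'.act_smooth (v.act_smooth hg)))).congr'
      (Eventually.of_forall fun y => ?_)
    rw [h3, v.bracket_act v' hg]
    ring
  | add i v v' _ _ ih ih' =>
    exact ((ih hg h).add (v.act_smooth hg) (v'.act_smooth hg) (ih' hg h)).congr'
      (Eventually.of_forall fun y => ((mvfderiv 𝓘(ℝ, E) g y).map_add _ _).symm)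
  | smul i f hf v Z _ hZ ih =>
    refine ((ih hg h).mul hf (v.act_smooth hg)).congr' (Eventually.of_forall fun y => ?_)
    have := (mvfderiv 𝓘(ℝ, E) g y).map_smul (f y) (v y)
    rw [← hZ y] at this
    exact this.symm

end Distribution

/-- A word of weight less than `n` has fewer than `n` derivatives along `Δ`. -/
theorem AdaptedFrame.word_eq_zero_of_derivVanish [CompleteSpace E] {Δ : Distribution E M} {x : M}
    (A : AdaptedFrame Δ x) (L : List (Fin A.n)) {n : ℕ} {g : M → ℝ} (hg : IsSmooth E g)
    (h : Δ.DerivVanish x (n + A.listWt L) g) : Δ.DerivVanish x n (A.word L g) := by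
  induction L generalizing n with
  | nil => exact h
  | cons j L ih =>
    rw [listWt_cons, ← add_assoc] at h
    exact (ih h).act_flag (A.field_flag j) (A.word_smooth L hg)

variable [FiniteDimensional ℝ E] [T2Space M]

theorem Distribution.derivVanish_of_vanishesToOrder {Δ : Distribution E M} {x : M} {n : ℕ}
    {g : M → ℝ} (hg : IsSmooth E g)
    (h : VanishesToOrder n (chartFn E x g) (extChartAt 𝓘(ℝ, E) x x)) : Δ.DerivVanish x n g := by
  induction n generalizing g with
  | zero => trivial
  | succ n ih =>
    refine ⟨?_, fun v _ => ih (v.act_smooth hg) (h.act hg v)⟩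
    have := h.eq_zero (Nat.succ_ne_zero n)
    rwa [chartFn, extChartAt_to_inv] at this

theorem VField.vanishesToOrder_inChart_iff {x : M} {X : VField E M} {n : ℕ} :
    VanishesToOrder n (X.inChart x) (extChartAt 𝓘(ℝ, E) x x) ↔
      ∀ m < n, iteratedFDeriv ℝ m (X.inChart x) (extChartAt 𝓘(ℝ, E) x x) = 0 :=
  have : CompleteSpace E := FiniteDimensional.complete ℝ E
  vanishesToOrder_iff_of_contDiffOn (extChartAt_target_mem_nhds x) (X.inChart_contDiffOn x)

namespace FilteredStructure

variable (F : FilteredStructure E M)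

theorem vanishesToOrder_pair (F : FilteredStructure E M) {x : M} {X : VField E M} {n : ℕ} (α : OneForm E M)
    (h : VanishesToOrder n (X.inChart x) (extChartAt 𝓘(ℝ, E) x x)) :
    VanishesToOrder n (chartFn E x (α.pair X)) (extChartAt 𝓘(ℝ, E) x x) := by
  obtain ⟨K, -, hK⟩ := F.exists_pair_bound x α
  exact (IsBigO.of_bound K (hK.mono fun y hy => hy X)).trans h

/-- In a chart, a field is bounded by its components with respect to an adapted frame. -/
theorem _root_.FilteredGeometry.AdaptedFrame.exists_inChart_bound {Δ : Distribution E M} {x : M}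
    (A : AdaptedFrame Δ x) : ∃ K : ℝ, 0 ≤ K ∧ ∀ᶠ y in 𝓝 (extChartAt 𝓘(ℝ, E) x x),
      ∀ X : VField E M, ‖X.inChart x y‖ ≤ K * ∑ k, |chartFn E x ((A.form k).pair X) y| := by
  refine ⟨∑ k, (‖(A.field k).inChart x (extChartAt 𝓘(ℝ, E) x x)‖ + 1), by positivity, ?_⟩
  have h1 : ∀ k, ∀ᶠ y in 𝓝 (extChartAt 𝓘(ℝ, E) x x), ‖(A.field k).inChart x y‖ <
      ‖(A.field k).inChart x (extChartAt 𝓘(ℝ, E) x x)‖ + 1 := fun k =>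
    ((A.field k).contDiffAt_inChart x (mem_extChartAt_target x)).continuousAt.norm.eventually
      (gt_mem_nhds (lt_add_one _))
  have h2 := (continuousAt_extChartAt_symm (I := 𝓘(ℝ, E)) x).eventually
    (by rw [extChartAt_to_inv]; exact A.dom_mem_nhds A.mem_dom)
  filter_upwards [eventually_all.2 h1, h2] with y hy hyd X
  have h3 : X.inChart x y =
      ∑ k, chartFn E x ((A.form k).pair X) y • (A.field k).inChart x y := by
    simp only [VField.inChart]
    rw [A.expand X _ hyd, map_sum]
    exact Finset.sum_congr rfl fun k _ => map_smul _ _ _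
  rw [h3, Finset.mul_sum]
  refine norm_sum_le_of_le _ fun k _ => ?_
  rw [norm_smul, Real.norm_eq_abs, mul_comm]
  refine mul_le_mul_of_nonneg_right ((hy k).le.trans ?_) (abs_nonneg _)
  exact Finset.single_le_sum (f := fun k => ‖(A.field k).inChart x (extChartAt 𝓘(ℝ, E) x x)‖ + 1)
    (fun _ _ => by positivity) (Finset.mem_univ k)

/-- A field with zero weighted `(i-1)`-jet vanishes to order `⌊i/ν⌋ + 1`. -/
theorem vanishesToOrder_of_mem_weightedJetKer {x : M} {X : VField E M} {i : ℕ}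
    (hX : X ∈ F.dist.weightedJetKer ((i : ℤ) - 1) x) :
    VanishesToOrder (i / F.depth + 1) (X.inChart x) (extChartAt 𝓘(ℝ, E) x x) := by
  obtain ⟨A⟩ := F.nonempty_adaptedFrame x
  obtain ⟨K, -, hK⟩ := A.exists_inChart_bound
  have h1 : ∀ k, VanishesToOrder (i / F.depth + 1) (chartFn E x ((A.form k).pair X))
      (extChartAt 𝓘(ℝ, E) x x) := by
    intro k
    refine F.vanishesToOrder_of_foldr_eq_zero ((A.form k).pair_smooth X) fun L hL hLi => ?_
    have h2 := hX (fun X => Distribution.monomialOp (fun _ => 1)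
      (L.map fun v => (F.depth, v)) ((A.form k).pair X)) (Submodule.subset_span ⟨1, i, A.form k,
        fun _ => 1, L.map fun v => (F.depth, v), le_rfl, by push_cast; ring,
        Distribution.formFiltration_mono (A.wt_pos k) (A.form_mem k), IsSmooth.const 1, ?_, ?_, rfl⟩)
    · simpa [Distribution.monomialOp, List.foldr_map] using h2
    · intro p hp
      obtain ⟨v, hv, rfl⟩ := List.mem_map.1 hp
      exact hL v hv
    · simp only [List.map_map, Function.comp_def, List.map_const', List.sum_replicate,
        smul_eq_mul]
      exact (Nat.mul_le_mul_right _ hLi).trans (Nat.div_mul_le_self _ _)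
  refine (IsBigO.of_bound K (hK.mono fun y hy => ?_)).trans
    (IsBigO.fun_sum (s := Finset.univ) fun k _ => (h1 k).abs_left)
  rw [Real.norm_of_nonneg (by positivity)]
  exact hy X

/-- A symmetry vanishing to order `s ≥ 1` in the standard sense vanishes to order `s - 1 + w`
along `Δ` on the forms of weight `w`: the equation expresses the derivatives along `Δ` of the
components of weight `w ≥ 2` by components of weight at least `w - 1`. -/
theorem IsSymmetry.derivVanish [CompleteSpace E] {F : FilteredStructure E M} {x : M}
    {X : VField E M} (hX : F.IsSymmetry X) {s : ℕ} (hs : 1 ≤ s)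
    (h : VanishesToOrder s (X.inChart x) (extChartAt 𝓘(ℝ, E) x x)) (A : AdaptedFrame F.dist x)
    (n : ℕ) (k : Fin A.n) (hn : n + 1 ≤ s + A.wt k) :
    F.dist.DerivVanish x n ((A.form k).pair X) := by
  induction n generalizing k with
  | zero => trivial
  | succ n ih =>
    have hsm := (A.form k).pair_smooth X
    rcases Nat.lt_or_ge (A.wt k) 2 with hk | hk
    · exact (Distribution.derivVanish_of_vanishesToOrder hsm
        (F.vanishesToOrder_pair (A.form k) h)).mono (by omega)
    refine ⟨?_, fun v hv => ?_⟩
    · have h0 := h.eq_zero (by omega)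
      rw [X.inChart_self] at h0
      change A.form k x (X x) = 0
      exact (congrArg (A.form k x) h0).trans (A.form k x).map_zero
    · have hsum : F.dist.DerivVanish x n fun y => ∑ l,
          (-1) * ((A.form k).pair (v.bracket (A.field l)) y * (A.form l).pair X y) := by
        refine Distribution.DerivVanish.sum _ (fun l _ => (IsSmooth.const _).mul
          (((A.form k).pair_smooth _).mul ((A.form l).pair_smooth X))) fun l _ => ?_
        refine Distribution.DerivVanish.mul (.const _)
          (((A.form k).pair_smooth _).mul ((A.form l).pair_smooth X)) ?_
        by_cases hl : A.wt k ≤ A.wt l + 1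
        · exact (ih l (by omega)).mul ((A.form k).pair_smooth _) ((A.form l).pair_smooth X)
        · have h0 : ∀ y, (A.form k).pair (v.bracket (A.field l)) y = 0 := fun y =>
            A.form_pair_eq_zero (hv.lieBracket (A.field_flag l)) (by omega) y
          simpa [h0] using Distribution.derivVanish_zero n
      refine hsum.congr' ?_
      filter_upwards [A.dom_mem_nhds A.mem_dom] with y hy
      -- the bracket of `v` with the expansion of `X` in the frame
      have hbr : v.bracket X y = ∑ l, (v.act ((A.form l).pair X) y • A.field l y +
          (A.form l).pair X y • v.bracket (A.field l) y) := by
        have h1 : v.bracket X y = v.bracket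
            (∑ l, VField.smulFn _ ((A.form l).pair_smooth X) (A.field l)) y := by
          refine v.bracket_congr_right _ _ ?_
          filter_upwards [A.dom_mem_nhds hy] with z hz
          rw [VField.sum_apply]
          exact A.expand X z hz
        have h2 : ∀ t : Finset (Fin A.n), v.bracket
            (∑ l ∈ t, VField.smulFn _ ((A.form l).pair_smooth X) (A.field l)) y =
            ∑ l ∈ t, (v.act ((A.form l).pair X) y • A.field l y +
              (A.form l).pair X y • v.bracket (A.field l) y) := by
          classical
          intro t
          induction t using Finset.induction_on with
          | empty =>
            have h3 := v.bracket_smulFn_right (fun _ => 0) (.const 0) 0 y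
            have h4 : VField.smulFn (fun _ => (0 : ℝ)) (IsSmooth.const 0) (0 : VField E M) = 0 := by
              ext z; exact smul_zero _
            rw [h4, v.act_const] at h3
            simpa using h3
          | insert l t hl ih =>
            rw [Finset.sum_insert hl, Finset.sum_insert hl, v.bracket_add_right, ih,
              VField.bracket_smulFn_right]
        rw [h1, h2]
      have hθ : (A.form k).pair (v.bracket X) y = v.act ((A.form k).pair X) y +
          ∑ l, (A.form l).pair X y * (A.form k).pair (v.bracket (A.field l)) y := by
        have h1 : (A.form k).pair (v.bracket X) y = ∑ l, (v.act ((A.form l).pair X) y *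
            (A.form k).pair (A.field l) y +
            (A.form l).pair X y * (A.form k).pair (v.bracket (A.field l)) y) := by
          simp only [OneForm.pair]
          rw [hbr, map_sum]
          refine Finset.sum_congr rfl fun l _ => ?_
          rw [map_add, map_smul, map_smul]
          rfl
        rw [h1, Finset.sum_add_distrib]
        simp [A.pair_field k _ y hy]
      have hzero : (A.form k).pair (v.bracket X) y = 0 := by
        have h1 : (A.form k).pair (X.bracket v) y = 0 :=
          hX _ (Or.inl ⟨v, A.form k, hv,
            Distribution.formFiltration_mono hk (A.form_mem k), rfl⟩) y
        have h2 : (A.form k).pair (v.bracket X) y = - (A.form k).pair (X.bracket v) y := by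
          simp only [OneForm.pair]
          rw [v.bracket_swap, map_neg]
        rw [h2, h1, neg_zero]
      rw [hzero] at hθ
      rw [← Finset.mul_sum]
      simp_rw [mul_comm ((A.form k).pair _ y)]
      linarith

/-- The bounds relating the standard and the weighted order of a symmetry at a point. -/
theorem jetDetermined_bounds [CompleteSpace E] {x : M} {X : VField E M} {i s : ℕ}
    (hX : X ∈ F.symFiltration i x) (hX' : X ∉ F.symFiltration (i + 1) x)
    (hs : IsJetDetermined s X x) : i / F.depth + 1 ≤ s ∧ s ≤ i + 1 := by
  constructor
  · by_contra! hlt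
    exact hs.2 (VField.vanishesToOrder_inChart_iff.1
      (F.vanishesToOrder_of_mem_weightedJetKer hX.2) s hlt)
  · by_contra! hlt
    refine hX' ⟨hX.1, ?_⟩
    obtain ⟨A⟩ := F.nonempty_adaptedFrame x
    rw [A.mem_weightedJetKer_iff A.mem_dom]
    intro b hb
    rw [AdaptedFrame.mem_opIdx] at hb
    have h1 := hX.1.derivVanish (by omega) (VField.vanishesToOrder_inChart_iff.2 hs.1) A
      (1 + A.listWt b.2.toList) b.1 (by rw [A.listWt_toList]; omega)
    exact (A.word_eq_zero_of_derivVanish _ ((A.form b.1).pair_smooth X) h1).1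

end FilteredStructure

end Comparison

/-! ### The linear system in a chart; determination of symmetries by jets -/

section LinearSystem

open Filter Asymptotics

variable {E : Type*} [NormedAddCommGroup E] [NormedSpace ℝ E]
  {M : Type*} [TopologicalSpace M] [ChartedSpace E M] [IsManifold 𝓘(ℝ, E) ∞ M]

/-- The vector of the basic operators of `𝔇_{-i}` applied to a field, in the chart at the base
point of the frame. -/
def AdaptedFrame.prolong {Δ : Distribution E M} {x₀ : M} (A : AdaptedFrame Δ x₀) (i : ℤ)
    (X : VField E M) : E → (A.opIdx i → ℝ) :=
  fun y b => chartFn E x₀ (A.basisOp b X) y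

theorem AdaptedFrame.prolong_contDiffOn {Δ : Distribution E M} {x₀ : M} (A : AdaptedFrame Δ x₀)
    (i : ℤ) (X : VField E M) :
    ContDiffOn ℝ ∞ (A.prolong i X) (extChartAt 𝓘(ℝ, E) x₀).target :=
  contDiffOn_pi.2 fun b => chartFn_contDiffOn x₀ (A.basisOp_smooth b X)

theorem FilteredStructure.wt_le_depth (F : FilteredStructure E M) {x₀ : M}
    (A : AdaptedFrame F.dist x₀) (k : Fin A.n) : A.wt k ≤ F.depth := by
  by_contra! h
  have h1 : ∀ v : TangentSpace 𝓘(ℝ, E) x₀, v ∈ F.dist.flagAt F.depth x₀ := fun v => by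
    rw [F.flag_depth]; exact Submodule.mem_top
  obtain ⟨X, hX, hXk⟩ := Distribution.mem_flagAt.1 (h1 (A.field k x₀))
  have h2 := A.form_pair_eq_zero hX h x₀
  have h3 := A.pair_field k k x₀ A.mem_dom
  simp only [OneForm.pair] at h2 h3
  rw [← hXk, h2] at h3
  simp at h3

variable [FiniteDimensional ℝ E] [T2Space M]

/-- An equation of finite type is locally equivalent to a linear system for the prolonged
variables, up to error terms given by elements of the module generated by the equation. -/
theorem FilteredStructure.exists_prolongation_bound (F : FilteredStructure E M) {κ : ℕ} {x₀ : M}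
    (hκ : F.completed κ x₀ ∩ F.dist.weightedJetKer ((κ : ℤ) - 1) x₀ ⊆ F.dist.weightedJetKer κ x₀)
    (A : AdaptedFrame F.dist x₀) :
    ∃ (J : Type) (_ : Fintype J) (C : J → Op E M) (K : ℝ), 0 ≤ K ∧
      (∀ j, DModule F.lieOps (C j)) ∧ ∀ᶠ y in 𝓝 (extChartAt 𝓘(ℝ, E) x₀ x₀), ∀ X : VField E M,
        ‖fderiv ℝ (A.prolong (κ - 1) X) y‖ ≤
          K * ‖A.prolong (κ - 1) X y‖ + K * ∑ j, |chartFn E x₀ (C j X) y| ∧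
        ‖X.inChart x₀ y‖ ≤ K * ‖A.prolong (κ - 1) X y‖ := by
  have : CompleteSpace E := FiniteDimensional.complete ℝ E
  have hS : ∀ B ∈ F.lieOps, ∀ X, IsSmooth E (B X) := fun B hB X => F.lieOps_smooth hB X
  have hred : ∀ a ∈ A.opIdx κ, A.Reducible F.lieOps ((κ : ℤ) - 1) (A.basisOp a) := fun a ha =>
    A.reducible_of_symbol_eq_zero hS (fun X h1 h2 => hκ ⟨h1, h2⟩) ha
  let b := Module.finBasis ℝ E
  obtain ⟨D, -, hD⟩ := F.exists_coordinate_fields x₀ b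
  obtain ⟨K₁, hK₁, hop⟩ := b.exists_opNorm_le (F := A.opIdx ((κ : ℤ) - 1) → ℝ)
  obtain ⟨K₂, hK₂, hin⟩ := A.exists_inChart_bound
  have hlin : ∀ (l : Fin (Module.finrank ℝ E)) (a : A.opIdx ((κ : ℤ) - 1)), ∃ C : Op E M,
      DModule F.lieOps C ∧ ∃ d : Fin A.n × Multiset (Fin A.n) → M → ℝ, (∀ b, IsSmooth E (d b)) ∧
      ∀ᶠ y in 𝓝 x₀, ∀ X, (D l).act (A.basisOp a X) y =
        C X y + ∑ b ∈ A.opIdx ((κ : ℤ) - 1), d b y * A.basisOp b X y := fun l a =>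
    (A.reducible_act_basisOp hS hred (D l) a.2).2
  choose C hC d hd hact using hlin
  let K₃ : ℝ := ∑ l, ∑ a, ∑ b : A.opIdx ((κ : ℤ) - 1), (|d l a b x₀| + 1)
  have hK₃ : 0 ≤ K₃ := by positivity
  refine ⟨Fin (Module.finrank ℝ E) × A.opIdx ((κ : ℤ) - 1), inferInstance, fun j => C j.1 j.2,
    K₁ * (K₃ + 1) + K₂ * A.n, by positivity, fun j => hC _ _, ?_⟩
  have h1 : ∀ᶠ y in 𝓝 (extChartAt 𝓘(ℝ, E) x₀ x₀), ∀ l (a : A.opIdx ((κ : ℤ) - 1)), ∀ X,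
      (D l).act (A.basisOp a X) ((extChartAt 𝓘(ℝ, E) x₀).symm y) =
        C l a X ((extChartAt 𝓘(ℝ, E) x₀).symm y) + ∑ b ∈ A.opIdx ((κ : ℤ) - 1),
          d l a b ((extChartAt 𝓘(ℝ, E) x₀).symm y) *
            A.basisOp b X ((extChartAt 𝓘(ℝ, E) x₀).symm y) :=
    eventually_all.2 fun l => eventually_all.2 fun a =>
      (continuousAt_extChartAt_symm (I := 𝓘(ℝ, E)) x₀).eventually
        (by rw [extChartAt_to_inv]; exact hact l a)
  have h2 : ∀ᶠ y in 𝓝 (extChartAt 𝓘(ℝ, E) x₀ x₀), ∀ l, ∀ a b : A.opIdx ((κ : ℤ) - 1),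
      |chartFn E x₀ (d l a b) y| ≤ |d l a b x₀| + 1 :=
    eventually_all.2 fun l => eventually_all.2 fun a => eventually_all.2 fun b =>
      eventually_abs_chartFn_le x₀ (hd l a b)
  filter_upwards [h1, h2, hD, hin, extChartAt_target_mem_nhds x₀] with y h1 h2 hD hin hyt X
  have hnn : 0 ≤ ‖A.prolong ((κ : ℤ) - 1) X y‖ := norm_nonneg _
  have hsum : 0 ≤ ∑ j : Fin (Module.finrank ℝ E) × A.opIdx ((κ : ℤ) - 1),
      |chartFn E x₀ (C j.1 j.2 X) y| := by positivity
  have hle : ∀ a : A.opIdx ((κ : ℤ) - 1),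
      |chartFn E x₀ (A.basisOp a X) y| ≤ ‖A.prolong ((κ : ℤ) - 1) X y‖ := fun a =>
    norm_le_pi_norm (A.prolong ((κ : ℤ) - 1) X y) a
  constructor
  · have hdiff : DifferentiableAt ℝ (A.prolong ((κ : ℤ) - 1) X) y :=
      ((A.prolong_contDiffOn _ X).contDiffAt
        ((isOpen_extChartAt_target x₀).mem_nhds hyt)).differentiableAt (by simp)
    have h3 : ∀ l, ‖fderiv ℝ (A.prolong ((κ : ℤ) - 1) X) y (b l)‖ ≤
        K₃ * ‖A.prolong ((κ : ℤ) - 1) X y‖ +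
          ∑ j : Fin (Module.finrank ℝ E) × A.opIdx ((κ : ℤ) - 1),
            |chartFn E x₀ (C j.1 j.2 X) y| := by
      intro l
      refine (pi_norm_le_iff_of_nonneg (by positivity)).2 fun a => ?_
      have h4 : fderiv ℝ (A.prolong ((κ : ℤ) - 1) X) y (b l) a =
          chartFn E x₀ ((D l).act (A.basisOp a X)) y := by
        rw [(D l).act_chart x₀ (A.basisOp_smooth a X) hyt, hD l]
        have h5 := (hasFDerivAt_pi'.1 hdiff.hasFDerivAt) a
        exact (congrArg (fun L : E →L[ℝ] ℝ => L (b l)) h5.fderiv).symm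
      rw [h4, chartFn, h1 l a X, Real.norm_eq_abs]
      refine (abs_add_le _ _).trans ?_
      rw [add_comm]
      refine add_le_add ?_ (Finset.single_le_sum
        (f := fun j : Fin (Module.finrank ℝ E) × A.opIdx ((κ : ℤ) - 1) =>
          |chartFn E x₀ (C j.1 j.2 X) y|) (fun _ _ => abs_nonneg _) (Finset.mem_univ (l, a)))
      rw [← Finset.sum_coe_sort]
      have h6 : ∑ b : A.opIdx ((κ : ℤ) - 1), (|d l a b x₀| + 1) ≤ K₃ :=
        (Finset.single_le_sum (f := fun a => ∑ b : A.opIdx ((κ : ℤ) - 1), (|d l a b x₀| + 1))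
          (fun _ _ => by positivity) (Finset.mem_univ a)).trans
        (Finset.single_le_sum (f := fun l => ∑ a, ∑ b : A.opIdx ((κ : ℤ) - 1),
          (|d l a b x₀| + 1)) (fun _ _ => by positivity) (Finset.mem_univ l))
      refine le_trans ?_ (mul_le_mul_of_nonneg_right h6 hnn)
      rw [Finset.sum_mul]
      refine (Finset.abs_sum_le_sum_abs _ _).trans (Finset.sum_le_sum fun b _ => ?_)
      rw [abs_mul]
      exact mul_le_mul (h2 l a b) (hle b) (abs_nonneg _) (by positivity)
    refine (hop (by positivity) h3).trans ?_
    have : 0 ≤ K₂ * A.n := by positivity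
    nlinarith [mul_nonneg this hnn, mul_nonneg this hsum, mul_nonneg hK₁.le hnn,
      mul_nonneg (mul_nonneg hK₁.le hK₃) hsum]
  · refine (hin X).trans ?_
    have h3 : ∑ k, |chartFn E x₀ ((A.form k).pair X) y| ≤
        A.n * ‖A.prolong ((κ : ℤ) - 1) X y‖ := by
      have h4 : ∀ k, |chartFn E x₀ ((A.form k).pair X) y| ≤ ‖A.prolong ((κ : ℤ) - 1) X y‖ := by
        intro k
        have hk : (k, (0 : Multiset (Fin A.n))) ∈ A.opIdx ((κ : ℤ) - 1) := by
          rw [A.mem_opIdx]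
          have := A.wt_pos k
          simp only [AdaptedFrame.msWt, Multiset.map_zero, Multiset.sum_zero]
          omega
        have := hle ⟨_, hk⟩
        simpa [AdaptedFrame.basisOp, AdaptedFrame.word] using this
      calc _ ≤ ∑ _k : Fin A.n, ‖A.prolong ((κ : ℤ) - 1) X y‖ :=
            Finset.sum_le_sum fun k _ => h4 k
        _ = _ := by simp
    have : 0 ≤ K₁ * (K₃ + 1) * ‖A.prolong ((κ : ℤ) - 1) X y‖ := by positivity
    calc _ ≤ K₂ * (A.n * ‖A.prolong ((κ : ℤ) - 1) X y‖) := mul_le_mul_of_nonneg_left h3 hK₂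
      _ ≤ _ := by nlinarith

/-- The prolonged variables of a field vanishing to high order vanish. -/
theorem AdaptedFrame.vanishesToOrder_basisOp (F : FilteredStructure E M) {x₀ : M}
    (A : AdaptedFrame F.dist x₀) (b : Fin A.n × Multiset (Fin A.n)) {X : VField E M} {n : ℕ}
    (h : VanishesToOrder (n + b.2.card) (X.inChart x₀) (extChartAt 𝓘(ℝ, E) x₀ x₀)) :
    VanishesToOrder n (chartFn E x₀ (A.basisOp b X)) (extChartAt 𝓘(ℝ, E) x₀ x₀) := by
  have key : ∀ (L : List (Fin A.n)) {n : ℕ} {g : M → ℝ}, IsSmooth E g →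
      VanishesToOrder (n + L.length) (chartFn E x₀ g) (extChartAt 𝓘(ℝ, E) x₀ x₀) →
      VanishesToOrder n (chartFn E x₀ (A.word L g)) (extChartAt 𝓘(ℝ, E) x₀ x₀) := by
    intro L
    induction L with
    | nil => exact fun _ h => h
    | cons j L ih =>
      intro n g hg h
      refine VanishesToOrder.act (A.word_smooth L hg) (A.field j) (ih hg ?_)
      rwa [List.length_cons, ← add_assoc, add_right_comm] at h
  refine key _ ((A.form _).pair_smooth X) ?_
  rw [Multiset.length_toList]
  exact F.vanishesToOrder_pair _ h

theorem AdaptedFrame.card_le_of_mem_opIdx (F : FilteredStructure E M) {x₀ : M}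
    (A : AdaptedFrame F.dist x₀) {κ : ℕ} {b : Fin A.n × Multiset (Fin A.n)}
    (hb : b ∈ A.opIdx ((κ : ℤ) - 1)) : b.2.card ≤ κ + F.depth := by
  rw [A.mem_opIdx] at hb
  have h1 := A.card_le_msWt b.2
  have h2 := F.wt_le_depth A b.1
  omega

/-- A symmetry with zero prolonged variables at a point vanishes: the set of such points is open and
closed, as the prolonged variables of a symmetry satisfy a homogeneous linear system. -/
theorem FilteredStructure.IsSymmetry.eq_zero [ConnectedSpace M] {F : FilteredStructure E M} {κ : ℕ}
    (hκ : ∀ x, F.completed κ x ∩ F.dist.weightedJetKer ((κ : ℤ) - 1) x ⊆ F.dist.weightedJetKer κ x)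
    {Z : VField E M} (hZ : F.IsSymmetry Z) {x : M}
    (hx : Z ∈ F.dist.weightedJetKer ((κ : ℤ) - 1) x) : Z = 0 := by
  have : CompleteSpace E := FiniteDimensional.complete ℝ E
  let N : Set M := {x | Z ∈ F.dist.weightedJetKer ((κ : ℤ) - 1) x}
  have hclopen : IsClopen N := by
    refine ⟨⟨isOpen_iff_mem_nhds.2 fun x₀ hx₀ => ?_⟩, isOpen_iff_mem_nhds.2 fun x₀ hx₀ => ?_⟩
    · obtain ⟨A⟩ := F.nonempty_adaptedFrame x₀
      have hx₀' : ¬ ∀ b ∈ A.opIdx ((κ : ℤ) - 1), A.basisOp b Z x₀ = 0 := fun h =>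
        hx₀ ((A.mem_weightedJetKer_iff A.mem_dom).2 h)
      push Not at hx₀'
      obtain ⟨b, hb, hne⟩ := hx₀'
      filter_upwards [(A.basisOp_smooth b Z).continuous.continuousAt.eventually_ne hne] with y hy hyN
      exact hy (hyN _ (A.basisOp_mem hb))
    · obtain ⟨A⟩ := F.nonempty_adaptedFrame x₀
      obtain ⟨J, _, C, K, hK, hC, hev⟩ := F.exists_prolongation_bound (hκ x₀) A
      set p := extChartAt 𝓘(ℝ, E) x₀ x₀
      obtain ⟨r, hr, hball⟩ := Metric.nhds_basis_closedBall.mem_iff.1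
        (hev.and (extChartAt_target_mem_nhds (I := 𝓘(ℝ, E)) x₀))
      let ρ : ℝ := min r (1 / (2 * (K + 1)))
      have hρ : 0 < ρ := by positivity
      have hsub : Metric.closedBall p ρ ⊆ Metric.closedBall p r :=
        Metric.closedBall_subset_closedBall (min_le_left _ _)
      have h0 : A.prolong ((κ : ℤ) - 1) Z p = 0 := by
        funext b
        simp only [AdaptedFrame.prolong, chartFn, p]
        rw [extChartAt_to_inv]
        exact (A.mem_weightedJetKer_iff A.mem_dom).1 hx₀ b b.2
      have hCZ : ∀ j y, chartFn E x₀ (C j Z) y = 0 := fun j y => by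
        rw [chartFn, (hC j).apply_eq_zero hZ]
      have hzero := norm_le_of_norm_fderiv_le (u := A.prolong ((κ : ℤ) - 1) Z) (x₀ := p) (r := ρ)
        (C := K) (ε := 0) hρ.le (fun y hy => ((A.prolong_contDiffOn _ Z).contDiffAt
          ((isOpen_extChartAt_target x₀).mem_nhds (hball (hsub hy)).2)).differentiableAt (by simp))
        h0 hK (by
          calc K * ρ ≤ (K + 1) * (1 / (2 * (K + 1))) := by
                gcongr
                · linarith
                · exact min_le_right _ _
            _ = 1 / 2 := by field_simp) (fun y hy => by
          have := ((hball (hsub hy)).1 Z).1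
          simpa [hCZ] using this)
      have hnhds : ∀ᶠ z in 𝓝 x₀, extChartAt 𝓘(ℝ, E) x₀ z ∈ Metric.closedBall p ρ :=
        (continuousAt_extChartAt (I := 𝓘(ℝ, E)) x₀).eventually (Metric.closedBall_mem_nhds p hρ)
      filter_upwards [hnhds, extChartAt_source_mem_nhds (I := 𝓘(ℝ, E)) x₀,
        A.dom_mem_nhds A.mem_dom] with z hz hzs hzd
      refine (A.mem_weightedJetKer_iff hzd).2 fun b hb => ?_
      have h1 := hzero _ hz
      rw [mul_zero, norm_le_zero_iff] at h1
      have h2 := congrFun h1 ⟨b, hb⟩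
      simp only [AdaptedFrame.prolong, chartFn] at h2
      rwa [(extChartAt 𝓘(ℝ, E) x₀).left_inv hzs] at h2
  have huniv : N = Set.univ := hclopen.eq_univ ⟨x, hx⟩
  ext y
  obtain ⟨A⟩ := F.nonempty_adaptedFrame y
  have hy : y ∈ N := huniv ▸ Set.mem_univ y
  change Z ∈ F.dist.weightedJetKer ((κ : ℤ) - 1) y at hy
  rw [A.mem_weightedJetKer_iff A.mem_dom] at hy
  rw [A.expand Z y A.mem_dom]
  refine Finset.sum_eq_zero fun k _ => ?_
  have hk : (k, (0 : Multiset (Fin A.n))) ∈ A.opIdx ((κ : ℤ) - 1) := by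
    rw [A.mem_opIdx]
    have := A.wt_pos k
    simp only [AdaptedFrame.msWt, Multiset.map_zero, Multiset.sum_zero]
    omega
  have h1 : (A.form k).pair Z y = 0 := by
    simpa [AdaptedFrame.basisOp, AdaptedFrame.word] using hy _ hk
  rw [h1, zero_smul]

/-- Symmetries of a structure of finite type are determined by finite jets. -/
theorem FilteredStructure.symmetry_eq_of_sameFieldJet [ConnectedSpace M]
    (F : FilteredStructure E M) {κ : ℕ}
    (hκ : ∀ x, F.completed κ x ∩ F.dist.weightedJetKer ((κ : ℤ) - 1) x ⊆ F.dist.weightedJetKer κ x)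
    {x : M} {X Y : VField E M} (hX : F.IsSymmetry X) (hY : F.IsSymmetry Y)
    (h : SameFieldJet (κ + F.depth) X Y x) : X = Y := by
  have : CompleteSpace E := FiniteDimensional.complete ℝ E
  rw [← sub_eq_zero]
  refine (hX.sub F hY).eq_zero hκ (x := x) ?_
  obtain ⟨A⟩ := F.nonempty_adaptedFrame x
  rw [A.mem_weightedJetKer_iff A.mem_dom]
  intro b hb
  have hcard := A.card_le_of_mem_opIdx F hb
  have h1 : VanishesToOrder (κ + F.depth + 1) ((X - Y).inChart x) (extChartAt 𝓘(ℝ, E) x x) := by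
    rw [VField.vanishesToOrder_inChart_iff]
    intro m hm
    have hx := mem_extChartAt_target (I := 𝓘(ℝ, E)) x
    rw [VField.inChart_sub, iteratedFDeriv_sub_apply
      ((X.contDiffAt_inChart x hx).of_le (natCast_le_infty _))
      ((Y.contDiffAt_inChart x hx).of_le (natCast_le_infty _)), h m (by omega), sub_self]
  have h2 := (A.vanishesToOrder_basisOp F b (n := 1) (h1.mono (by omega))).eq_zero one_ne_zero
  rwa [chartFn, extChartAt_to_inv] at h2

end LinearSystem

/-! ### The nonlinear equations of automorphisms -/

section NonlinearEquation

open Filter Asymptotics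

variable {E : Type*} [NormedAddCommGroup E] [NormedSpace ℝ E]

instance finiteDimensional_continuousMultilinearMap [FiniteDimensional ℝ E] (n : ℕ) :
    FiniteDimensional ℝ (E [×n]→L[ℝ] E) :=
  FiniteDimensional.of_injective (ContinuousMultilinearMap.toMultilinearMapLinear (R' := ℝ))
    ContinuousMultilinearMap.toMultilinearMap_injective

variable {M : Type*} [TopologicalSpace M] [ChartedSpace E M] [IsManifold 𝓘(ℝ, E) ∞ M]

theorem contDiffOn_extChartAt_comp {x q : M} {φ : M → M} (hφ : ContMDiff 𝓘(ℝ, E) 𝓘(ℝ, E) ∞ φ)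
    (hx : φ x ∈ (extChartAt 𝓘(ℝ, E) q).source) :
    ∃ U ∈ 𝓝 (extChartAt 𝓘(ℝ, E) x x), ContDiffOn ℝ ∞
      (fun y => extChartAt 𝓘(ℝ, E) q (φ ((extChartAt 𝓘(ℝ, E) x).symm y))) U := by
  refine ⟨(extChartAt 𝓘(ℝ, E) x).target ∩
    {y | φ ((extChartAt 𝓘(ℝ, E) x).symm y) ∈ (extChartAt 𝓘(ℝ, E) q).source},
    inter_mem (extChartAt_target_mem_nhds x) ?_, ?_⟩
  · have h1 : ContinuousAt (fun y => φ ((extChartAt 𝓘(ℝ, E) x).symm y))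
        (extChartAt 𝓘(ℝ, E) x x) :=
      hφ.continuous.continuousAt.comp (continuousAt_extChartAt_symm (I := 𝓘(ℝ, E)) x)
    refine h1.preimage_mem_nhds ((isOpen_extChartAt_source (I := 𝓘(ℝ, E)) q).mem_nhds ?_)
    rwa [extChartAt_to_inv]
  · rw [← contMDiffOn_iff_contDiffOn]
    have h1 : ContMDiffOn 𝓘(ℝ, E) 𝓘(ℝ, E) ∞ (extChartAt 𝓘(ℝ, E) q)
        (extChartAt 𝓘(ℝ, E) q).source := by
      rw [extChartAt_source]; exact contMDiffOn_extChartAt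
    exact h1.comp (hφ.comp_contMDiffOn ((contMDiffOn_extChartAt_symm x).mono
      Set.inter_subset_left)) fun y hy => hy.2

theorem contDiffOn_mapInChart {x₀ : M} {φ : M → M} (hφ : ContMDiff 𝓘(ℝ, E) 𝓘(ℝ, E) ∞ φ)
    (hx₀ : φ x₀ ∈ (extChartAt 𝓘(ℝ, E) x₀).source) :
    ∃ U ∈ 𝓝 (extChartAt 𝓘(ℝ, E) x₀ x₀), ContDiffOn ℝ ∞ (mapInChart E x₀ φ) U :=
  contDiffOn_extChartAt_comp hφ hx₀

theorem mapInChart_self {x₀ : M} {φ : M → M} (hx₀ : φ x₀ = x₀) :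
    mapInChart E x₀ φ (extChartAt 𝓘(ℝ, E) x₀ x₀) = extChartAt 𝓘(ℝ, E) x₀ x₀ := by
  rw [mapInChart, extChartAt_to_inv, hx₀]

theorem contDiff_jetValue : ContDiff ℝ ∞ fun J : JetFiber E 1 => J 0 0 :=
  (ContinuousMultilinearMap.apply ℝ (fun _ : Fin 0 => E) E 0).contDiff.comp
    (ContinuousLinearMap.proj (R := ℝ) (φ := fun m : Fin 2 => E [×(m : ℕ)]→L[ℝ] E) 0).contDiff

/-- The linear part of a `1`-jet. -/
def jetDeriv (J : JetFiber E 1) : E →L[ℝ] E := continuousMultilinearCurryFin1 ℝ E E (J 1)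

theorem contDiff_jetDeriv : ContDiff ℝ ∞ (jetDeriv (E := E)) :=
  (continuousMultilinearCurryFin1 ℝ E E).contDiff.comp
    (ContinuousLinearMap.proj (R := ℝ) (φ := fun m : Fin 2 => E [×(m : ℕ)]→L[ℝ] E) 1).contDiff

theorem coordJet_jetValue (f : E → E) (y : E) : coordJet 1 f y 0 0 = f y :=
  iteratedFDeriv_zero_apply _

theorem jetDeriv_coordJet (f : E → E) (y : E) : jetDeriv (coordJet 1 f y) = fderiv ℝ f y := by
  ext v
  refine (continuousMultilinearCurryFin1_apply _ _).trans ?_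
  refine (iteratedFDeriv_one_apply (𝕜 := ℝ) (f := f) (x := y) _).trans ?_
  rfl

theorem Distribution.Flag.mem_space {Δ : Distribution E M} {i : ℕ} {X : VField E M}
    (h : Δ.Flag i X) (hi : i ≤ 1) (x : M) : X x ∈ Δ.space x := by
  induction h with
  | zero => exact (Δ.space x).zero_mem
  | base X h => exact h x
  | mono i X _ ih => exact ih (by omega)
  | bracket i X Y Z _ hY hZ =>
    obtain rfl : Y = 0 := hY.eq_zero (by omega)
    have h1 : Z x = 0 := (hZ x).trans (congrFun VectorField.mlieBracket_zero_right x)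
    rw [h1]
    exact (Δ.space x).zero_mem
  | add i X Y _ _ ih ih' => exact (Δ.space x).add_mem (ih hi) (ih' hi)
  | smul i f _ X Z _ hZ ih => rw [hZ]; exact (Δ.space x).smul_mem _ (ih hi)

/-- A map preserving the filtered structure: the condition defining automorphisms, for maps which
are not assumed to be invertible. -/
def FilteredStructure.Preserves (F : FilteredStructure E M) (φ : M → M) : Prop :=
  ContMDiff 𝓘(ℝ, E) 𝓘(ℝ, E) ∞ φ ∧
    (∀ x, ∀ v ∈ F.dist.space x, mfderiv 𝓘(ℝ, E) 𝓘(ℝ, E) φ x v ∈ F.dist.space (φ x)) ∧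
    ∀ j x, (F.red j).mem φ x

theorem FilteredStructure.preserves_id (F : FilteredStructure E M) : F.Preserves id :=
  ⟨contMDiff_id, fun x v hv => by rw [mfderiv_id]; exact hv, fun j x => (F.red j).one x⟩

theorem FilteredStructure.Preserves.comp {F : FilteredStructure E M} {φ ψ : M → M}
    (hψ : F.Preserves ψ) (hφ : F.Preserves φ) : F.Preserves (ψ ∘ φ) := by
  refine ⟨hψ.1.comp hφ.1, fun x v hv => ?_, fun j x =>
    (F.red j).comp φ ψ x (hφ.2.2 j x) (hψ.2.2 j (φ x))⟩
  rw [mfderiv_comp x (hψ.1.mdifferentiableAt (by simp)) (hφ.1.mdifferentiableAt (by simp))]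
  exact hψ.2.1 _ _ (hφ.2.1 x v hv)

theorem FilteredStructure.Preserves.iterate {F : FilteredStructure E M} {φ : M → M}
    (hφ : F.Preserves φ) (n : ℕ) : F.Preserves φ^[n] := by
  induction n with
  | zero => exact F.preserves_id
  | succ n ih => rw [Function.iterate_succ]; exact ih.comp hφ

/-- A bound for the orders of the equations of a filtered structure. -/
def FilteredStructure.maxOrder (F : FilteredStructure E M) : ℕ := 1 + ∑ j, F.order j

variable [FiniteDimensional ℝ E] [T2Space M]

/-- The bracket of fields in a chart. -/
theorem VField.bracket_inChart_eventually [CompleteSpace E] (x₀ : M) :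
    ∀ᶠ y in 𝓝 (extChartAt 𝓘(ℝ, E) x₀ x₀), ∀ X Y : VField E M, (X.bracket Y).inChart x₀ y =
      fderiv ℝ (Y.inChart x₀) y (X.inChart x₀ y) - fderiv ℝ (X.inChart x₀) y (Y.inChart x₀ y) := by
  let b := Module.finBasis ℝ E
  obtain ⟨c, hc, -, hcX⟩ := exists_coordinate_functions (M := M) x₀ b
  filter_upwards [hcX.eventually_nhds, extChartAt_target_mem_nhds x₀] with y hy hyt X Y
  have hact : ∀ (Z W : VField E M) l,
      Z.act (W.act (c l)) ((extChartAt 𝓘(ℝ, E) x₀).symm y) =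
        b.coord l (fderiv ℝ (W.inChart x₀) y (Z.inChart x₀ y)) := by
    intro Z W l
    refine (Z.act_chart x₀ (W.act_smooth (hc l)) hyt).trans ?_
    have h1 : chartFn E x₀ (W.act (c l)) =ᶠ[𝓝 y]
        fun z => LinearMap.toContinuousLinearMap (b.coord l) (W.inChart x₀ z) :=
      hy.mono fun z hz => hz l W
    have h2 : DifferentiableAt ℝ (W.inChart x₀) y :=
      (W.contDiffAt_inChart x₀ hyt).differentiableAt (by simp)
    have h3 := (((LinearMap.toContinuousLinearMap (b.coord l)).hasFDerivAt).comp y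
      h2.hasFDerivAt).fderiv
    rw [h1.fderiv_eq]
    exact congrArg (fun L : E →L[ℝ] ℝ => L (Z.inChart x₀ y)) h3
  refine b.ext_elem fun l => ?_
  have h3 := hy.self_of_nhds l (X.bracket Y)
  rw [X.bracket_act Y (hc l), hact, hact] at h3
  rw [← Module.Basis.coord_apply, ← h3, ← map_sub]
  rfl

/-- Each operator of the Lie equation is, near every point, the linearization at the identity of a
smooth equation satisfied by the jets of the maps which preserve the structure. -/
theorem FilteredStructure.exists_local_equation (F : FilteredStructure E M) {B : Op E M}
    (hB : B ∈ F.lieOps) (x₀ : M) : ∃ (k : ℕ) (Φ : E × JetFiber E k → ℝ), k ≤ F.maxOrder ∧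
      ContDiff ℝ ∞ Φ ∧
      (∀ᶠ y in 𝓝 (extChartAt 𝓘(ℝ, E) x₀ x₀), ∀ X : VField E M, chartFn E x₀ (B X) y =
        fderiv ℝ Φ (y, coordJet k id y) (0, coordJet k (X.inChart x₀) y)) ∧
      ∀ φ : M → M, F.Preserves φ → φ x₀ = x₀ →
        coordJet k (mapInChart E x₀ φ) (extChartAt 𝓘(ℝ, E) x₀ x₀) =
          coordJet k id (extChartAt 𝓘(ℝ, E) x₀ x₀) →
        ∀ᶠ y in 𝓝 (extChartAt 𝓘(ℝ, E) x₀ x₀), Φ (y, coordJet k (mapInChart E x₀ φ) y) = 0 := by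
  have : CompleteSpace E := FiniteDimensional.complete ℝ E
  set p := extChartAt 𝓘(ℝ, E) x₀ x₀ with hp
  have hpt : (extChartAt 𝓘(ℝ, E) x₀).target ∈ 𝓝 p := extChartAt_target_mem_nhds x₀
  have hsymm : Tendsto (extChartAt 𝓘(ℝ, E) x₀).symm (𝓝 p) (𝓝 x₀) := by
    have := (continuousAt_extChartAt_symm (I := 𝓘(ℝ, E)) x₀).tendsto
    rwa [extChartAt_to_inv] at this
  have hmap : ∀ φ : M → M, F.Preserves φ → φ x₀ = x₀ → ContinuousAt (mapInChart E x₀ φ) p ∧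
      ∀ᶠ y in 𝓝 p, ContDiffAt ℝ ∞ (mapInChart E x₀ φ) y := by
    intro φ hφ hx
    obtain ⟨U, hU, hφU⟩ := contDiffOn_mapInChart (E := E) hφ.1 (x₀ := x₀)
      (by rw [hx]; exact mem_extChartAt_source x₀)
    exact ⟨(hφU.contDiffAt hU).continuousAt, (eventually_mem_nhds_iff.2 hU).mono
      fun y hy => hφU.contDiffAt hy⟩
  rcases hB with ⟨v, α, hv, hα, rfl⟩ | hB
  · obtain ⟨a, ha, haX⟩ := F.exists_covector x₀ α
    obtain ⟨V, hV, hVv⟩ := exists_contDiff_eventuallyEq hpt (v.inChart_contDiffOn x₀)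
    have hVv' : ∀ᶠ y in 𝓝 p, V =ᶠ[𝓝 y] v.inChart x₀ := hVv.eventually_nhds
    have hαv : ∀ x, ∀ u ∈ F.dist.space x, α x u = 0 := by
      intro x u hu
      obtain ⟨Y, hY, hYs⟩ := F.dist.smooth x u hu
      have := hα Y (.base Y hYs) x
      rw [← hY]
      exact this
    have hΦ : ContDiff ℝ ∞ fun z : E × JetFiber E 1 => -(a (z.2 0 0)) (jetDeriv z.2 (V z.1)) :=
      (((ha.comp (contDiff_jetValue.comp contDiff_snd)).clm_apply
        ((contDiff_jetDeriv.comp contDiff_snd).clm_apply (hV.comp contDiff_fst)))).neg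
    refine ⟨1, _, by simp [maxOrder], hΦ, ?_, fun φ hφ hφx _ => ?_⟩
    · filter_upwards [haX.eventually_nhds, hVv', VField.bracket_inChart_eventually x₀,
        eventually_mem_nhds_iff.2 hpt] with y hay hVy hbr hyt X
      have hXd : DifferentiableAt ℝ (X.inChart x₀) y :=
        ((X.inChart_contDiffOn x₀).contDiffAt hyt).differentiableAt (by simp)
      -- the left hand side
      have h1 : chartFn E x₀ (α.pair (X.bracket v)) y = a y (fderiv ℝ V y (X.inChart x₀ y) -
          fderiv ℝ (X.inChart x₀) y (V y)) := by
        rw [hay.self_of_nhds, hbr, hVy.fderiv_eq, hVy.self_of_nhds]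
      -- the derivative of the relation `α(v) = 0`
      have h2 : fderiv ℝ a y (X.inChart x₀ y) (V y) + a y (fderiv ℝ V y (X.inChart x₀ y)) = 0 := by
        have h3 : (fun z => a z (V z)) =ᶠ[𝓝 y] fun _ => 0 := by
          filter_upwards [hay, hVy] with z hz hVz
          rw [hVz, ← hz v]
          exact hαv _ _ (hv.mem_space le_rfl _)
        have h4 := ((ha.differentiable (by simp)).differentiableAt.hasFDerivAt (x := y)).clm_apply
          ((hV.differentiable (by simp)).differentiableAt.hasFDerivAt (x := y))
        have h5 := h4.fderiv
        rw [h3.fderiv_eq, fderiv_fun_const] at h5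
        have h6 := congrArg (fun L : E →L[ℝ] ℝ => L (X.inChart x₀ y)) h5
        simp at h6
        linarith
      -- the derivative of the equation along the line through the jet of the identity
      have h7 : HasDerivAt (fun t : ℝ => -(a ((coordJet 1 id y + t • coordJet 1 (X.inChart x₀) y) 0 0))
          (jetDeriv (coordJet 1 id y + t • coordJet 1 (X.inChart x₀) y) (V y)))
          (-(fderiv ℝ a y (X.inChart x₀ y) (V y) + a y (fderiv ℝ (X.inChart x₀) y (V y)))) 0 := by
        have h8 : ∀ t : ℝ, (coordJet 1 id y + t • coordJet 1 (X.inChart x₀) y) 0 0 =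
            y + t • X.inChart x₀ y := by
          intro t
          have e1 := coordJet_jetValue (id : E → E) y
          have e2 := coordJet_jetValue (X.inChart x₀) y
          change coordJet 1 id y 0 0 + t • coordJet 1 (X.inChart x₀) y 0 0 = _
          rw [e1, e2]
          rfl
        have h9 : ∀ t : ℝ, jetDeriv (coordJet 1 id y + t • coordJet 1 (X.inChart x₀) y) =
            ContinuousLinearMap.id ℝ E + t • fderiv ℝ (X.inChart x₀) y := by
          intro t
          have e1 := jetDeriv_coordJet (id : E → E) y
          have e2 := jetDeriv_coordJet (X.inChart x₀) y
          rw [fderiv_id] at e1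
          rw [← e1, ← e2]
          simp only [jetDeriv, Pi.add_apply, Pi.smul_apply, map_add, map_smul]
        simp_rw [h8, h9]
        have h10 : HasDerivAt (fun t : ℝ => y + t • X.inChart x₀ y) (X.inChart x₀ y) 0 := by
          simpa using ((hasDerivAt_id (0 : ℝ)).smul_const (X.inChart x₀ y)).const_add y
        have h11 : HasDerivAt (fun t : ℝ => a (y + t • X.inChart x₀ y))
            (fderiv ℝ a y (X.inChart x₀ y)) 0 := by
          have h12 : HasFDerivAt a (fderiv ℝ a y) (y + (0 : ℝ) • X.inChart x₀ y) := by
            rw [zero_smul, add_zero]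
            exact (ha.differentiable (by simp)).differentiableAt.hasFDerivAt
          exact h12.comp_hasDerivAt (0 : ℝ) h10
        have h13 : HasDerivAt (fun t : ℝ => (ContinuousLinearMap.id ℝ E +
            t • fderiv ℝ (X.inChart x₀) y) (V y)) (fderiv ℝ (X.inChart x₀) y (V y)) 0 := by
          have := ((hasDerivAt_id (0 : ℝ)).smul_const
            (fderiv ℝ (X.inChart x₀) y (V y))).const_add (V y)
          simpa using this
        exact (h11.clm_apply h13).neg.congr_deriv (by simp)
      have h15 : HasDerivAt (fun t : ℝ => ((y, coordJet 1 id y) : E × JetFiber E 1) +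
          t • (0, coordJet 1 (X.inChart x₀) y)) (0, coordJet 1 (X.inChart x₀) y) 0 := by
        simpa using ((hasDerivAt_id (0 : ℝ)).smul_const
          ((0, coordJet 1 (X.inChart x₀) y) : E × JetFiber E 1)).const_add (y, coordJet 1 id y)
      have h16 : HasFDerivAt (fun z : E × JetFiber E 1 => -(a (z.2 0 0)) (jetDeriv z.2 (V z.1)))
          (fderiv ℝ (fun z : E × JetFiber E 1 => -(a (z.2 0 0)) (jetDeriv z.2 (V z.1)))
            (y, coordJet 1 id y)) ((y, coordJet 1 id y) +
              (0 : ℝ) • (0, coordJet 1 (X.inChart x₀) y)) := by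
        rw [zero_smul, add_zero]
        exact (hΦ.differentiable (by simp)).differentiableAt.hasFDerivAt
      have h17 := h16.comp_hasDerivAt (0 : ℝ) h15
      have h18 : ((fun z : E × JetFiber E 1 => -(a (z.2 0 0)) (jetDeriv z.2 (V z.1))) ∘
          fun t : ℝ => ((y, coordJet 1 id y) : E × JetFiber E 1) +
            t • (0, coordJet 1 (X.inChart x₀) y)) =
          fun t : ℝ => -(a ((coordJet 1 id y + t • coordJet 1 (X.inChart x₀) y) 0 0))
          (jetDeriv (coordJet 1 id y + t • coordJet 1 (X.inChart x₀) y) (V y)) := by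
        funext t
        simp
      rw [h18] at h17
      change chartFn E x₀ (α.pair (X.bracket v)) y = _
      rw [h1, map_sub]
      have := h17.unique h7
      linarith
    · have hcont := (hmap φ hφ hφx).1
      have htend : Tendsto (mapInChart E x₀ φ) (𝓝 p) (𝓝 p) := by
        have := hcont.tendsto
        rwa [hp, mapInChart_self hφx] at this
      have hsrc : ∀ᶠ y in 𝓝 p, φ ((extChartAt 𝓘(ℝ, E) x₀).symm y) ∈
          (extChartAt 𝓘(ℝ, E) x₀).source :=
        (((hφ.1.continuous.tendsto x₀).comp hsymm).eventually
          (by rw [hφx]; exact extChartAt_source_mem_nhds (I := 𝓘(ℝ, E)) x₀))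
      filter_upwards [htend.eventually haX, hVv, hsrc, hpt, (hmap φ hφ hφx).2]
        with y hay hVy hys hyt hyd
      rw [coordJet_jetValue, jetDeriv_coordJet, hVy, neg_eq_zero]
      set x := (extChartAt 𝓘(ℝ, E) x₀).symm y with hx
      have hxs : x ∈ (extChartAt 𝓘(ℝ, E) x₀).source := (extChartAt 𝓘(ℝ, E) x₀).map_target hyt
      have hxy : extChartAt 𝓘(ℝ, E) x₀ x = y := (extChartAt 𝓘(ℝ, E) x₀).right_inv hyt
      have hmem := hφ.2.1 x _ (hv.mem_space le_rfl x)
      obtain ⟨Y, hY, -⟩ := F.dist.smooth _ _ hmem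
      have hback : (extChartAt 𝓘(ℝ, E) x₀).symm (mapInChart E x₀ φ y) = φ x :=
        (extChartAt 𝓘(ℝ, E) x₀).left_inv hys
      have hYc : Y.inChart x₀ (mapInChart E x₀ φ y) =
          fderiv ℝ (mapInChart E x₀ φ) y (v.inChart x₀ y) := by
        simp only [VField.inChart]
        rw [hback, hY]
        have e1 : (extChartAt 𝓘(ℝ, E) x₀ ∘ φ) =ᶠ[𝓝 x]
            (mapInChart E x₀ φ ∘ extChartAt 𝓘(ℝ, E) x₀) := by
          filter_upwards [(isOpen_extChartAt_source (I := 𝓘(ℝ, E)) x₀).mem_nhds hxs] with z hz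
          simp only [Function.comp, mapInChart]
          rw [(extChartAt 𝓘(ℝ, E) x₀).left_inv hz]
        have hd1 : MDifferentiableAt 𝓘(ℝ, E) 𝓘(ℝ, E) (extChartAt 𝓘(ℝ, E) x₀) (φ x) :=
          mdifferentiableAt_extChartAt (by rwa [← extChartAt_source 𝓘(ℝ, E)])
        have hd2 : MDifferentiableAt 𝓘(ℝ, E) 𝓘(ℝ, E) (extChartAt 𝓘(ℝ, E) x₀) x :=
          mdifferentiableAt_extChartAt (by rwa [← extChartAt_source 𝓘(ℝ, E)])
        have hd3 : MDifferentiableAt 𝓘(ℝ, E) 𝓘(ℝ, E) (mapInChart E x₀ φ)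
            (extChartAt 𝓘(ℝ, E) x₀ x) := by
          rw [hxy]; exact (hyd.differentiableAt (by simp)).mdifferentiableAt
        have e2 := mfderiv_comp_apply x hd1 (hφ.1.mdifferentiableAt (by simp)) (v x)
        have e3 := mfderiv_comp_apply x hd3 hd2 (v x)
        rw [← e1.mfderiv_eq, hxy, mfderiv_eq_fderiv] at e3
        exact e2.symm.trans e3
      have h1 := hay Y
      rw [hYc] at h1
      rw [← h1, chartFn, hback]
      have h2 := hαv _ _ hmem
      rw [← hY] at h2
      exact h2
  · obtain ⟨j, hj⟩ := Set.mem_iUnion.1 hB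
    obtain ⟨Φ₀, W, hW, hpW, hΦ₀, hmem, hBX⟩ := hj x₀
    obtain ⟨Φ, hΦ, hΦΦ⟩ := exists_contDiff_eventuallyEq (hW.mem_nhds hpW) hΦ₀
    have hjetc : ContinuousAt (fun y : E => (y, coordJet (F.order j) id y)) p :=
      continuousAt_id.prodMk (contDiffAt_coordJet contDiffAt_id _).continuousAt
    refine ⟨F.order j, Φ, ?_, hΦ, ?_, fun φ hφ hφx hjet => ?_⟩
    · have := Finset.single_le_sum (f := F.order) (fun _ _ => Nat.zero_le _) (Finset.mem_univ j)
      rw [maxOrder]; omega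
    · filter_upwards [hsymm.eventually hBX, hpt,
        hjetc.eventually hΦΦ.eventually_nhds] with y hy hyt hyΦ X
      rw [chartFn, hy X, (extChartAt 𝓘(ℝ, E) x₀).right_inv hyt]
      have h1 : (fun J => Φ₀ (y, J)) =ᶠ[𝓝 (coordJet (F.order j) id y)] fun J => Φ (y, J) :=
        ((Continuous.prodMk_right y).continuousAt.eventually hyΦ).mono fun J hJ => hJ.symm
      rw [h1.fderiv_eq]
      have h2 : HasFDerivAt (fun J : JetFiber E (F.order j) => (y, J))
          (ContinuousLinearMap.inr ℝ E (JetFiber E (F.order j))) (coordJet (F.order j) id y) :=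
        hasFDerivAt_prodMk_right y _
      have h3 := ((hΦ.differentiable (by simp)).differentiableAt.hasFDerivAt
        (x := (y, coordJet (F.order j) id y))).comp _ h2
      have h4 := h3.fderiv
      have h5 : (Φ ∘ fun J : JetFiber E (F.order j) => (y, J)) = fun J => Φ (y, J) := rfl
      rw [h5] at h4
      rw [h4]
      rfl
    · have hjetφ : ContinuousAt (fun y : E =>
          (y, coordJet (F.order j) (mapInChart E x₀ φ) y)) p :=
        continuousAt_id.prodMk (contDiffAt_coordJet (hmap φ hφ hφx).2.self_of_nhds _).continuousAt
      have hval : (p, coordJet (F.order j) (mapInChart E x₀ φ) p) =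
          (p, coordJet (F.order j) id p) := by rw [hjet]
      have hsrc : ∀ᶠ y in 𝓝 p, φ ((extChartAt 𝓘(ℝ, E) x₀).symm y) ∈
          (extChartAt 𝓘(ℝ, E) x₀).source :=
        (((hφ.1.continuous.tendsto x₀).comp hsymm).eventually
          (by rw [hφx]; exact extChartAt_source_mem_nhds (I := 𝓘(ℝ, E)) x₀))
      have hin : ∀ᶠ y in 𝓝 p, (y, coordJet (F.order j) (mapInChart E x₀ φ) y) ∈ W ∧
          Φ (y, coordJet (F.order j) (mapInChart E x₀ φ) y) =
            Φ₀ (y, coordJet (F.order j) (mapInChart E x₀ φ) y) :=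
        hjetφ.eventually (by
          simp only
          rw [hval]
          exact Filter.Eventually.and (hW.mem_nhds hpW) hΦΦ)
      filter_upwards [hin, hpt, hsrc] with y hy hyt hys
      have hxy := (extChartAt 𝓘(ℝ, E) x₀).right_inv hyt
      have := hmem φ ((extChartAt 𝓘(ℝ, E) x₀).symm y) (hφ.2.2 j _)
        ((extChartAt 𝓘(ℝ, E) x₀).map_target hyt) hys (by rw [hxy]; exact hy.1)
      rw [hxy] at this
      rw [hy.2, this]

end NonlinearEquation

/-! ### Orders of smallness with respect to a gauge -/

section Gauge

open Filter Asymptotics Metric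

variable {E : Type*} [NormedAddCommGroup E] [NormedSpace ℝ E]
  {V : Type*} [NormedAddCommGroup V] [NormedSpace ℝ V]

/-- A gauge: a positive function of small radii `r` bounded by `r`. -/
def IsGauge (b : ℝ → ℝ) : Prop := ∀ᶠ r in 𝓝[>] (0 : ℝ), 0 < b r ∧ b r ≤ r

/-- The map `e` is of order `m` with respect to the gauge `b`: its supremum on the ball of radius
`r` about `p` is bounded by a multiple of `b(r)^m`. -/
def OrderBound (b : ℝ → ℝ) (p : E) (m : ℕ) (e : E → V) : Prop :=
  ∃ C : ℝ, ∀ᶠ r in 𝓝[>] (0 : ℝ), ∀ y ∈ closedBall p r, ‖e y‖ ≤ C * b r ^ m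

theorem isGauge_id : IsGauge fun r => r := by
  filter_upwards [self_mem_nhdsWithin] with r hr
  exact ⟨hr, le_rfl⟩

theorem eventually_forall_closedBall {p : E} {P : E → Prop} (h : ∀ᶠ y in 𝓝 p, P y) :
    ∀ᶠ r in 𝓝[>] (0 : ℝ), ∀ y ∈ closedBall p r, P y := by
  obtain ⟨ε, hε, hball⟩ := Metric.eventually_nhds_iff_ball.1 h
  filter_upwards [Ioo_mem_nhdsGT hε] with r hr y hy
  exact hball y (closedBall_subset_ball hr.2 hy)

variable {b : ℝ → ℝ} {p : E} {m n : ℕ}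

theorem OrderBound.congr' {e e' : E → V} (h : OrderBound b p m e) (he : e =ᶠ[𝓝 p] e') :
    OrderBound b p m e' := by
  obtain ⟨C, hC⟩ := h
  refine ⟨C, ?_⟩
  filter_upwards [hC, eventually_forall_closedBall he] with r hr hr' y hy
  rw [← hr' y hy]
  exact hr y hy

theorem OrderBound.of_norm_le {W : Type*} [NormedAddCommGroup W] {e : E → V} {e' : E → W}
    (h : OrderBound b p m e) {K : ℝ} (hK : 0 ≤ K) (he : ∀ᶠ y in 𝓝 p, ‖e' y‖ ≤ K * ‖e y‖) :
    OrderBound b p m e' := by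
  obtain ⟨C, hC⟩ := h
  refine ⟨K * C, ?_⟩
  filter_upwards [hC, eventually_forall_closedBall he] with r hr hr' y hy
  rw [mul_assoc]
  exact (hr' y hy).trans (mul_le_mul_of_nonneg_left (hr y hy) hK)

theorem OrderBound.exists_nonneg (hb : IsGauge b) {e : E → V} (h : OrderBound b p m e) :
    ∃ C : ℝ, 0 ≤ C ∧ ∀ᶠ r in 𝓝[>] (0 : ℝ), ∀ y ∈ closedBall p r, ‖e y‖ ≤ C * b r ^ m := by
  obtain ⟨C, hC⟩ := h
  refine ⟨|C|, abs_nonneg _, ?_⟩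
  filter_upwards [hC, hb] with r hr hbr y hy
  exact (hr y hy).trans (mul_le_mul_of_nonneg_right (le_abs_self C) (pow_nonneg hbr.1.le m))

theorem OrderBound.add {e e' : E → V} (h : OrderBound b p m e) (h' : OrderBound b p m e') :
    OrderBound b p m fun y => e y + e' y := by
  obtain ⟨C, hC⟩ := h
  obtain ⟨C', hC'⟩ := h'
  refine ⟨C + C', ?_⟩
  filter_upwards [hC, hC'] with r hr hr' y hy
  rw [add_mul]
  exact (norm_add_le _ _).trans (add_le_add (hr y hy) (hr' y hy))

theorem orderBound_zero : OrderBound b p m fun _ => (0 : V) :=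
  ⟨0, Eventually.of_forall fun r y _ => by simp⟩

theorem OrderBound.sum {ι : Type*} (s : Finset ι) {e : ι → E → V}
    (h : ∀ i ∈ s, OrderBound b p m (e i)) : OrderBound b p m fun y => ∑ i ∈ s, e i y := by
  classical
  induction s using Finset.induction_on with
  | empty => simpa using orderBound_zero
  | insert i s hi ih =>
    simp_rw [Finset.sum_insert hi]
    exact (h i (Finset.mem_insert_self i s)).add (ih fun j hj => h j (Finset.mem_insert_of_mem hj))

theorem OrderBound.mono (hb : IsGauge b) {e : E → V} (h : OrderBound b p n e) (hmn : m ≤ n) :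
    OrderBound b p m e := by
  obtain ⟨C, hC0, hC⟩ := h.exists_nonneg hb
  refine ⟨C, ?_⟩
  filter_upwards [hC, hb, Ioo_mem_nhdsGT zero_lt_one] with r hr hbr hr1 y hy
  refine (hr y hy).trans (mul_le_mul_of_nonneg_left ?_ hC0)
  exact pow_le_pow_of_le_one hbr.1.le (hbr.2.trans hr1.2.le) hmn

theorem OrderBound.mul_left {f e : E → ℝ} (hf : ContinuousAt f p) (h : OrderBound b p m e) :
    OrderBound b p m fun y => f y * e y := by
  refine h.of_norm_le (K := |f p| + 1) (by positivity) ?_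
  filter_upwards [hf.abs.eventually (gt_mem_nhds (lt_add_one _))] with y hy
  rw [norm_mul]
  exact mul_le_mul_of_nonneg_right hy.le (norm_nonneg _)

theorem OrderBound.of_vanishesToOrder {e : E → V} (h : VanishesToOrder m e p) :
    OrderBound (fun r => r) p m e := by
  obtain ⟨C, hC0, hC⟩ := h.exists_nonneg
  refine ⟨C, ?_⟩
  filter_upwards [eventually_forall_closedBall hC.bound] with r hr y hy
  refine (hr y hy).trans (mul_le_mul_of_nonneg_left ?_ hC0)
  rw [norm_pow, norm_norm]
  rw [mem_closedBall, dist_eq_norm] at hy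
  gcongr

theorem OrderBound.vanishesToOrder {e : E → V} (h : OrderBound (fun r => r) p m e) :
    VanishesToOrder m e p := by
  obtain ⟨C, hC⟩ := h
  refine IsBigO.of_bound C ?_
  obtain ⟨ε, hε, hsub⟩ := mem_nhdsGT_iff_exists_Ioo_subset.1 hC
  filter_upwards [ball_mem_nhds p hε] with y hy
  rw [norm_pow, norm_norm]
  rcases eq_or_ne y p with rfl | hne
  · rcases m with _ | m
    · simpa using hsub (Set.mem_Ioo.2 ⟨half_pos hε, half_lt_self hε⟩) y
        (mem_closedBall_self (half_pos hε).le)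
    · have hlim : Tendsto (fun r : ℝ => C * r ^ (m + 1)) (𝓝[>] 0) (𝓝 0) := by
        have : Continuous fun r : ℝ => C * r ^ (m + 1) := by fun_prop
        simpa using (this.tendsto 0).mono_left nhdsWithin_le_nhds
      have h0 : ‖e y‖ ≤ 0 := by
        refine ge_of_tendsto hlim ?_
        filter_upwards [hC, self_mem_nhdsWithin] with r hr hr0
        exact hr y (mem_closedBall_self (le_of_lt hr0))
      simpa using h0
  · rw [mem_ball, dist_eq_norm] at hy
    exact hsub (Set.mem_Ioo.2 ⟨norm_pos_iff.2 (sub_ne_zero.2 hne), hy⟩) y (by simp [dist_eq_norm])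

variable [FiniteDimensional ℝ E] [CompleteSpace V]

/-- Differentiation lowers the order with respect to any gauge by one. -/
theorem OrderBound.fderiv (hb : IsGauge b) {e : E → V} {U : Set E} (hU : U ∈ 𝓝 p)
    (he : ContDiffOn ℝ ∞ e U) (h : OrderBound b p (m + 1) e) :
    OrderBound b p m (_root_.fderiv ℝ e) := by
  obtain ⟨g, hg, hge⟩ := exists_contDiff_eventuallyEq hU he
  suffices hs : OrderBound b p m (_root_.fderiv ℝ g) from hs.congr' hge.fderiv
  obtain ⟨C, hC0, hC⟩ := (h.congr' hge.symm).exists_nonneg hb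
  obtain ⟨K, hK0, hK⟩ := exists_norm_fderiv_le_interpolation hg p m
  refine ⟨K * (C + 1), ?_⟩
  filter_upwards [hC, hb, Ioo_mem_nhdsGT zero_lt_one] with r hr hbr hr1 y hy
  refine (hK r hr1.1 hr1.2.le (b r) hbr.1 hbr.2 _ hr y hy).trans (le_of_eq ?_)
  have := hbr.1.ne'
  field_simp
  ring

theorem OrderBound.iteratedFDeriv (hb : IsGauge b) {e : E → V} (he : ContDiff ℝ ∞ e)
    (h : OrderBound b p (m + n) e) : OrderBound b p m (_root_.iteratedFDeriv ℝ n e) := by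
  induction n generalizing m with
  | zero =>
    refine h.of_norm_le zero_le_one (Eventually.of_forall fun y => ?_)
    rw [norm_iteratedFDeriv_zero, one_mul]
  | succ n ih =>
    have h1 : OrderBound b p (m + 1) (_root_.iteratedFDeriv ℝ n e) :=
      ih (by rwa [Nat.add_right_comm, Nat.add_assoc])
    have h2 := h1.fderiv hb univ_mem
      (he.iteratedFDeriv_right (m := ∞) (mod_cast le_top)).contDiffOn
    refine h2.of_norm_le zero_le_one (Eventually.of_forall fun y => ?_)
    rw [norm_fderiv_iteratedFDeriv, one_mul]

theorem OrderBound.coordJet (hb : IsGauge b) {e : E → E} {k : ℕ} (he : ContDiff ℝ ∞ e)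
    (h : OrderBound b p (m + k) e) : OrderBound b p m (FilteredGeometry.coordJet k e) := by
  have : CompleteSpace E := FiniteDimensional.complete ℝ E
  have h1 : ∀ i : Fin (k + 1), OrderBound b p m (_root_.iteratedFDeriv ℝ (i : ℕ) e) := fun i =>
    (h.mono hb (Nat.add_le_add_left (Nat.lt_succ_iff.1 i.2) m)).iteratedFDeriv hb he
  choose C hC using fun i => (h1 i).exists_nonneg hb
  refine ⟨∑ i, C i, ?_⟩
  filter_upwards [eventually_all.2 fun i => (hC i).2, hb] with r hr hbr y hy
  have hbm := pow_nonneg hbr.1.le m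
  refine (pi_norm_le_iff_of_nonneg (mul_nonneg (Finset.sum_nonneg fun i _ => (hC i).1) hbm)).2
    fun i => (hr i y hy).trans (mul_le_mul_of_nonneg_right ?_ hbm)
  exact Finset.single_le_sum (f := C) (fun i _ => (hC i).1) (Finset.mem_univ i)

variable {M : Type*} [TopologicalSpace M] [ChartedSpace E M] [IsManifold 𝓘(ℝ, E) ∞ M]

theorem OrderBound.act (hb : IsGauge b) {x : M} {g : M → ℝ} (hg : IsSmooth E g) (v : VField E M)
    (h : OrderBound b (extChartAt 𝓘(ℝ, E) x x) (m + 1) (chartFn E x g)) :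
    OrderBound b (extChartAt 𝓘(ℝ, E) x x) m (chartFn E x (v.act g)) := by
  have h1 := h.fderiv hb (extChartAt_target_mem_nhds x) (chartFn_contDiffOn x hg)
  refine h1.of_norm_le (K := ‖v.inChart x (extChartAt 𝓘(ℝ, E) x x)‖ + 1) (by positivity) ?_
  filter_upwards [extChartAt_target_mem_nhds x, (v.contDiffAt_inChart x
    (mem_extChartAt_target x)).continuousAt.norm.eventually (gt_mem_nhds (lt_add_one _))]
    with y hy hyv
  rw [v.act_chart x hg hy, mul_comm]
  exact (ContinuousLinearMap.le_opNorm _ _).trans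
    (mul_le_mul_of_nonneg_left hyv.le (norm_nonneg _))

/-- Elements of the module generated by `S` lose a bounded number of orders. -/
theorem DModule.exists_orderBound {S : Set (Op E M)} (hS : ∀ B ∈ S, ∀ X, IsSmooth E (B X))
    {C : Op E M} (hC : DModule S C) (x : M) : ∃ d : ℕ, ∀ (b : ℝ → ℝ), IsGauge b →
      ∀ (m : ℕ) (X : VField E M),
        (∀ B ∈ S, OrderBound b (extChartAt 𝓘(ℝ, E) x x) (m + d) (chartFn E x (B X))) →
        OrderBound b (extChartAt 𝓘(ℝ, E) x x) m (chartFn E x (C X)) := by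
  induction hC with
  | of B hB => exact ⟨0, fun b _ m X h => h B hB⟩
  | zero => exact ⟨0, fun b _ m X _ => orderBound_zero⟩
  | add B C _ _ ihB ihC =>
    obtain ⟨d, hd⟩ := ihB
    obtain ⟨d', hd'⟩ := ihC
    exact ⟨d + d', fun b hb m X h =>
      (hd b hb m X fun B hB => (h B hB).mono hb (by omega)).add
        (hd' b hb m X fun B hB => (h B hB).mono hb (by omega))⟩
  | smul f hf B _ ih =>
    obtain ⟨d, hd⟩ := ih
    refine ⟨d, fun b hb m X h => (hd b hb m X h).mul_left (f := chartFn E x f) ?_⟩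
    exact ((chartFn_contDiffOn x hf).contDiffAt (extChartAt_target_mem_nhds x)).continuousAt
  | deriv v B hB ih =>
    obtain ⟨d, hd⟩ := ih
    exact ⟨d + 1, fun b hb m X h => OrderBound.act hb (hB.smooth hS X) v
      (hd b hb (m + 1) X fun B hB => (h B hB).mono hb (by omega))⟩

end Gauge

/-! ### The formal logarithm of a map close to the identity -/

section FormalLog

open Filter Asymptotics Metric Polynomial

/-- The polynomial `t ↦ t(t-1)⋯(t-j+1)/j!`. -/
def binomPoly (j : ℕ) : ℝ[X] := C ((j.factorial : ℝ)⁻¹) * descPochhammer ℝ j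

theorem binomPoly_eval (j n : ℕ) : (binomPoly j).eval (n : ℝ) = n.choose j := by
  rw [binomPoly, eval_mul, eval_C, descPochhammer_eval_eq_descFactorial,
    Nat.descFactorial_eq_factorial_mul_choose]
  push_cast
  have : (j.factorial : ℝ) ≠ 0 := by positivity
  field_simp

theorem binomPoly_natDegree_le (j : ℕ) : (binomPoly j).natDegree ≤ j := by
  refine (natDegree_C_mul_le _ _).trans (le_of_eq ?_)
  exact descPochhammer_natDegree ℝ j

theorem X_dvd_binomPoly_succ (j : ℕ) : X ∣ binomPoly (j + 1) := by
  rw [X_dvd_iff, coeff_zero_eq_eval_zero]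
  have := binomPoly_eval (j + 1) 0
  simpa using this

theorem binomPoly_one : binomPoly 1 = X := by simp [binomPoly]

/-- Weights that compute, from its values at natural numbers, the derivative at `0` of a
polynomial of bounded degree. -/
theorem exists_derivative_weights (N : ℕ) : ∃ c : Fin (N + 1) → ℝ, ∀ Q : ℝ[X], Q.natDegree ≤ N →
    ∑ n, c n * Q.eval ((n : ℕ) : ℝ) = Q.coeff 1 := by
  obtain ⟨c, hc⟩ := exists_differentiation_weights N
  refine ⟨c, fun Q hQ => ?_⟩
  simp_rw [eval_eq_sum_range' (Nat.lt_succ_of_le hQ), Finset.mul_sum]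
  rw [Finset.sum_comm]
  have h1 : ∀ i ∈ Finset.range (N + 1), ∑ n, c n * (Q.coeff i * ((n : ℕ) : ℝ) ^ i) =
      if i = 1 then Q.coeff 1 else 0 := by
    intro i hi
    have h2 := hc i (Nat.lt_succ_iff.1 (Finset.mem_range.1 hi))
    calc _ = Q.coeff i * ∑ n, c n * ((n : ℕ) : ℝ) ^ i := by
          rw [Finset.mul_sum]; exact Finset.sum_congr rfl fun n _ => by ring
      _ = _ := by
          rw [h2]
          split_ifs with h
          · rw [h, mul_one]
          · rw [mul_zero]
  rw [Finset.sum_congr rfl h1, Finset.sum_ite_eq']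
  split_ifs with h
  · rfl
  · rw [coeff_eq_zero_of_natDegree_lt]
    simp only [Finset.mem_range, not_lt] at h
    omega

variable {E : Type*} [NormedAddCommGroup E] [NormedSpace ℝ E]
  {H : Type*} [NormedAddCommGroup H] [NormedSpace ℝ H]

theorem VanishesToOrder.sum {ι : Type*} (s : Finset ι) {m : ℕ} {p : E} {f : ι → E → H}
    (h : ∀ i ∈ s, VanishesToOrder m (f i) p) : VanishesToOrder m (fun y => ∑ i ∈ s, f i y) p :=
  IsBigO.fun_sum h

/-- Let `Φ` vanish at `ζ_n(y)` for all `n`, where `ζ_n = z + ∑ r, (n choose r+1) g_r` up to order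
`m`. Then the derivative of `Φ` at `z` vanishes, up to order `m`, on the derivative at `n = 0` of
this polynomial in `n`. The Taylor polynomial of `Φ` at `z` turns `ζ_n` into a polynomial in `n`,
the derivative of which at `n = 0` is computed from its values. -/
theorem vanishesToOrder_fderiv_newton {Φ : H → ℝ} (hΦ : ContDiff ℝ ∞ Φ) {p : E} {z : E → H}
    (hz : ContinuousAt z p) {D m : ℕ} (hm : 1 ≤ m) (hmD : m ≤ D) {g : Fin D → E → H}
    (hg : ∀ r, VanishesToOrder 1 (g r) p) {ζ : ℕ → E → H}
    (hζ0 : ∀ n, ∀ᶠ y in 𝓝 p, Φ (ζ n y) = 0)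
    (hζ : ∀ n : ℕ, VanishesToOrder m
      (fun y => ζ n y - z y - ∑ r : Fin D, (n.choose ((r : ℕ) + 1) : ℝ) • g r y) p) :
    VanishesToOrder m
      (fun y => fderiv ℝ Φ (z y) (∑ r : Fin D, (binomPoly ((r : ℕ) + 1)).coeff 1 • g r y)) p := by
  obtain ⟨c, hc⟩ := exists_derivative_weights (D * D)
  let v : ℕ → E → H := fun n y => ∑ r : Fin D, (n.choose ((r : ℕ) + 1) : ℝ) • g r y
  have hv : ∀ n, VanishesToOrder 1 (v n) p := fun n =>
    VanishesToOrder.sum _ fun r _ => (hg r).const_smul_left _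
  let T : ℕ → E → ℝ := fun n y => ∑ i ∈ Finset.range (D + 1),
    ((i.factorial : ℝ)⁻¹ • iteratedFDeriv ℝ i Φ (z y) fun _ => v n y)
  -- the weighted sum of the Taylor polynomials is the derivative at `n = 0`
  have hT : ∀ y, ∑ n : Fin (D * D + 1), c n * T n y =
      fderiv ℝ Φ (z y) (∑ r : Fin D, (binomPoly ((r : ℕ) + 1)).coeff 1 • g r y) := by
    intro y
    have hexp : ∀ (i : ℕ) (w : Fin D → ℝ),
        (iteratedFDeriv ℝ i Φ (z y) fun _ => ∑ r, w r • g r y) =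
        ∑ ρ : Fin i → Fin D, (∏ j, w (ρ j)) * iteratedFDeriv ℝ i Φ (z y) fun j => g (ρ j) y := by
      intro i w
      rw [ContinuousMultilinearMap.map_sum]
      refine Finset.sum_congr rfl fun ρ _ => ?_
      rw [ContinuousMultilinearMap.map_smul_univ, smul_eq_mul]
    have hw : ∀ (i : ℕ) (_ : i ∈ Finset.range (D + 1)) (ρ : Fin i → Fin D),
        ∑ n : Fin (D * D + 1), c n * ∏ j, (((n : ℕ).choose (ρ j + 1) : ℕ) : ℝ) =
          (∏ j, binomPoly (ρ j + 1)).coeff 1 := by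
      intro i hi ρ
      rw [← hc]
      · simp_rw [eval_prod, binomPoly_eval]
      · -- a product of at most `D` factors of degree at most `D`
        refine (natDegree_prod_le _ _).trans ?_
        calc _ ≤ ∑ _j : Fin i, D := Finset.sum_le_sum fun j _ =>
              (binomPoly_natDegree_le _).trans (ρ j).2
          _ ≤ D * D := by
            simp only [Finset.sum_const, Finset.card_univ, Fintype.card_fin, smul_eq_mul]
            exact Nat.mul_le_mul_right _ (Nat.lt_succ_iff.1 (Finset.mem_range.1 hi))
    have hstep : ∀ i ∈ Finset.range (D + 1), ∑ n : Fin (D * D + 1), c n * ((i.factorial : ℝ)⁻¹ •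
        iteratedFDeriv ℝ i Φ (z y) fun _ => v n y) = if i = 1 then
        fderiv ℝ Φ (z y) (∑ r : Fin D, (binomPoly ((r : ℕ) + 1)).coeff 1 • g r y) else 0 := by
      intro i hi
      have h1 : ∑ n : Fin (D * D + 1), c n * ((i.factorial : ℝ)⁻¹ •
          iteratedFDeriv ℝ i Φ (z y) fun _ => v n y) = (i.factorial : ℝ)⁻¹ *
          ∑ ρ : Fin i → Fin D, (∏ j, binomPoly (ρ j + 1)).coeff 1 *
            iteratedFDeriv ℝ i Φ (z y) fun j => g (ρ j) y := by
        simp only [v, hexp, smul_eq_mul, Finset.mul_sum]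
        rw [Finset.sum_comm]
        refine Finset.sum_congr rfl fun ρ _ => ?_
        rw [← hw i hi ρ, Finset.sum_mul, Finset.mul_sum]
        exact Finset.sum_congr rfl fun n _ => by ring
      rw [h1]
      by_cases hi1 : i = 1
      · subst hi1
        rw [if_pos rfl, ← iteratedFDeriv_one_apply (𝕜 := ℝ) (f := Φ) (x := z y)
          (fun _ => ∑ r : Fin D, (binomPoly ((r : ℕ) + 1)).coeff 1 • g r y), hexp]
        simp
      · rw [if_neg hi1]
        refine mul_eq_zero_of_right _ (Finset.sum_eq_zero fun ρ _ => ?_)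
        refine mul_eq_zero_of_left ?_ _
        rcases i with _ | _ | i
        · simp [coeff_one]
        · exact absurd rfl hi1
        · -- the product is divisible by `X ^ 2`
          rw [Fin.prod_univ_succ, Fin.prod_univ_succ, ← mul_assoc]
          have hdvd : X ^ 2 ∣ binomPoly (ρ 0 + 1) * binomPoly (ρ (Fin.succ 0) + 1) := by
            rw [pow_two]
            exact mul_dvd_mul (X_dvd_binomPoly_succ _) (X_dvd_binomPoly_succ _)
          exact X_pow_dvd_iff.1 (hdvd.mul_right _) 1 (by norm_num)
    simp only [T, Finset.mul_sum]
    rw [Finset.sum_comm, Finset.sum_congr rfl hstep, Finset.sum_ite_eq',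
      if_pos (Finset.mem_range.2 (by omega))]
  have hTn : ∀ n, VanishesToOrder m (T n) p := by
    intro n
    -- the Taylor estimate and a Lipschitz estimate near `z p`
    have hcont : Continuous (iteratedFDeriv ℝ (D + 1) Φ) :=
      hΦ.continuous_iteratedFDeriv (by exact_mod_cast le_top)
    have hB : ∀ᶠ u in 𝓝 (z p), ‖iteratedFDeriv ℝ (D + 1) Φ u‖ ≤
        ‖iteratedFDeriv ℝ (D + 1) Φ (z p)‖ + 1 :=
      (hcont.norm.continuousAt.eventually (gt_mem_nhds (lt_add_one _))).mono fun u hu => hu.le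
    obtain ⟨K, t, ht, hlip⟩ := (hΦ.contDiffAt.of_le
      (natCast_le_infty 1) : ContDiffAt ℝ 1 Φ (z p)).exists_lipschitzOnWith
    obtain ⟨ε, hε, hball⟩ := Metric.eventually_nhds_iff_ball.1 (hB.and ht)
    have hv0 : Tendsto (v n) (𝓝 p) (𝓝 0) := by
      refine (hv n).trans_tendsto ?_
      have : Continuous fun y : E => ‖y - p‖ ^ 1 := by fun_prop
      simpa using this.tendsto p
    have hd0 : Tendsto (fun y => ζ n y - z y - v n y) (𝓝 p) (𝓝 0) := by
      refine ((hζ n).mono hm).trans_tendsto ?_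
      have : Continuous fun y : E => ‖y - p‖ ^ 1 := by fun_prop
      simpa using this.tendsto p
    have hz1 : ∀ᶠ y in 𝓝 p, z y ∈ ball (z p) ε := hz.eventually (ball_mem_nhds _ hε)
    have hz2 : ∀ᶠ y in 𝓝 p, z y + v n y ∈ ball (z p) ε := by
      have h1 : Tendsto (fun y => z y + v n y) (𝓝 p) (𝓝 (z p)) := by
        simpa using hz.tendsto.add hv0
      exact h1.eventually (ball_mem_nhds _ hε)
    have hz3 : ∀ᶠ y in 𝓝 p, ζ n y ∈ ball (z p) ε := by
      have h1 : Tendsto (ζ n) (𝓝 p) (𝓝 (z p)) := by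
        have := (hz.tendsto.add hv0).add hd0
        simpa using this
      exact h1.eventually (ball_mem_nhds _ hε)
    have e1 : VanishesToOrder m (fun y => Φ (z y + v n y) - T n y) p := by
      have h1 : (fun y => Φ (z y + v n y) - T n y) =O[𝓝 p] fun y => ‖v n y‖ ^ (D + 1) := by
        refine IsBigO.of_bound (‖iteratedFDeriv ℝ (D + 1) Φ (z p)‖ + 1) ?_
        filter_upwards [hz1, hz2] with y h1 h2
        rw [norm_pow, norm_norm]
        refine norm_sub_taylor_le hΦ D (z y) (v n y) fun s hs => (hball _ ?_).1
        exact (convex_ball (z p) ε).add_smul_mem h1 h2 hs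
      refine VanishesToOrder.mono (n := D + 1) (by omega) (h1.trans ?_)
      simpa using ((hv n).norm_left.pow (D + 1))
    have e2 : VanishesToOrder m (fun y => Φ (ζ n y) - Φ (z y + v n y)) p := by
      refine IsBigO.trans (IsBigO.of_bound K ?_) (hζ n)
      filter_upwards [hz2, hz3] with y h1 h2
      have h3 := hlip.norm_sub_le (hball _ h2).2 (hball _ h1).2
      rwa [← sub_sub] at h3
    have e3 : VanishesToOrder m (fun y => Φ (ζ n y)) p :=
      EventuallyEq.trans_isBigO (f₂ := fun _ => (0 : ℝ)) (hζ0 n)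
        (isBigO_zero (fun y => ‖y - p‖ ^ m) (𝓝 p))
    refine ((e3.sub e2).sub e1).congr_left fun y => ?_
    ring
  refine (VanishesToOrder.sum Finset.univ fun (n : Fin (D * D + 1)) _ =>
    (hTn n).const_mul_left (c n)).congr_left
    fun y => hT y

variable [FiniteDimensional ℝ E]

/-- The iterated differences of the powers of `h` under composition:
`a_0 = id`, `a_{j+1} = a_j ∘ h - a_j`. -/
def newtonTerm (h : E → E) : ℕ → E → E
  | 0 => id
  | j + 1 => fun y => newtonTerm h j (h y) - newtonTerm h j y

/-- The truncation after `D` terms of the formal logarithm `∑ (-1)^(j-1)/j a_j` of `h`. -/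
def newtonLog (h : E → E) (D : ℕ) : E → E :=
  fun y => ∑ r : Fin D, (binomPoly (r + 1)).coeff 1 • newtonTerm h (r + 1) y

variable {h : E → E} {p : E} {s : ℕ}

theorem newtonTerm_contDiff (hh : ContDiff ℝ ∞ h) (j : ℕ) : ContDiff ℝ ∞ (newtonTerm h j) := by
  induction j with
  | zero => exact contDiff_id
  | succ j ih => exact (ih.comp hh).sub ih

theorem newtonLog_contDiff (hh : ContDiff ℝ ∞ h) (D : ℕ) : ContDiff ℝ ∞ (newtonLog h D) :=
  ContDiff.sum fun _ _ => (newtonTerm_contDiff hh _).const_smul _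

/-- Newton's interpolation formula for the iterates of `h`. -/
theorem iterate_eq_sum_newtonTerm (h : E → E) (n : ℕ) {R : ℕ} (hR : n ≤ R) (y : E) :
    h^[n] y = ∑ j ∈ Finset.range (R + 1), (n.choose j : ℝ) • newtonTerm h j y := by
  induction n generalizing R y with
  | zero =>
    rw [Finset.sum_range_succ']
    simp [newtonTerm]
  | succ n ih =>
    obtain ⟨R, rfl⟩ : ∃ R', R = R' + 1 := ⟨R - 1, by omega⟩
    rw [Function.iterate_succ_apply, ih (R := R) (by omega), Finset.sum_range_succ' _ (R + 1)]
    have h1 : ∀ j, newtonTerm h j (h y) = newtonTerm h j y + newtonTerm h (j + 1) y := fun j =>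
      (add_sub_cancel _ _).symm
    have h2 := ih (R := R + 1) (by omega) y
    rw [ih (R := R) (by omega) y, Finset.sum_range_succ' _ (R + 1)] at h2
    simp_rw [h1, smul_add, Finset.sum_add_distrib, Nat.choose_succ_succ', Nat.cast_add, add_smul]
    rw [Finset.sum_add_distrib, h2]
    simp only [Nat.choose_zero_right]
    abel

/-- Composition with a map tangent to the identity to order `s` gains `s - 1` orders. -/
theorem VanishesToOrder.comp_sub {V : Type*} [NormedAddCommGroup V] [NormedSpace ℝ V]
    [CompleteSpace V] {a : E → V} (ha : ContDiff ℝ ∞ a) {r : ℕ} (hr : VanishesToOrder (r + 1) a p)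
    (hs2 : 2 ≤ s) (hs : VanishesToOrder s (fun y => h y - y) p) :
    VanishesToOrder (r + s) (fun y => a (h y) - a y) p := by
  obtain ⟨C, hC0, hC⟩ := (hr.fderiv ha).exists_nonneg
  have hclose : ∀ᶠ y in 𝓝 p, ‖h y - y‖ ≤ ‖y - p‖ := by
    obtain ⟨C', hC'0, hC'⟩ := (hs.mono hs2).exists_nonneg
    have hsm : ∀ᶠ y in 𝓝 p, C' * ‖y - p‖ < 1 := by
      have : Continuous fun y : E => C' * ‖y - p‖ := by fun_prop
      exact this.continuousAt.eventually (gt_mem_nhds (by simp))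
    filter_upwards [hC'.bound, hsm] with y hy hy1
    rw [norm_pow, norm_norm, pow_two, ← mul_assoc] at hy
    exact hy.trans ((mul_le_mul_of_nonneg_right hy1.le (norm_nonneg _)).trans (one_mul _).le)
  obtain ⟨ε, hε, hball⟩ := Metric.eventually_nhds_iff_ball.1 hC.bound
  have hmain : (fun y => a (h y) - a y) =O[𝓝 p] fun y => ‖y - p‖ ^ r * ‖h y - y‖ := by
    refine IsBigO.of_bound (C * 2 ^ r) ?_
    filter_upwards [hclose, ball_mem_nhds p (half_pos hε)] with y hy hyε
    rw [mem_ball, dist_eq_norm] at hyε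
    have h1 := (convex_closedBall p (2 * ‖y - p‖)).norm_image_sub_le_of_norm_fderiv_le (𝕜 := ℝ)
      (f := a) (C := C * (2 * ‖y - p‖) ^ r) (x := y) (y := h y)
      (fun z _ => (ha.differentiable (by simp)).differentiableAt) (fun z hz => ?_)
      (by rw [mem_closedBall, dist_eq_norm]; linarith [norm_nonneg (y - p)]) ?_
    · refine h1.trans (le_of_eq ?_)
      rw [norm_mul, norm_norm, norm_pow, norm_norm]
      ring
    · rw [mem_closedBall, dist_eq_norm] at hz
      refine (hball z ?_).trans ?_
      · rw [mem_ball, dist_eq_norm]; linarith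
      · rw [norm_pow, norm_norm]
        gcongr
    · rw [mem_closedBall, dist_eq_norm]
      calc ‖h y - p‖ = ‖(h y - y) + (y - p)‖ := by congr 1; abel
        _ ≤ 2 * ‖y - p‖ := by linarith [norm_add_le (h y - y) (y - p)]
  refine hmain.trans ?_
  have h2 := (isBigO_refl (fun y => ‖y - p‖ ^ r) (𝓝 p)).mul hs.norm_left
  simpa only [← pow_add] using h2

theorem newtonTerm_vanishesToOrder (hh : ContDiff ℝ ∞ h) (hs2 : 2 ≤ s)
    (hs : VanishesToOrder s (fun y => h y - y) p) (j : ℕ) :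
    VanishesToOrder (s + j) (newtonTerm h (j + 1)) p := by
  have : CompleteSpace E := FiniteDimensional.complete ℝ E
  induction j with
  | zero => exact hs
  | succ j ih =>
    have h1 : VanishesToOrder ((s + j - 1) + 1) (newtonTerm h (j + 1)) p := ih.mono (by omega)
    exact (h1.comp_sub (newtonTerm_contDiff hh _) hs2 hs).mono (by omega)

/-- The first term of the formal logarithm of `h` is `h - id`. -/
theorem newtonLog_sub (hh : ContDiff ℝ ∞ h) (hs2 : 2 ≤ s)
    (hs : VanishesToOrder s (fun y => h y - y) p) {D : ℕ} (hD : 1 ≤ D) :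
    VanishesToOrder (s + 1) (fun y => newtonLog h D y - (h y - y)) p := by
  obtain ⟨D, rfl⟩ : ∃ D', D = D' + 1 := ⟨D - 1, by omega⟩
  have h1 : VanishesToOrder (s + 1) (fun y => ∑ r : Fin D,
      (binomPoly (r + 1 + 1)).coeff 1 • newtonTerm h (r + 1 + 1) y) p :=
    VanishesToOrder.sum _ fun r _ => IsBigO.const_smul_left
      ((newtonTerm_vanishesToOrder hh hs2 hs (r + 1)).mono (by omega)) _
  refine h1.congr_left fun y => ?_
  rw [newtonLog, Fin.sum_univ_succ]
  simp [binomPoly_one, newtonTerm]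

theorem coordJet_add {f g : E → E} (hf : ContDiff ℝ ∞ f) (hg : ContDiff ℝ ∞ g) (k : ℕ) (y : E) :
    coordJet k (f + g) y = coordJet k f y + coordJet k g y := by
  funext m
  exact iteratedFDeriv_add_apply (hf.contDiffAt.of_le (natCast_le_infty _))
    (hg.contDiffAt.of_le (natCast_le_infty _))

theorem coordJet_sum_smul {ι : Type*} (t : Finset ι) (c : ι → ℝ) {f : ι → E → E}
    (hf : ∀ i, ContDiff ℝ ∞ (f i)) (k : ℕ) (y : E) :
    coordJet k (fun y => ∑ i ∈ t, c i • f i y) y = ∑ i ∈ t, c i • coordJet k (f i) y := by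
  classical
  induction t using Finset.induction_on with
  | empty =>
    funext m
    simp only [Finset.sum_empty, coordJet]
    exact congrFun iteratedFDeriv_fun_zero y
  | insert i t hi ih =>
    rw [Finset.sum_insert hi, ← ih]
    have h1 : (fun y => ∑ j ∈ insert i t, c j • f j y) =
        (fun y => c i • f i y) + fun y => ∑ j ∈ t, c j • f j y := by
      funext z
      rw [Finset.sum_insert hi]
      rfl
    rw [h1, coordJet_add ((hf i).const_smul _) (ContDiff.sum fun j _ => (hf j).const_smul _)]
    congr 1
    funext m
    exact iteratedFDeriv_const_smul_apply ((hf i).contDiffAt.of_le (natCast_le_infty _))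

theorem VanishesToOrder.coordJet {f : E → E} (hf : ContDiff ℝ ∞ f) {m k : ℕ}
    (h : VanishesToOrder (m + k) f p) : VanishesToOrder m (FilteredGeometry.coordJet k f) p := by
  have : CompleteSpace E := FiniteDimensional.complete ℝ E
  exact isBigO_pi.2 fun i => VanishesToOrder.iteratedFDeriv hf
    (h.mono (Nat.add_le_add_left (Nat.lt_succ_iff.1 i.2) m))

/-- If all iterates of `h` satisfy the equation `Φ = 0`, the truncated logarithm of `h` satisfies
the equation linearized along the identity up to high order. -/
theorem vanishesToOrder_linearization_newtonLog {k : ℕ} {Φ : E × JetFiber E k → ℝ}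
    (hΦ : ContDiff ℝ ∞ Φ) (hh : ContDiff ℝ ∞ h) (hs2 : 2 ≤ s) (hsk : k + 1 ≤ s)
    (hs : VanishesToOrder s (fun y => h y - y) p)
    (hit : ∀ n, ∀ᶠ y in 𝓝 p, Φ (y, coordJet k h^[n] y) = 0) {D : ℕ} (hD : 1 ≤ D) :
    VanishesToOrder D (fun y => fderiv ℝ Φ (y, coordJet k id y)
      (0, coordJet k (newtonLog h D) y)) p := by
  have hid : ContinuousAt (fun y : E => (y, coordJet k id y)) p :=
    continuousAt_id.prodMk (contDiffAt_coordJet contDiffAt_id k).continuousAt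
  have hjet : ∀ j, VanishesToOrder (j + 1) (coordJet k (newtonTerm h (j + 1))) p := fun j =>
    ((newtonTerm_vanishesToOrder hh hs2 hs j).mono (by omega)).coordJet (newtonTerm_contDiff hh _)
  refine (vanishesToOrder_fderiv_newton hΦ hid (D := D) hD le_rfl
    (g := fun r y => (0, coordJet k (newtonTerm h (r + 1)) y))
    (ζ := fun n y => (y, coordJet k h^[n] y)) (fun r => ?_) hit fun n => ?_).congr_left fun y => ?_
  · exact (isBigO_zero _ _).prod_left ((hjet r).mono (by omega))
  · -- the error consists of the terms of index larger than `D`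
    have h1 : VanishesToOrder D (fun y => ∑ j ∈ Finset.range n, ((n.choose (D + j + 1) : ℕ) : ℝ) •
        coordJet k (newtonTerm h (D + j + 1)) y) p :=
      VanishesToOrder.sum _ fun j _ => IsBigO.const_smul_left
        (VanishesToOrder.mono (by omega : D ≤ D + j + 1) (hjet (D + j))) ((n.choose (D + j + 1) : ℕ) : ℝ)
    refine ((isBigO_zero (fun y => ‖y - p‖ ^ D) (𝓝 p)).prod_left h1 (E' := E)).congr_left
      fun y => ?_
    have h2 : h^[n] = fun y => ∑ j ∈ Finset.range (D + n + 1),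
        (n.choose j : ℝ) • newtonTerm h j y :=
      funext fun y => iterate_eq_sum_newtonTerm h n (by omega) y
    have h3 : coordJet k h^[n] y = ∑ j ∈ Finset.range (D + n + 1),
        (n.choose j : ℝ) • coordJet k (newtonTerm h j) y := by
      rw [h2, coordJet_sum_smul _ _ (newtonTerm_contDiff hh)]
    rw [show D + n + 1 = (D + 1) + n by ring, Finset.sum_range_add, Finset.sum_range_succ',
      ← Fin.sum_univ_eq_sum_range (fun j => ((n.choose (j + 1) : ℕ) : ℝ) •
        coordJet k (newtonTerm h (j + 1)) y)] at h3
    have h4 : coordJet k (newtonTerm h 0) y = coordJet k id y := rfl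
    rw [h4] at h3
    refine Prod.ext ?_ ?_
    · simp [Prod.fst_sum]
    · simp only [Prod.snd_sub, Prod.snd_sum, Prod.smul_snd, h3]
      simp only [Nat.choose_zero_right, Nat.cast_one, one_smul]
      rw [show ∀ a b c d : JetFiber E k, a + b + c - b - d = a - d + c by intros; abel]
      simp [add_right_comm]
  · congr 1
    refine Prod.ext ?_ ?_
    · simp [Prod.fst_sum]
    · simp only [Prod.snd_sum, Prod.smul_snd]
      exact (coordJet_sum_smul Finset.univ (fun r : Fin D => (binomPoly (r + 1)).coeff 1)
        (fun r : Fin D => newtonTerm_contDiff hh (r + 1)) k y).symm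

end FormalLog

/-! ### Maps preserving a structure of finite type near a fixed point -/

section FixedPoint

open Filter Asymptotics Metric

variable {E : Type*} [NormedAddCommGroup E] [NormedSpace ℝ E]
  {M : Type*} [TopologicalSpace M] [ChartedSpace E M]

theorem coordJet_congr {f g : E → E} {p : E} (hfg : f =ᶠ[𝓝 p] g) (k : ℕ) :
    coordJet k f =ᶠ[𝓝 p] coordJet k g := by
  filter_upwards [hfg.eventuallyEq_nhds] with y hy
  funext m
  exact (hy.iteratedFDeriv ℝ m).eq_of_nhds

theorem mapInChart_id (x₀ : M) :
    mapInChart E x₀ id =ᶠ[𝓝 (extChartAt 𝓘(ℝ, E) x₀ x₀)] id := by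
  filter_upwards [extChartAt_target_mem_nhds (I := 𝓘(ℝ, E)) x₀] with y hy
  exact (extChartAt 𝓘(ℝ, E) x₀).right_inv hy

/-- Near a fixed point the expression of an iterate is the iterate of the expression. -/
theorem mapInChart_iterate {x₀ : M} {φ : M → M} (hφ : Continuous φ) (hx₀ : φ x₀ = x₀) {h : E → E}
    (hh : Continuous h) (hhφ : h =ᶠ[𝓝 (extChartAt 𝓘(ℝ, E) x₀ x₀)] mapInChart E x₀ φ) (n : ℕ) :
    h^[n] =ᶠ[𝓝 (extChartAt 𝓘(ℝ, E) x₀ x₀)] mapInChart E x₀ φ^[n] := by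
  set p := extChartAt 𝓘(ℝ, E) x₀ x₀
  have hp : h p = p := by
    rw [hhφ.eq_of_nhds, mapInChart, extChartAt_to_inv, hx₀]
  induction n with
  | zero => exact (mapInChart_id x₀).symm
  | succ n ih =>
    have h1 : Tendsto h (𝓝 p) (𝓝 p) := by simpa [hp] using hh.tendsto p
    have h2 : ∀ᶠ y in 𝓝 p,
        φ ((extChartAt 𝓘(ℝ, E) x₀).symm y) ∈ (extChartAt 𝓘(ℝ, E) x₀).source := by
      have h3 : ContinuousAt (fun y => φ ((extChartAt 𝓘(ℝ, E) x₀).symm y)) p :=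
        hφ.continuousAt.comp (continuousAt_extChartAt_symm (I := 𝓘(ℝ, E)) x₀)
      refine h3.preimage_mem_nhds (extChartAt_source_mem_nhds' ?_)
      simp [p, hx₀]
    filter_upwards [h1.eventually ih, hhφ, h2] with y hy1 hy2 hy3
    rw [Function.iterate_succ_apply, hy1, hy2]
    simp only [mapInChart, Function.iterate_succ_apply]
    rw [(extChartAt 𝓘(ℝ, E) x₀).left_inv hy3]

/-- If `Φ` vanishes at `z` and at `z + v`, its derivative at `z` is quadratically small on `v`. -/
theorem eventually_abs_fderiv_le_sq {H : Type*} [NormedAddCommGroup H] [NormedSpace ℝ H]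
    {Φ : H → ℝ} (hΦ : ContDiff ℝ ∞ Φ) {p : E} {z v : E → H} (hz : ContinuousAt z p)
    (hv : Tendsto v (𝓝 p) (𝓝 0)) (h0 : ∀ᶠ y in 𝓝 p, Φ (z y) = 0)
    (h1 : ∀ᶠ y in 𝓝 p, Φ (z y + v y) = 0) :
    ∃ K : ℝ, 0 ≤ K ∧ ∀ᶠ y in 𝓝 p, ‖fderiv ℝ Φ (z y) (v y)‖ ≤ K * ‖v y‖ ^ 2 := by
  have hcont : Continuous (iteratedFDeriv ℝ 2 Φ) :=
    hΦ.continuous_iteratedFDeriv (natCast_le_infty 2)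
  have hB : ∀ᶠ u in 𝓝 (z p), ‖iteratedFDeriv ℝ 2 Φ u‖ ≤ ‖iteratedFDeriv ℝ 2 Φ (z p)‖ + 1 :=
    (hcont.norm.continuousAt.eventually (gt_mem_nhds (lt_add_one _))).mono fun u hu => hu.le
  obtain ⟨ε, hε, hball⟩ := Metric.eventually_nhds_iff_ball.1 hB
  have hzv : Tendsto (fun y => z y + v y) (𝓝 p) (𝓝 (z p)) := by simpa using hz.tendsto.add hv
  refine ⟨‖iteratedFDeriv ℝ 2 Φ (z p)‖ + 1, by positivity, ?_⟩
  filter_upwards [h0, h1, hz.eventually (ball_mem_nhds _ hε), hzv.eventually (ball_mem_nhds _ hε)]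
    with y hy0 hy1 hy2 hy3
  have h2 := norm_sub_taylor_le hΦ 1 (z y) (v y) (B := ‖iteratedFDeriv ℝ 2 Φ (z p)‖ + 1)
    fun s hs => hball _ ((convex_ball (z p) ε).add_smul_mem hy2 hy3 hs)
  simpa [Finset.sum_range_succ, hy0, hy1] using h2

variable [IsManifold 𝓘(ℝ, E) ∞ M] [FiniteDimensional ℝ E]

theorem OrderBound.of_norm_le_sq {V W : Type*} [NormedAddCommGroup V] [NormedSpace ℝ V]
    [NormedAddCommGroup W] {b : ℝ → ℝ} {p : E} {m : ℕ} {e : E → V} {e' : E → W}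
    (h : OrderBound b p m e) {K : ℝ} (hK : 0 ≤ K) (he : ∀ᶠ y in 𝓝 p, ‖e' y‖ ≤ K * ‖e y‖ ^ 2) :
    OrderBound b p (2 * m) e' := by
  obtain ⟨C, hC⟩ := h
  refine ⟨K * C ^ 2, ?_⟩
  filter_upwards [hC, eventually_forall_closedBall he] with r hr hr' y hy
  refine (hr' y hy).trans ?_
  rw [mul_assoc, mul_comm 2 m, pow_mul, ← mul_pow]
  exact mul_le_mul_of_nonneg_left (pow_le_pow_left₀ (norm_nonneg _) (hr y hy) 2) hK

theorem coordJet_eq_of_vanishesToOrder_sub {f g : E → E} (hf : ContDiff ℝ ∞ f)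
    (hg : ContDiff ℝ ∞ g) {p : E} {k : ℕ} (h : VanishesToOrder (k + 1) (fun y => f y - g y) p) :
    coordJet k f p = coordJet k g p := by
  have : CompleteSpace E := FiniteDimensional.complete ℝ E
  funext m
  have h1 := (vanishesToOrder_iff_iteratedFDeriv (hf.sub hg)).1 h m m.2
  have h2 := iteratedFDeriv_sub_apply (x := p) (i := (m : ℕ)) (𝕜 := ℝ)
    (hf.contDiffAt.of_le (natCast_le_infty _)) (hg.contDiffAt.of_le (natCast_le_infty _))
  exact sub_eq_zero.1 (h2.symm.trans h1)

theorem contDiff_iterate {h : E → E} (hh : ContDiff ℝ ∞ h) (n : ℕ) : ContDiff ℝ ∞ h^[n] := by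
  induction n with
  | zero => exact contDiff_id
  | succ n ih => exact ih.comp hh

theorem vanishesToOrder_iterate_sub {h : E → E} (hh : ContDiff ℝ ∞ h) {s : ℕ} (hs2 : 2 ≤ s) {p : E}
    (hs : VanishesToOrder s (fun y => h y - y) p) (n : ℕ) :
    VanishesToOrder s (fun y => h^[n] y - y) p := by
  have h1 : VanishesToOrder s (fun y => ∑ j ∈ Finset.range n,
      (n.choose (j + 1) : ℝ) • newtonTerm h (j + 1) y) p :=
    VanishesToOrder.sum _ fun j _ => IsBigO.const_smul_left
      (VanishesToOrder.mono (by omega : s ≤ s + j) (newtonTerm_vanishesToOrder hh hs2 hs j))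
      (n.choose (j + 1) : ℝ)
  refine h1.congr_left fun y => ?_
  rw [iterate_eq_sum_newtonTerm h n le_rfl y, Finset.sum_range_succ']
  simp [newtonTerm]

variable [T2Space M] {F : FilteredStructure E M} {κ : ℕ} {x₀ : M} {φ : M → M} {h : E → E}

/-- A map preserving the structure which is tangent to the identity at a fixed point to a high
order is tangent to it to the next order: its truncated formal logarithm satisfies the Lie equation
up to high order, so that the linear system for the prolonged variables applies to it. -/
theorem FilteredStructure.Preserves.vanishesToOrder_succ
    (hκ : F.completed κ x₀ ∩ F.dist.weightedJetKer ((κ : ℤ) - 1) x₀ ⊆ F.dist.weightedJetKer κ x₀)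
    (hφ : F.Preserves φ) (hx₀ : φ x₀ = x₀) (hh : ContDiff ℝ ∞ h)
    (hhφ : h =ᶠ[𝓝 (extChartAt 𝓘(ℝ, E) x₀ x₀)] mapInChart E x₀ φ) {s : ℕ}
    (hs1 : κ + F.depth + F.maxOrder + 1 ≤ s)
    (hs : VanishesToOrder s (fun y => h y - y) (extChartAt 𝓘(ℝ, E) x₀ x₀)) :
    VanishesToOrder (s + 1) (fun y => h y - y) (extChartAt 𝓘(ℝ, E) x₀ x₀) := by
  have : CompleteSpace E := FiniteDimensional.complete ℝ E
  have hmax : 1 ≤ F.maxOrder := Nat.le_add_right _ _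
  have hs2 : 2 ≤ s := by omega
  obtain ⟨A⟩ := F.nonempty_adaptedFrame x₀
  obtain ⟨J, _, C, K, hK, hC, hev⟩ := F.exists_prolongation_bound hκ A
  choose d hd using fun j => (hC j).exists_orderBound (fun _ hB => F.lieOps_smooth hB) x₀
  set p := extChartAt 𝓘(ℝ, E) x₀ x₀
  -- the logarithm is truncated so late that the orders lost in the `C j` do not matter
  let D : ℕ := s + ∑ j, d j
  have hD1 : 1 ≤ D := by simp only [D]; omega
  obtain ⟨X, hX⟩ := F.exists_field_inChart_eq x₀ (newtonLog_contDiff hh D)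
  have hB : ∀ B ∈ F.lieOps, VanishesToOrder D (chartFn E x₀ (B X)) p := by
    intro B hB
    obtain ⟨k, Φ, hk, hΦ, h1, h2⟩ := F.exists_local_equation hB x₀
    have hit : ∀ n, ∀ᶠ y in 𝓝 p, Φ (y, coordJet k h^[n] y) = 0 := by
      intro n
      have h3 := mapInChart_iterate hφ.1.continuous hx₀ hh.continuous hhφ n
      have h4 : coordJet k h^[n] p = coordJet k id p :=
        coordJet_eq_of_vanishesToOrder_sub (contDiff_iterate hh n) contDiff_id
          ((vanishesToOrder_iterate_sub hh hs2 hs n).mono (by omega))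
      have h5 := h2 φ^[n] (hφ.iterate n) (Function.iterate_fixed hx₀ n)
        ((coordJet_congr h3 k).eq_of_nhds.symm.trans h4)
      filter_upwards [h5, coordJet_congr h3 k] with y hy1 hy2
      rw [hy2, hy1]
    refine (vanishesToOrder_linearization_newtonLog hΦ hh hs2 (by omega) hs hit hD1).congr' ?_
    filter_upwards [h1, coordJet_congr hX k] with y hy1 hy2
    rw [hy1 X, hy2]
  have hCX : ∀ j, VanishesToOrder s (chartFn E x₀ (C j X)) p := by
    intro j
    refine (hd j _ isGauge_id s X fun B hBmem => OrderBound.of_vanishesToOrder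
      ((hB B hBmem).mono ?_)).vanishesToOrder
    exact Nat.add_le_add_left (Finset.single_le_sum (f := d) (fun _ _ => Nat.zero_le _)
      (Finset.mem_univ j)) s
  have hlog := newtonLog_sub hh hs2 hs hD1
  have hXs : VanishesToOrder s (X.inChart x₀) p := by
    refine VanishesToOrder.congr' ?_ hX.symm
    refine ((hlog.mono (Nat.le_succ s)).add hs).congr_left fun y => ?_
    abel
  have hu1 : VanishesToOrder 1 (A.prolong ((κ : ℤ) - 1) X) p := by
    refine isBigO_pi.2 fun b => ?_
    have hcard := A.card_le_of_mem_opIdx F b.2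
    exact A.vanishesToOrder_basisOp F b.1 (n := 1) (hXs.mono (by omega))
  have hdiff : ∀ᶠ y in 𝓝 p, DifferentiableAt ℝ (A.prolong ((κ : ℤ) - 1) X) y := by
    filter_upwards [(isOpen_extChartAt_target x₀).mem_nhds (mem_extChartAt_target x₀)] with y hy
    exact ((A.prolong_contDiffOn _ X).contDiffAt
      ((isOpen_extChartAt_target x₀).mem_nhds hy)).differentiableAt (by simp)
  -- the linear system improves the order of vanishing step by step
  have hboot : ∀ r ≤ s, VanishesToOrder (r + 1) (A.prolong ((κ : ℤ) - 1) X) p := by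
    intro r
    induction r with
    | zero => exact fun _ => hu1
    | succ r ih =>
      intro hr
      refine VanishesToOrder.of_fderiv hdiff (hu1.eq_zero one_ne_zero) ?_
      have h1 : VanishesToOrder (r + 1) (fun y => K * ‖A.prolong ((κ : ℤ) - 1) X y‖ +
          K * ∑ j, |chartFn E x₀ (C j X) y|) p :=
        ((ih (by omega)).norm_left.const_mul_left K).add
          ((VanishesToOrder.sum Finset.univ fun j _ =>
            ((hCX j).mono hr).abs_left).const_mul_left K)
      refine IsBigO.trans (IsBigO.of_bound 1 ?_) h1
      filter_upwards [hev] with y hy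
      rw [one_mul]
      exact (hy X).1.trans (le_abs_self _)
  have hXs1 : VanishesToOrder (s + 1) (X.inChart x₀) p := by
    refine IsBigO.trans (IsBigO.of_bound K ?_) (hboot s le_rfl)
    filter_upwards [hev] with y hy using (hy X).2
  refine ((hXs1.congr' hX).sub hlog).congr_left fun y => ?_
  abel

/-- A map preserving the structure which is tangent to the identity to infinite order at a fixed
point is the identity near that point. Its deviation `w` from the identity satisfies the Lie
equation up to an error that is quadratic in a jet of `w`. By interpolation the derivatives of
this error are much smaller than `w` itself, which contradicts the linear system for the prolonged
variables. -/
theorem FilteredStructure.Preserves.eventually_eq_id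
    (hκ : F.completed κ x₀ ∩ F.dist.weightedJetKer ((κ : ℤ) - 1) x₀ ⊆ F.dist.weightedJetKer κ x₀)
    (hφ : F.Preserves φ) (hx₀ : φ x₀ = x₀) (hh : ContDiff ℝ ∞ h)
    (hhφ : h =ᶠ[𝓝 (extChartAt 𝓘(ℝ, E) x₀ x₀)] mapInChart E x₀ φ)
    (hs : ∀ s, VanishesToOrder s (fun y => h y - y) (extChartAt 𝓘(ℝ, E) x₀ x₀)) :
    ∀ᶠ y in 𝓝 (extChartAt 𝓘(ℝ, E) x₀ x₀), h y = y := by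
  by_contra hne
  have : CompleteSpace E := FiniteDimensional.complete ℝ E
  have : ProperSpace E := FiniteDimensional.proper ℝ E
  obtain ⟨A⟩ := F.nonempty_adaptedFrame x₀
  obtain ⟨J, _, C, K, hK, hC, hev⟩ := F.exists_prolongation_bound hκ A
  choose d hd using fun j => (hC j).exists_orderBound (fun _ hB => F.lieOps_smooth hB) x₀
  set p := extChartAt 𝓘(ℝ, E) x₀ x₀
  let w : E → E := fun y => h y - y
  have hw : ContDiff ℝ ∞ w := hh.sub contDiff_id
  -- a point of the ball of radius `r` where the norm of `w` is maximal
  have hmax : ∀ r : ℝ, ∃ z, 0 ≤ r → z ∈ closedBall p r ∧ ∀ y ∈ closedBall p r, ‖w y‖ ≤ ‖w z‖ := by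
    intro r
    by_cases hr : 0 ≤ r
    · obtain ⟨z, hz, hzmax⟩ := (isCompact_closedBall p r).exists_isMaxOn
        (nonempty_closedBall.2 hr) hw.continuous.norm.continuousOn
      exact ⟨z, fun _ => ⟨hz, fun y hy => hzmax hy⟩⟩
    · exact ⟨p, fun h => absurd h hr⟩
  choose z hz using hmax
  have hpos : ∀ r, 0 < r → 0 < ‖w (z r)‖ := by
    intro r hr
    refine (norm_nonneg _).lt_of_ne fun h0 => hne ?_
    filter_upwards [closedBall_mem_nhds p hr] with y hy
    have h1 := (hz r hr.le).2 y hy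
    rw [← h0, norm_le_zero_iff] at h1
    exact sub_eq_zero.1 h1
  -- the quadratic error, of order `2 * m`, exceeds `N` by more than the orders lost in the `C j`
  let m : ℕ := F.maxOrder + ∑ j, d j + 1
  let N : ℕ := F.maxOrder + m
  have hN : N ≠ 0 := by simp only [N, m]; omega
  -- the gauge is chosen such that the supremum of `w` is of order exactly `N`
  let b : ℝ → ℝ := fun r => ‖w (z r)‖ ^ ((N : ℝ)⁻¹)
  have hbN : ∀ r, b r ^ N = ‖w (z r)‖ := fun r => Real.rpow_inv_natCast_pow (norm_nonneg _) hN
  have hb : IsGauge b := by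
    obtain ⟨C', hC'0, hC'⟩ := (hs (N + 1)).exists_nonneg
    have hsmall : ∀ᶠ r in 𝓝[>] (0 : ℝ), C' * r < 1 := by
      have h1 : Continuous fun r : ℝ => C' * r := by fun_prop
      exact (h1.tendsto 0).mono_left nhdsWithin_le_nhds (gt_mem_nhds (by simp))
    filter_upwards [eventually_forall_closedBall hC'.bound, hsmall, self_mem_nhdsWithin]
      with r hr1 hr2 hr0
    have hr0' : 0 < r := hr0
    refine ⟨Real.rpow_pos_of_pos (hpos r hr0) _, ?_⟩
    have h1 := hr1 (z r) (hz r hr0'.le).1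
    have h2 : ‖z r - p‖ ≤ r := by
      rw [← dist_eq_norm]; exact (hz r hr0'.le).1
    refine le_of_pow_le_pow_left₀ hN hr0'.le ?_
    rw [hbN]
    calc ‖w (z r)‖ ≤ C' * ‖z r - p‖ ^ (N + 1) := by simpa using h1
      _ ≤ C' * r ^ (N + 1) := by gcongr
      _ = C' * r * r ^ N := by ring
      _ ≤ 1 * r ^ N := by gcongr
      _ = r ^ N := one_mul _
  have hwb : OrderBound b p N w := by
    refine ⟨1, ?_⟩
    filter_upwards [self_mem_nhdsWithin] with r hr0 y hy
    rw [one_mul, hbN]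
    exact (hz r (le_of_lt hr0)).2 y hy
  obtain ⟨X, hX⟩ := F.exists_field_inChart_eq x₀ hw
  have hB : ∀ B ∈ F.lieOps, OrderBound b p (2 * m) (chartFn E x₀ (B X)) := by
    intro B hB
    obtain ⟨k, Φ, hk, hΦ, h1, h2⟩ := F.exists_local_equation hB x₀
    have hid : ContinuousAt (fun y : E => (y, coordJet k id y)) p :=
      continuousAt_id.prodMk (contDiffAt_coordJet contDiffAt_id k).continuousAt
    have hjw : Tendsto (fun y => ((0 : E), coordJet k w y)) (𝓝 p) (𝓝 0) := by
      have h3 : ContinuousAt (coordJet k w) p :=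
        (contDiffAt_coordJet hw.contDiffAt k).continuousAt
      have h4 : coordJet k w p = 0 :=
        ((hs (1 + k)).coordJet hw).eq_zero one_ne_zero
      have h5 := (continuousAt_const (y := (0 : E))).prodMk h3
      rw [ContinuousAt, h4] at h5
      exact h5
    have hjet : ∀ y, coordJet k h y = coordJet k id y + coordJet k w y := by
      intro y
      rw [← coordJet_add contDiff_id hw]
      congr 1
      funext y
      exact (add_sub_cancel y (h y)).symm
    have h3 : coordJet k h p = coordJet k id p :=
      coordJet_eq_of_vanishesToOrder_sub hh contDiff_id (hs _)
    have hΦh : ∀ᶠ y in 𝓝 p, Φ ((y, coordJet k id y) + (0, coordJet k w y)) = 0 := by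
      filter_upwards [h2 φ hφ hx₀ ((coordJet_congr hhφ k).eq_of_nhds.symm.trans h3),
        coordJet_congr hhφ k] with y hy1 hy2
      rw [Prod.mk_add_mk, add_zero, ← hjet, hy2, hy1]
    have hΦid : ∀ᶠ y in 𝓝 p, Φ (y, coordJet k id y) = 0 := by
      filter_upwards [h2 id F.preserves_id rfl (coordJet_congr (mapInChart_id x₀) k).eq_of_nhds,
        coordJet_congr (mapInChart_id (E := E) x₀) k] with y hy1 hy2
      rw [← hy2, hy1]
    obtain ⟨L, hL0, hL⟩ := eventually_abs_fderiv_le_sq hΦ hid hjw hΦid hΦh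
    have h4 : OrderBound b p m (coordJet k w) :=
      OrderBound.coordJet hb hw (hwb.mono hb (by simp only [N]; omega))
    refine h4.of_norm_le_sq hL0 ?_
    filter_upwards [hL, h1, coordJet_congr hX k] with y hy1 hy2 hy3
    rw [hy2 X, hy3]
    simpa using hy1
  have hCX : OrderBound b p (N + 1) (fun y => ∑ j, |chartFn E x₀ (C j X) y|) := by
    refine OrderBound.sum _ fun j _ => ?_
    have h1 : d j ≤ ∑ j, d j :=
      Finset.single_le_sum (f := d) (fun _ _ => Nat.zero_le _) (Finset.mem_univ j)
    refine OrderBound.of_norm_le (hd j b hb (N + 1) X fun B hBmem => (hB B hBmem).mono hb ?_)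
      zero_le_one (Eventually.of_forall fun y => by simp)
    simp only [N, m]
    omega
  obtain ⟨C₁, hC₁, hCX⟩ := hCX.exists_nonneg hb
  have hu0 : A.prolong ((κ : ℤ) - 1) X p = 0 := by
    funext b
    exact (A.vanishesToOrder_basisOp F b.1 (n := 1)
      (VanishesToOrder.congr' (hs _) hX.symm)).eq_zero one_ne_zero
  have hdiff : ∀ᶠ y in 𝓝 p, DifferentiableAt ℝ (A.prolong ((κ : ℤ) - 1) X) y := by
    filter_upwards [(isOpen_extChartAt_target x₀).mem_nhds (mem_extChartAt_target x₀)] with y hy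
    exact ((A.prolong_contDiffOn _ X).contDiffAt
      ((isOpen_extChartAt_target x₀).mem_nhds hy)).differentiableAt (by simp)
  have hsmall : ∀ᶠ r in 𝓝[>] (0 : ℝ), K * r < 1 / 2 ∧ 2 * K * K * C₁ * r < 1 ∧ r < 1 := by
    have h1 : Continuous fun r : ℝ => K * r := by fun_prop
    have h2 : Continuous fun r : ℝ => 2 * K * K * C₁ * r := by fun_prop
    refine Eventually.filter_mono nhdsWithin_le_nhds (((h1.tendsto 0).eventually
      (gt_mem_nhds (by simp))).and (((h2.tendsto 0).eventually (gt_mem_nhds (by simp))).and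
        (gt_mem_nhds zero_lt_one)))
  obtain ⟨r, hr1, ⟨hr2, hr3, hr4⟩, hr5, hr6, hr7, hr8, hr0⟩ :=
    ((eventually_forall_closedBall hev).and (hsmall.and (hCX.and ((eventually_forall_closedBall
      hdiff).and ((eventually_forall_closedBall hX).and (hb.and self_mem_nhdsWithin)))))).exists
  have hr0' : (0 : ℝ) < r := hr0
  have hu := norm_le_of_norm_fderiv_le (C := K) (ε := K * (C₁ * b r ^ (N + 1))) hr0'.le hr6 hu0 hK
    hr2.le (fun y hy => ((hr1 y hy) X).1.trans (add_le_add_right (mul_le_mul_of_nonneg_left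
      ((le_abs_self _).trans (hr5 y hy)) hK) _)) (z r) (hz r hr0'.le).1
  have h1 : b r ^ N ≤ K * (2 * r * (K * (C₁ * b r ^ (N + 1)))) := by
    have h2 := ((hr1 (z r) (hz r hr0'.le).1) X).2
    rw [hr7 (z r) (hz r hr0'.le).1] at h2
    rw [hbN]
    exact h2.trans (mul_le_mul_of_nonneg_left hu hK)
  have h2 : 0 < b r ^ N := pow_pos hr8.1 N
  have h3 : K * (2 * r * (K * (C₁ * b r ^ (N + 1)))) = 2 * K * K * C₁ * r * b r * b r ^ N := by ring
  have h4 : 2 * K * K * C₁ * r * b r < 1 := by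
    refine lt_of_le_of_lt ?_ hr3
    exact mul_le_of_le_one_right (by positivity) (hr8.2.trans hr4.le)
  rw [h3] at h1
  nlinarith

end FixedPoint

/-! ### Automorphisms are determined by finite jets -/

section Automorphisms

open Filter Asymptotics Metric

variable {E : Type*} [NormedAddCommGroup E] [NormedSpace ℝ E] [FiniteDimensional ℝ E]
  {M : Type*} [TopologicalSpace M] [T2Space M] [ChartedSpace E M] [IsManifold 𝓘(ℝ, E) ∞ M]
  {F : FilteredStructure E M} {κ : ℕ}

theorem FilteredStructure.Preserves.eventuallyEq_id {x₀ : M}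
    (hκ : F.completed κ x₀ ∩ F.dist.weightedJetKer ((κ : ℤ) - 1) x₀ ⊆ F.dist.weightedJetKer κ x₀)
    {φ : M → M} (hφ : F.Preserves φ) (hx₀ : φ x₀ = x₀)
    (hs : VanishesToOrder (κ + F.depth + F.maxOrder + 1) (fun y => mapInChart E x₀ φ y - y)
      (extChartAt 𝓘(ℝ, E) x₀ x₀)) : φ =ᶠ[𝓝 x₀] id := by
  obtain ⟨U, hU, hφU⟩ := contDiffOn_mapInChart hφ.1
    (by rw [hx₀]; exact mem_extChartAt_source (I := 𝓘(ℝ, E)) x₀)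
  obtain ⟨h, hh, hhφ⟩ := exists_contDiff_eventuallyEq hU hφU
  have hall : ∀ j, VanishesToOrder (κ + F.depth + F.maxOrder + 1 + j) (fun y => h y - y)
      (extChartAt 𝓘(ℝ, E) x₀ x₀) := by
    intro j
    induction j with
    | zero => exact hs.congr' (hhφ.mono fun y hy => by simp only [hy])
    | succ j ih => exact hφ.vanishesToOrder_succ hκ hx₀ hh hhφ (Nat.le_add_right _ j) ih
  have hid := hφ.eventually_eq_id hκ hx₀ hh hhφ fun s => (hall s).mono (by omega)
  have hsrc : ∀ᶠ x in 𝓝 x₀, φ x ∈ (extChartAt 𝓘(ℝ, E) x₀).source := by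
    refine hφ.1.continuous.continuousAt.preimage_mem_nhds ?_
    rw [hx₀]
    exact extChartAt_source_mem_nhds x₀
  filter_upwards [(continuousAt_extChartAt (I := 𝓘(ℝ, E)) x₀).eventually (hid.and hhφ), hsrc,
    extChartAt_source_mem_nhds (I := 𝓘(ℝ, E)) x₀] with x hx1 hx2 hx3
  have h1 := hx1.2.symm.trans hx1.1
  rw [mapInChart, (extChartAt 𝓘(ℝ, E) x₀).left_inv hx3] at h1
  exact (extChartAt 𝓘(ℝ, E) x₀).injOn hx2 hx3 h1

/-- The set of points near which a map preserving the structure is the identity is open and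
closed. -/
theorem FilteredStructure.Preserves.eq_id [ConnectedSpace M]
    (hκ : ∀ x, F.completed κ x ∩ F.dist.weightedJetKer ((κ : ℤ) - 1) x ⊆ F.dist.weightedJetKer κ x)
    {φ : M → M} (hφ : F.Preserves φ) {x : M} (hx : φ x = x)
    (hs : VanishesToOrder (κ + F.depth + F.maxOrder + 1) (fun y => mapInChart E x φ y - y)
      (extChartAt 𝓘(ℝ, E) x x)) : φ = id := by
  have : CompleteSpace E := FiniteDimensional.complete ℝ E
  let S : Set M := {x | φ =ᶠ[𝓝 x] id}
  have hopen : IsOpen S := isOpen_setOfPred_eventually_nhds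
  have hclosed : IsClosed S := by
    refine isClosed_of_closure_subset fun x₀ hx₀ => ?_
    have hfix : φ x₀ = x₀ :=
      closure_minimal (fun x hx => EventuallyEq.eq_of_nhds hx)
        (isClosed_eq hφ.1.continuous continuous_id) hx₀
    refine hφ.eventuallyEq_id (hκ x₀) hfix ?_
    obtain ⟨U, hU, hφU⟩ := contDiffOn_mapInChart hφ.1
      (by rw [hfix]; exact mem_extChartAt_source (I := 𝓘(ℝ, E)) x₀)
    obtain ⟨h, hh, hhφ⟩ := exists_contDiff_eventuallyEq hU hφU
    set p := extChartAt 𝓘(ℝ, E) x₀ x₀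
    have hw : ContDiff ℝ ∞ fun y => h y - y := hh.sub contDiff_id
    -- the deviation from the identity vanishes near points arbitrarily close to `p`
    have hfreq : ∃ᶠ y in 𝓝 p, (fun y => h y - y) =ᶠ[𝓝 y] fun _ => 0 := by
      have h1 : ∃ᶠ x in 𝓝 x₀, φ =ᶠ[𝓝 x] id := mem_closure_iff_frequently.1 hx₀
      have h2 : ∃ᶠ x in 𝓝 x₀, (fun y => h y - y) =ᶠ[𝓝 (extChartAt 𝓘(ℝ, E) x₀ x)] fun _ => 0 := by
        refine (h1.and_eventually (((continuousAt_extChartAt (I := 𝓘(ℝ, E)) x₀).eventually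
          hhφ.eventuallyEq_nhds).and (extChartAt_source_mem_nhds (I := 𝓘(ℝ, E)) x₀))).mono ?_
        rintro x ⟨hx1, hx2, hx3⟩
        have hy := (extChartAt 𝓘(ℝ, E) x₀).map_source hx3
        have hsymm := continuousAt_extChartAt_symm'' (I := 𝓘(ℝ, E)) hy
        rw [ContinuousAt, (extChartAt 𝓘(ℝ, E) x₀).left_inv hx3] at hsymm
        filter_upwards [hx2, hsymm.eventually hx1,
          (isOpen_extChartAt_target x₀).mem_nhds hy] with y hy1 hy2 hy3
        rw [hy1, mapInChart, hy2, id, (extChartAt 𝓘(ℝ, E) x₀).right_inv hy3, sub_self]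
      exact (continuousAt_extChartAt (I := 𝓘(ℝ, E)) x₀).frequently h2
    have hzero : ∀ m : ℕ, iteratedFDeriv ℝ m (fun y => h y - y) p = 0 := by
      intro m
      have hcont : Continuous (iteratedFDeriv ℝ m fun y => h y - y) :=
        hw.continuous_iteratedFDeriv (natCast_le_infty m)
      refine (isClosed_singleton.preimage hcont).mem_of_frequently_of_tendsto
        (hfreq.mono fun y hy => ?_) tendsto_id
      change iteratedFDeriv ℝ m _ y = 0
      rw [(hy.iteratedFDeriv ℝ m).eq_of_nhds, iteratedFDeriv_fun_zero]
      rfl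
    have h3 : VanishesToOrder (κ + F.depth + F.maxOrder + 1) (fun y => h y - y) p :=
      (vanishesToOrder_iff_iteratedFDeriv hw).2 fun m _ => hzero m
    exact h3.congr' (hhφ.mono fun y hy => by simp only [hy])
  have huniv : S = Set.univ :=
    IsClopen.eq_univ ⟨hclosed, hopen⟩ ⟨x, hφ.eventuallyEq_id (hκ x) hx hs⟩
  funext y
  have hy : y ∈ S := huniv ▸ Set.mem_univ y
  exact EventuallyEq.eq_of_nhds hy

theorem FilteredStructure.IsAutomorphism.preserves {φ : Diffeomorph 𝓘(ℝ, E) 𝓘(ℝ, E) M M ∞}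
    (hφ : F.IsAutomorphism φ) : F.Preserves φ :=
  ⟨φ.contMDiff, hφ.1, hφ.2⟩

theorem FilteredStructure.IsAutomorphism.preserves_symm
    {φ : Diffeomorph 𝓘(ℝ, E) 𝓘(ℝ, E) M M ∞} (hφ : F.IsAutomorphism φ) : F.Preserves φ.symm := by
  suffices hs : ∀ x y, φ x = y → (∀ v ∈ F.dist.space y,
      mfderiv 𝓘(ℝ, E) 𝓘(ℝ, E) φ.symm y v ∈ F.dist.space (φ.symm y)) ∧
      ∀ j, (F.red j).mem φ.symm y from
    ⟨φ.symm.contMDiff, fun y => (hs _ y (φ.apply_symm_apply y)).1,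
      fun j y => (hs _ y (φ.apply_symm_apply y)).2 j⟩
  rintro x _ rfl
  refine ⟨fun v hv => ?_, fun j => (F.red j).inv φ φ.symm x (hφ.2 j x)
    (φ.symm.isLocalDiffeomorph _) (Eventually.of_forall φ.symm_apply_apply)⟩
  let f : E →L[ℝ] E := mfderiv 𝓘(ℝ, E) 𝓘(ℝ, E) φ x
  let g : E →L[ℝ] E := mfderiv 𝓘(ℝ, E) 𝓘(ℝ, E) φ.symm (φ x)
  have hid : ∀ θ : M → M, θ = id → ∀ u : E, (mfderiv 𝓘(ℝ, E) 𝓘(ℝ, E) θ x : E →L[ℝ] E) u = u := by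
    rintro _ rfl u
    exact DFunLike.congr_fun mfderiv_id u
  have hinv : ∀ u, g (f u) = u := fun u =>
    (DFunLike.congr_fun (mfderiv_comp x (φ.symm.contMDiff.mdifferentiableAt (by simp))
      (φ.contMDiff.mdifferentiableAt (by simp))) u).symm.trans
      (hid (φ.symm ∘ φ) (funext φ.symm_apply_apply) u)
  let Δ : M → Submodule ℝ E := F.dist.space
  -- the derivative maps `Δ_x` into a space of the same dimension
  have hmap : (Δ x).map (f : E →ₗ[ℝ] E) = Δ (φ x) := by
    refine Submodule.eq_of_le_of_finrank_eq ?_ ?_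
    · rintro _ ⟨u, hu, rfl⟩
      exact hφ.1 x u hu
    · obtain ⟨r, hr⟩ := F.dist.rank
      rw [← (Submodule.equivMapOfInjective (f : E →ₗ[ℝ] E)
        (Function.LeftInverse.injective hinv) (Δ x)).finrank_eq]
      exact (hr x).trans (hr (φ x)).symm
  have hv' : v ∈ (Δ x).map (f : E →ₗ[ℝ] E) := hmap ▸ hv
  obtain ⟨u, hu, rfl⟩ := hv'
  have h1 : g (f u) ∈ Δ (φ.symm (φ x)) := by
    rw [hinv, φ.symm_apply_apply]
    exact hu
  exact h1

/-- If two diffeomorphisms have the same jet at `x`, the inverse of the one composed with the other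
is tangent to the identity at `x` to the same order. -/
theorem SameMapJet.vanishesToOrder {φ ψ : Diffeomorph 𝓘(ℝ, E) 𝓘(ℝ, E) M M ∞} {k : ℕ} {x : M}
    (h : SameMapJet E k φ ψ x) : VanishesToOrder (k + 1)
      (fun y => mapInChart E x (ψ.symm ∘ φ) y - y) (extChartAt 𝓘(ℝ, E) x x) := by
  have : CompleteSpace E := FiniteDimensional.complete ℝ E
  obtain ⟨q, hq⟩ : ∃ q, ψ x = q := ⟨_, rfl⟩
  have hφq : φ x = q := h.1.trans hq
  have hjet := h.2
  simp only [writtenInExtChartAt, hq, hφq] at hjet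
  have hqs : q ∈ (extChartAt 𝓘(ℝ, E) q).source := mem_extChartAt_source (I := 𝓘(ℝ, E)) q
  obtain ⟨U, hU, hφU⟩ := contDiffOn_extChartAt_comp (x := x) (q := q) φ.contMDiff (hφq ▸ hqs)
  obtain ⟨V, hV, hψV⟩ := contDiffOn_extChartAt_comp (x := x) (q := q) ψ.contMDiff (hq ▸ hqs)
  have hxq : ψ.symm q = x := by rw [← hq, ψ.symm_apply_apply]
  obtain ⟨W, hW, hgW⟩ := contDiffOn_extChartAt_comp (x := q) (q := x) ψ.symm.contMDiff
    (by rw [hxq]; exact mem_extChartAt_source (I := 𝓘(ℝ, E)) x)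
  set p := extChartAt 𝓘(ℝ, E) x x with hp
  let a : E → E := fun y => extChartAt 𝓘(ℝ, E) q (φ ((extChartAt 𝓘(ℝ, E) x).symm y))
  let c : E → E := fun y => extChartAt 𝓘(ℝ, E) q (ψ ((extChartAt 𝓘(ℝ, E) x).symm y))
  have ha : ContDiffAt ℝ ∞ a p := hφU.contDiffAt hU
  have hc : ContDiffAt ℝ ∞ c p := hψV.contDiffAt hV
  have hap : a p = extChartAt 𝓘(ℝ, E) q q := by simp only [a, p]; rw [extChartAt_to_inv, hφq]
  have hcp : c p = extChartAt 𝓘(ℝ, E) q q := by simp only [c, p]; rw [extChartAt_to_inv, hq]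
  have hac : VanishesToOrder (k + 1) (fun y => a y - c y) p := by
    refine (vanishesToOrder_iff_of_contDiffOn (inter_mem hU hV)
      ((hφU.mono Set.inter_subset_left).sub (hψV.mono Set.inter_subset_right))).2 fun m hm => ?_
    refine (iteratedFDeriv_sub_apply (ha.of_le (natCast_le_infty _))
      (hc.of_le (natCast_le_infty _))).trans ?_
    exact sub_eq_zero.2 (hjet m (by omega))
  obtain ⟨K, t, ht, hlip⟩ := ((hgW.contDiffAt hW).of_le (natCast_le_infty 1)).exists_lipschitzOnWith
  have hmem : ∀ {θ : M → M}, Continuous θ → θ x = q → ∀ᶠ y in 𝓝 p,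
      θ ((extChartAt 𝓘(ℝ, E) x).symm y) ∈ (extChartAt 𝓘(ℝ, E) q).source := by
    intro θ hθ hθx
    have h1 : ContinuousAt (fun y => θ ((extChartAt 𝓘(ℝ, E) x).symm y)) p :=
      hθ.continuousAt.comp (continuousAt_extChartAt_symm (I := 𝓘(ℝ, E)) x)
    refine h1.preimage_mem_nhds (extChartAt_source_mem_nhds' ?_)
    rw [hp, extChartAt_to_inv, hθx]
    exact hqs
  refine IsBigO.trans (IsBigO.of_bound K ?_) hac
  filter_upwards [hmem φ.continuous hφq, hmem ψ.continuous hq,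
    ha.continuousAt.preimage_mem_nhds (hap ▸ ht), hc.continuousAt.preimage_mem_nhds (hcp ▸ ht),
    extChartAt_target_mem_nhds (I := 𝓘(ℝ, E)) x] with y hy1 hy2 hy3 hy4 hy5
  have h1 := hlip.norm_sub_le hy3 hy4
  simp only [a, c] at h1
  rw [(extChartAt 𝓘(ℝ, E) q).left_inv hy1, (extChartAt 𝓘(ℝ, E) q).left_inv hy2,
    ψ.symm_apply_apply, (extChartAt 𝓘(ℝ, E) x).right_inv hy5] at h1
  exact h1

/-- Automorphisms of a structure of finite type are determined by finite jets. -/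
theorem FilteredStructure.automorphism_eq_of_sameMapJet [ConnectedSpace M]
    (hκ : ∀ x, F.completed κ x ∩ F.dist.weightedJetKer ((κ : ℤ) - 1) x ⊆ F.dist.weightedJetKer κ x)
    {φ ψ : Diffeomorph 𝓘(ℝ, E) 𝓘(ℝ, E) M M ∞} (hφ : F.IsAutomorphism φ) (hψ : F.IsAutomorphism ψ)
    {x : M} (h : SameMapJet E (κ + F.depth + F.maxOrder) φ ψ x) : φ = ψ := by
  have hid : ψ.symm ∘ φ = id := by
    refine (hψ.preserves_symm.comp hφ.preserves).eq_id hκ (x := x) ?_ h.vanishesToOrder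
    rw [Function.comp_apply, h.1, ψ.symm_apply_apply]
  ext y
  have h1 := congrArg ψ (congrFun hid y)
  simpa using h1

end Automorphisms

end FilteredGeometry

end

open FilteredGeometry
theorem mainTheorem3 {E : Type*} [NormedAddCommGroup E] [NormedSpace ℝ E] [FiniteDimensional ℝ E]
    {M : Type*} [TopologicalSpace M] [T2Space M] [SecondCountableTopology M] [ConnectedSpace M]
    [ChartedSpace E M] [IsManifold 𝓘(ℝ, E) ∞ M]
    (F : FilteredStructure E M) (hF : F.FiniteType) :
    (∃ k : ℕ, ∀ (x : M) (X Y : VField E M), F.IsSymmetry X → F.IsSymmetry Y →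
      SameFieldJet k X Y x → X = Y) ∧
    (∃ k : ℕ, ∀ (x : M) (φ ψ : Diffeomorph 𝓘(ℝ, E) 𝓘(ℝ, E) M M ∞),
      F.IsAutomorphism φ → F.IsAutomorphism ψ → SameMapJet E k φ ψ x → φ = ψ) ∧
    (∀ (x : M) (X : VField E M) (i s : ℕ),
      X ∈ F.symFiltration i x → X ∉ F.symFiltration (i + 1) x → IsJetDetermined s X x →
      i / F.depth + 1 ≤ s ∧ s ≤ i + 1) := by
  have : CompleteSpace E := FiniteDimensional.complete ℝ E
  obtain ⟨κ, hκ⟩ := hF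
  exact ⟨⟨κ + F.depth, fun x X Y hX hY h => F.symmetry_eq_of_sameFieldJet hκ hX hY h⟩,
    ⟨κ + F.depth + F.maxOrder, fun x φ ψ hφ hψ h =>
      FilteredStructure.automorphism_eq_of_sameMapJet hκ hφ hψ h⟩,
    fun x X i s hX hX' hs => F.jetDetermined_bounds hX hX' hs⟩
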